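/- **Planarity theorem for graphs with a cross structure (Vassiliev's conjecture).** Graphs are finite; loops and multiple edges are allowed. A half-edge is an end of an edge (so a loop has two half-edges at its vertex). An $X$-graph is a graph in which every vertex has degree $4$ (that is, exactly four half-edges issue from it) and in which, for every vertex, a partition of its four half-edges into two pairs is fixed. An $X$-graph is called $X$-planar if it can be drawn in the plane without self-intersections (vertices are distinct points, edges are continuous arcs, simple except that the ends of a loop coincide, meeting each other and the vertices only at common end vertices) so that on going around each vertex the half-edges of the first pair and those of the second pair alternate, i.e. occur in the cyclic order $1212$ and not $1122$. (Going around a vertex $v$ means going along a simple closed curve which lies in an arbitrarily small neighbourhood of $v$, encloses $v$, and meets the drawing in exactly four points, one on each of the four half-edges at $v$.) A non-self-intersecting cycle is a closed walk of length at least $1$ without repeated vertices and without repeated edges (a loop is such a cycle of length $1$). A common vertex of two cycles having no common edges is called a crossing vertex if one of the two cycles passes through this vertex along the two half-edges of one pair. **Theorem.** An $X$-graph is $X$-planar if and only if it does not contain two non-self-intersecting cycles without common edges that have exactly one crossing vertex. -/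

import Mathlib

/-- An `X`-graph with vertex set `V` and set of half-edges `H` (loops and multiple edges are
allowed). An edge is a two-element set `{h, opp h}`; the half-edge `h` issues from the vertex
`vert h`, so that the edge `{h, opp h}` joins `vert h` to `vert (opp h)` and a loop has two
half-edges at the same vertex. Every vertex has exactly four half-edges. The map `partner` encodes
the splitting of the four half-edges at every vertex into two pairs `{h, partner h}`. -/
structure XGraph (V H : Type*) where
  vert : H → V
  opp : H → H
  opp_opp : ∀ h, opp (opp h) = h
  opp_ne : ∀ h, opp h ≠ h
  degree_eq_four : ∀ v, {h | vert h = v}.ncard = 4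
  partner : H → H
  partner_partner : ∀ h, partner (partner h) = h
  partner_ne : ∀ h, partner h ≠ h
  vert_partner : ∀ h, vert (partner h) = vert h

namespace XGraph

variable {V H : Type*}

/-- A non-self-intersecting (simple) cycle of length `len ≥ 1`: a cyclic sequence of edges, the
`i`-th of which is traversed from `vert (dart i)` to `vert (opp (dart i))`, with neither a repeated
vertex nor a repeated edge. A loop is a cycle of length `1`. -/
structure SimpleCycle (G : XGraph V H) where
  len : ℕ
  len_pos : 0 < len
  dart : ZMod len → H
  vert_opp_dart : ∀ i, G.vert (G.opp (dart i)) = G.vert (dart (i + 1))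
  vert_injective : Function.Injective fun i => G.vert (dart i)
  dart_ne_opp_dart : ∀ i j, dart i ≠ G.opp (dart j)

/-- The half-edges of the edges of a cycle. -/
def SimpleCycle.halfEdges {G : XGraph V H} (C : G.SimpleCycle) : Set H :=
  {h | ∃ i, h = C.dart i ∨ h = G.opp (C.dart i)}

/-- The two cycles have no common edges. -/
def SimpleCycle.EdgeDisjoint {G : XGraph V H} (C D : G.SimpleCycle) : Prop :=
  Disjoint C.halfEdges D.halfEdges

/-- The cycle visits the vertex `v`. -/
def SimpleCycle.Visits {G : XGraph V H} (C : G.SimpleCycle) (v : V) : Prop :=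
  ∃ h ∈ C.halfEdges, G.vert h = v

/-- The cycle passes through `v` along the two half-edges of one pair. -/
def SimpleCycle.PassesAlongPair {G : XGraph V H} (C : G.SimpleCycle) (v : V) : Prop :=
  ∃ h, G.vert h = v ∧ h ∈ C.halfEdges ∧ G.partner h ∈ C.halfEdges

/-- `v` is a crossing vertex of the cycles `C` and `D` (used for cycles without common edges):
a common vertex through which one of the cycles passes along the half-edges of one pair. -/
def SimpleCycle.IsCrossingVertex {G : XGraph V H} (C D : G.SimpleCycle) (v : V) : Prop :=
  C.Visits v ∧ D.Visits v ∧ (C.PassesAlongPair v ∨ D.PassesAlongPair v)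

/-- A drawing of the graph in the plane without self-intersections: vertices are distinct points,
and the edge `{h, opp h}` is an arc, parametrized by `arc h` from the end `vert h` (and by
`arc (opp h)` in the opposite direction), which is simple except that its end points coincide when
it is a loop. Distinct arcs meet at common end vertices only, and no arc passes through a vertex. -/
structure PlaneDrawing (G : XGraph V H) where
  pos : V → EuclideanSpace ℝ (Fin 2)
  arc : H → C(unitInterval, EuclideanSpace ℝ (Fin 2))
  arc_zero : ∀ h, arc h 0 = pos (G.vert h)
  arc_opp : ∀ h t, arc (G.opp h) t = arc h (unitInterval.symm t)
  pos_injective : Function.Injective pos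
  arc_ne_pos : ∀ h v, ∀ t ∈ Set.Ioo (0 : unitInterval) 1, arc h t ≠ pos v
  arc_eq_arc : ∀ h k, ∀ s ∈ Set.Ioo (0 : unitInterval) 1, ∀ t ∈ Set.Ioo (0 : unitInterval) 1,
    arc h s = arc k t → (k = h ∧ t = s) ∨ (k = G.opp h ∧ t = unitInterval.symm s)

/-- The subset of the plane covered by the drawing. -/
def PlaneDrawing.image {G : XGraph V H} (D : G.PlaneDrawing) : Set (EuclideanSpace ℝ (Fin 2)) :=
  Set.range D.pos ∪ ⋃ h, Set.range (D.arc h)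

/-- A simple closed curve in the plane, given as a `1`-periodic map. -/
structure IsSimpleClosedCurve (γ : ℝ → EuclideanSpace ℝ (Fin 2)) : Prop where
  continuous : Continuous γ
  periodic : Function.Periodic γ 1
  injOn : Set.InjOn γ (Set.Ico 0 1)

/-- The closed curve `γ` goes around the point `p`: `p` lies in a bounded component of the
complement of the curve. -/
def Encloses (γ : ℝ → EuclideanSpace ℝ (Fin 2)) (p : EuclideanSpace ℝ (Fin 2)) : Prop :=
  p ∉ Set.range γ ∧ Bornology.IsBounded (connectedComponentIn (Set.range γ)ᶜ p)

/-- Going around the vertex `v`, half-edges of the first pair and half-edges of the second pair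
alternate: arbitrarily close to `v` there is a simple closed curve `γ` around `v` that meets the
drawing in exactly four points, lying on the initial halves of the arcs of the four half-edges
`h 0`, `h 1`, `h 2`, `h 3` at `v` and met by `γ` in this order, such that `{h 0, h 2}` and
`{h 1, h 3}` are the two pairs. -/
def PlaneDrawing.AlternatesAt {G : XGraph V H} (D : G.PlaneDrawing) (v : V) : Prop :=
  ∀ r > 0, ∃ γ : ℝ → EuclideanSpace ℝ (Fin 2),
    IsSimpleClosedCurve γ ∧ Encloses γ (D.pos v) ∧ Set.range γ ⊆ Metric.ball (D.pos v) r ∧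
    ∃ (h : Fin 4 → H) (t : Fin 4 → ℝ),
      Function.Injective h ∧ (∀ i, G.vert (h i) = v) ∧
      G.partner (h 0) = h 2 ∧ G.partner (h 1) = h 3 ∧
      StrictMono t ∧ (∀ i, t i ∈ Set.Ico (0 : ℝ) 1) ∧
      (∀ i, ∃ s : unitInterval, (s : ℝ) < 1 / 2 ∧ γ (t i) = D.arc (h i) s) ∧
      ∀ u ∈ Set.Ico (0 : ℝ) 1, γ u ∈ D.image → ∃ i, u = t i

/-- An `X`-graph is `X`-planar if it can be drawn in the plane without self-intersections so that
around every vertex the half-edges of the two pairs alternate. -/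
def IsXPlanar (G : XGraph V H) : Prop :=
  ∃ D : G.PlaneDrawing, ∀ v, D.AlternatesAt v

end XGraph

/-!
A graph with a cross structure is `X`-planar if and only if it does not contain two edge-disjoint
simple cycles with exactly one crossing vertex.

**Necessity.** Suppose that in an alternating drawing the cycle `C` passes its only crossing vertex
with `D` along a pair. Around every other common vertex the two half-edges of `D` follow each other,
so that the rest of `D` can be joined outside `C`. Together with the rest of `C`, and with a small
curve around the crossing vertex as the rim of a wheel, this is a drawing of the complete graph on
five vertices (`not_exists_planar_wheel_with_diagonals`). Such a drawing does not exist
(`not_exists_planar_completeGraph_five`): the winding of the differences of two disjoint edges gives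
one linear equation for each of the fifteen pairs of disjoint edges, and these equations contradict
each other modulo `2`. The Jordan curve theorem is not needed.

**Sufficiency.** Sets of edges are described modulo `2`; a set is even if it meets every vertex in an
even number of half-edges. If two disjoint even sets have an odd number of crossings, then there are
two cycles with exactly one crossing (`exists_unique_crossing_of_odd`): in a minimal example both sets
are cycles, and two crossings could be removed by recombining the cycles. So suppose that the number
of crossings of disjoint even sets is always even.

A smoothing that joins at every vertex half-edges of different pairs decomposes the graph into
circuits. A smoothing with as few circuits as possible passes each vertex twice by the same circuit,
and by the assumption in such a way that the two outgoing half-edges form a pair. Writing the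
circuits one after the other along a line gives a `Layout`, in which every vertex is a chord between
its two passages. If the interlacement graph of these chords were not bipartite, a shortest odd cycle
in it would yield two disjoint even sets with exactly one crossing
(`exists_chord_sets_of_not_colorable`, `Layout.colorable_interlaceGraph`).

A `2`-colouring of the interlacement graph gives a drawing: the circuits run along the line, except
that each second passage through a vertex is pulled to the first one by a pair of parallel parabolic
arches, above or below the line according to the colour, and the closing edge of a circuit starting
at a vertex goes to the side opposite to these arches (`ArchDiagram`, `Layout.archDiagram`). Arches
on one side are nested or disjoint, so that they do not meet (`ArchDiagram.drawing`), and around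
every vertex the pairs alternate (`ArchDiagram.alternatesAt`).
-/

/-! ### The complete graph on five vertices is not planar -/

/-- A nowhere vanishing function on a simply connected space has a continuous logarithm. -/
theorem exists_continuous_log {A : Type*} [TopologicalSpace A] [SimplyConnectedSpace A]
    [LocallyPathConnectedSpace A] (f : A → ℂ) (hf : Continuous f) (h0 : ∀ x, f x ≠ 0) :
    ∃ L : A → ℂ, Continuous L ∧ ∀ x, Complex.exp (L x) = f x := by
  obtain ⟨a₀⟩ : Nonempty A := inferInstance
  obtain ⟨F, ⟨-, hF⟩, -⟩ := Complex.isCoveringMapOn_exp.existsUnique_continuousMap_lifts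
    (⟨f, hf⟩ : C(A, ℂ)) (a₀ := a₀) (e₀ := Complex.log (f a₀)) (Complex.exp_log (h0 a₀))
    (fun a => h0 a)
  exact ⟨F, F.continuous, fun x => congrFun hF x⟩

/-- Two continuous logarithms of proportional functions differ by a constant. -/
theorem sub_eq_sub_of_exp_eq_const_mul_exp (L M : ℝ → ℂ) (hL : Continuous L) (hM : Continuous M)
    (k : ℂ) (h : ∀ x, Complex.exp (L x) = k * Complex.exp (M x)) (x y : ℝ) :
    L x - L y = M x - M y := by
  have key : (fun z => L z - M z) = fun _ => L y - M y := by
    have hcov := Complex.isCoveringMap_exp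
    refine hcov.eq_of_comp_eq (hL.sub hM) continuous_const ?_ y rfl
    funext z
    apply Subtype.ext
    simp only [Function.comp, Complex.exp_sub, h]
    rw [mul_div_cancel_right₀ _ (Complex.exp_ne_zero _),
      mul_div_cancel_right₀ _ (Complex.exp_ne_zero _)]
  have := congrFun key x
  linear_combination this

/-- The order sign of a pair of indices. -/
def orderSign (x y : Fin 5) : ℤ := if x < y then 1 else -1

/-- There are no five points in the plane with arcs joining any two of them such that arcs without
a common end are disjoint. The change of the logarithm of `e i j - P c` along the arc `e i j` is
determined by the five points up to an integer multiple `n i j c` of `2πi`. As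
`e a b s - e c d t` has a logarithm on the whole square, each of the fifteen pairs of disjoint edges
gives a linear equation between these integers; the sum of these equations is contradictory
modulo `2`. -/
theorem not_exists_planar_completeGraph_five (P : Fin 5 → ℂ) (e : Fin 5 → Fin 5 → ℝ → ℂ)
    (hc : ∀ i j, i < j → Continuous (e i j)) (h0 : ∀ i j, i < j → e i j 0 = P i)
    (h1 : ∀ i j, i < j → e i j 1 = P j)
    (hd : ∀ a b c d, a < b → c < d → a ≠ c → a ≠ d → b ≠ c → b ≠ d →
      ∀ s t, e a b s ≠ e c d t) : False := by
  have hPne : ∀ x y, x ≠ y → P x ≠ P y := by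
    have : ∀ x y : Fin 5, x < y → P x ≠ P y := by
      intro x y hxy hP
      obtain ⟨z, w, hzx, hzy, hwx, hwy, hzw⟩ :
          ∃ z w : Fin 5, z ≠ x ∧ z ≠ y ∧ w ≠ x ∧ w ≠ y ∧ z < w := by
        clear * - hxy
        revert x y
        decide
      rcases lt_or_gt_of_ne hzx with h | h <;> rcases lt_or_gt_of_ne hwy with h' | h'
      · exact hd z x w y h h' hzw.ne hzy hwx.symm hxy.ne 1 1 (by rw [h1 _ _ h, h1 _ _ h', hP])
      · exact hd z x y w h h' hzy hzw.ne hxy.ne hwx.symm 1 0 (by rw [h1 _ _ h, h0 _ _ h', hP])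
      · exact hd x z w y h h' hwx.symm hxy.ne hzw.ne hzy 0 1 (by rw [h0 _ _ h, h1 _ _ h', hP])
      · exact hd x z y w h h' hxy.ne hwx.symm hzy hzw.ne 0 0 (by rw [h0 _ _ h, h0 _ _ h', hP])
    intro x y hxy
    rcases lt_or_gt_of_ne hxy with h | h
    · exact this x y h
    · exact (this y x h).symm
  -- logarithms of the differences of the points, with a normalized sign change
  obtain ⟨φ, hφ, hφs⟩ : ∃ φ : Fin 5 → Fin 5 → ℂ,
      (∀ x y, x ≠ y → Complex.exp (φ x y) = P y - P x) ∧
      ∀ x y, x ≠ y → φ x y - φ y x = Real.pi * Complex.I * orderSign x y := by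
    refine ⟨fun x y => if x < y then Complex.log (P y - P x) else
      Complex.log (P x - P y) - Real.pi * Complex.I, fun x y hxy => ?_, fun x y hxy => ?_⟩
    · rcases lt_or_gt_of_ne hxy with h | h
      · simp only [h, if_true]
        exact Complex.exp_log (sub_ne_zero.2 (hPne _ _ hxy.symm))
      · simp only [h.not_gt, if_false]
        rw [Complex.exp_sub, Complex.exp_pi_mul_I, Complex.exp_log (sub_ne_zero.2 (hPne _ _ hxy))]
        ring
    · rcases lt_or_gt_of_ne hxy with h | h
      · simp [h, h.not_gt, orderSign]
      · simp [h, h.not_gt, orderSign]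
  have hne : ∀ i j c, i < j → c ≠ i → c ≠ j → ∀ s, e i j s - P c ≠ 0 := by
    intro i j c hij hci hcj s
    obtain ⟨d, hdi, hdj, hdc⟩ : ∃ d : Fin 5, d ≠ i ∧ d ≠ j ∧ d ≠ c := by
      clear * -; revert i j c; decide
    rw [sub_ne_zero]
    rcases lt_or_gt_of_ne hdc with h | h
    · rw [← h1 d c h]
      exact hd i j d c hij h hdi.symm hci.symm hdj.symm hcj.symm s 1
    · rw [← h0 c d h]
      exact hd i j c d hij h hci.symm hdi.symm hcj.symm hdj.symm s 0
  have hlog : ∀ i j c, i < j → c ≠ i → c ≠ j → ∃ L : ℝ → ℂ, Continuous L ∧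
      ∀ s, Complex.exp (L s) = e i j s - P c := fun i j c hij hci hcj =>
    exists_continuous_log _ ((hc i j hij).sub continuous_const) (hne i j c hij hci hcj)
  choose! Θ hΘc hΘ using hlog
  have hn : ∀ i j c, i < j → c ≠ i → c ≠ j → ∃ n : ℤ,
      Θ i j c 1 - Θ i j c 0 = φ c j - φ c i + n * (2 * Real.pi * Complex.I) := by
    intro i j c hij hci hcj
    have : Complex.exp (Θ i j c 1 - Θ i j c 0) = Complex.exp (φ c j - φ c i) := by
      rw [Complex.exp_sub, Complex.exp_sub, hΘ i j c hij hci hcj, hΘ i j c hij hci hcj,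
        hφ _ _ hci, hφ _ _ hcj, h0 _ _ hij, h1 _ _ hij]
    exact Complex.exp_eq_exp_iff_exists_int.1 this
  choose! n hn using hn
  have hsq : ∀ a b c d, a < b → c < d → a ≠ c → a ≠ d → b ≠ c → b ≠ d →
      orderSign c b + orderSign a c + orderSign b d + orderSign d a +
        2 * (n a b c + n c d b - n a b d - n c d a) = 0 := by
    intro a b c d hab hcd hac had hbc hbd
    obtain ⟨L, hLc, hL⟩ := exists_continuous_log (A := ℝ × ℝ)
      (fun q => e a b q.1 - e c d q.2)
      (((hc a b hab).comp continuous_fst).sub ((hc c d hcd).comp continuous_snd))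
      (fun q => sub_ne_zero.2 (hd a b c d hab hcd hac had hbc hbd _ _))
    have e1 := sub_eq_sub_of_exp_eq_const_mul_exp (fun s => L (s, 0)) (Θ a b c) (by fun_prop)
      (hΘc a b c hab hac.symm hbc.symm) 1
      (fun s => by rw [hL, hΘ a b c hab hac.symm hbc.symm, h0 _ _ hcd, one_mul]) 1 0
    have e2 := sub_eq_sub_of_exp_eq_const_mul_exp (fun s => L (s, 1)) (Θ a b d) (by fun_prop)
      (hΘc a b d hab had.symm hbd.symm) 1
      (fun s => by rw [hL, hΘ a b d hab had.symm hbd.symm, h1 _ _ hcd, one_mul]) 1 0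
    have e3 := sub_eq_sub_of_exp_eq_const_mul_exp (fun s => L (0, s)) (Θ c d a) (by fun_prop)
      (hΘc c d a hcd hac had) (-1)
      (fun s => by rw [hL, hΘ c d a hcd hac had, h0 _ _ hab]; ring) 1 0
    have e4 := sub_eq_sub_of_exp_eq_const_mul_exp (fun s => L (1, s)) (Θ c d b) (by fun_prop)
      (hΘc c d b hcd hbc hbd) (-1)
      (fun s => by rw [hL, hΘ c d b hcd hbc hbd, h1 _ _ hab]; ring) 1 0
    have key : (Real.pi * Complex.I : ℂ) *
        ((orderSign c b + orderSign a c + orderSign b d + orderSign d a +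
        2 * (n a b c + n c d b - n a b d - n c d a) : ℤ) : ℂ) = 0 := by
      push_cast
      linear_combination (e2 - e1 + e3 - e4) - hn a b c hab hac.symm hbc.symm
        + hn a b d hab had.symm hbd.symm + hn c d a hcd hac had - hn c d b hcd hbc hbd
        - hφs c b hbc.symm - hφs a c hac - hφs b d hbd - hφs d a had.symm
    have hpi : (Real.pi * Complex.I : ℂ) ≠ 0 := by simp [Real.pi_ne_zero]
    exact_mod_cast (mul_eq_zero.1 key).resolve_left hpi
  have E1 := hsq 0 1 2 3 (by decide) (by decide) (by decide) (by decide) (by decide) (by decide)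
  have E2 := hsq 0 1 2 4 (by decide) (by decide) (by decide) (by decide) (by decide) (by decide)
  have E3 := hsq 0 1 3 4 (by decide) (by decide) (by decide) (by decide) (by decide) (by decide)
  have E4 := hsq 0 2 1 3 (by decide) (by decide) (by decide) (by decide) (by decide) (by decide)
  have E5 := hsq 0 2 1 4 (by decide) (by decide) (by decide) (by decide) (by decide) (by decide)
  have E6 := hsq 0 2 3 4 (by decide) (by decide) (by decide) (by decide) (by decide) (by decide)
  have E7 := hsq 0 3 1 2 (by decide) (by decide) (by decide) (by decide) (by decide) (by decide)
  have E8 := hsq 0 3 1 4 (by decide) (by decide) (by decide) (by decide) (by decide) (by decide)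
  have E9 := hsq 0 3 2 4 (by decide) (by decide) (by decide) (by decide) (by decide) (by decide)
  have E10 := hsq 0 4 1 2 (by decide) (by decide) (by decide) (by decide) (by decide) (by decide)
  have E11 := hsq 0 4 1 3 (by decide) (by decide) (by decide) (by decide) (by decide) (by decide)
  have E12 := hsq 0 4 2 3 (by decide) (by decide) (by decide) (by decide) (by decide) (by decide)
  have E13 := hsq 1 2 3 4 (by decide) (by decide) (by decide) (by decide) (by decide) (by decide)
  have E14 := hsq 1 3 2 4 (by decide) (by decide) (by decide) (by decide) (by decide) (by decide)
  have E15 := hsq 1 4 2 3 (by decide) (by decide) (by decide) (by decide) (by decide) (by decide)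
  simp (decide := true) only [orderSign, if_true, if_false] at E1 E2 E3 E4 E5 E6 E7 E8
  simp (decide := true) only [orderSign, if_true, if_false] at E9 E10 E11 E12 E13 E14 E15
  omega

/-! ### Cycles in a plane drawing -/

/-- A wheel with four spokes cannot be extended by two disjoint arcs joining opposite points of its
rim: this would be a drawing of the complete graph on five vertices. -/
theorem not_exists_planar_wheel_with_diagonals (o : EuclideanSpace ℝ (Fin 2))
    (a : Fin 4 → EuclideanSpace ℝ (Fin 2)) (S R : Fin 4 → Set (EuclideanSpace ℝ (Fin 2)))
    (X Y : Set (EuclideanSpace ℝ (Fin 2))) (hS : ∀ j, JoinedIn (S j) o (a j))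
    (hR : ∀ j, JoinedIn (R j) (a j) (a (j + 1))) (hX : JoinedIn X (a 0) (a 2))
    (hY : JoinedIn Y (a 1) (a 3)) (hSR : ∀ j k, k ≠ j → k ≠ j + 1 → Disjoint (S k) (R j))
    (hR02 : Disjoint (R 0) (R 2)) (hR13 : Disjoint (R 1) (R 3)) (hXY : Disjoint X Y)
    (hX1 : Disjoint (S 1) X) (hX3 : Disjoint (S 3) X) (hY0 : Disjoint (S 0) Y)
    (hY2 : Disjoint (S 2) Y) : False := by
  let ι : EuclideanSpace ℝ (Fin 2) → ℂ := fun x => ⟨x 0, x 1⟩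
  have hι : Continuous ι := by
    have : ι = fun x => ((x 0 : ℝ) : ℂ) + (x 1 : ℝ) * Complex.I := by
      funext x; exact (Complex.mk_eq_add_mul_I _ _)
    rw [this]; fun_prop
  have hιi : Function.Injective ι := by
    intro x y h
    ext i
    fin_cases i
    · exact congrArg Complex.re h
    · exact congrArg Complex.im h
  let P : Fin 5 → EuclideanSpace ℝ (Fin 2) := ![o, a 0, a 1, a 2, a 3]
  let E : Fin 5 → Fin 5 → Set (EuclideanSpace ℝ (Fin 2)) :=
    ![![∅, S 0, S 1, S 2, S 3], ![∅, ∅, R 0, X, R 3], ![∅, ∅, ∅, R 1, Y], ![∅, ∅, ∅, ∅, R 2],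
      ![∅, ∅, ∅, ∅, ∅]]
  have hE : ∀ i j, i < j → JoinedIn (E i j) (P i) (P j) := by
    intro i j hij
    fin_cases i <;> fin_cases j <;> first | exact absurd hij (by decide) | skip
    exacts [hS 0, hS 1, hS 2, hS 3, hR 0, hX, (hR 3).symm, hR 1, hY, hR 2]
  have hD : ∀ i j k l, i < j → k < l → i ≠ k → i ≠ l → j ≠ k → j ≠ l → i < k →
      Disjoint (E i j) (E k l) := by
    intro i j k l hij hkl hik hil hjk hjl h
    fin_cases i <;> fin_cases j <;> first | exact absurd hij (by decide) | skip
    all_goals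
      fin_cases k <;> first | exact absurd h (by decide) | exact absurd hjk (by decide) | skip
    all_goals
      fin_cases l <;> first | exact absurd hkl (by decide) | exact absurd hjl (by decide) | skip
    exacts [hSR 1 0 (by decide) (by decide), hY0, hSR 2 0 (by decide) (by decide), hX1,
      hSR 3 1 (by decide) (by decide), hSR 2 1 (by decide) (by decide),
      hSR 0 2 (by decide) (by decide), hSR 3 2 (by decide) (by decide), hY2,
      hSR 0 3 (by decide) (by decide), hX3, hSR 1 3 (by decide) (by decide), hR02, hXY, hR13.symm]
  refine not_exists_planar_completeGraph_five (ι ∘ P)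
    (fun i j t => if h : i < j then ι ((hE i j h).somePath.extend t) else 0) ?_ ?_ ?_ ?_
  · intro i j hij
    simp only [hij, dif_pos]
    exact hι.comp (hE i j hij).somePath.continuous_extend
  · intro i j hij
    simp [hij]
  · intro i j hij
    simp [hij]
  · intro i j k l hij hkl hik hil hjk hjl s t h
    simp only [hij, hkl, dif_pos] at h
    have h := hιi h
    have h1 := (hE i j hij).somePath_mem (Set.projIcc 0 1 zero_le_one s)
    have h2 := (hE k l hkl).somePath_mem (Set.projIcc 0 1 zero_le_one t)
    have h' : (hE i j hij).somePath (Set.projIcc 0 1 zero_le_one s) =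
      (hE k l hkl).somePath (Set.projIcc 0 1 zero_le_one t) := h
    rw [h'] at h1
    rcases lt_or_gt_of_ne hik with hlt | hlt
    · exact Set.disjoint_left.1 (hD i j k l hij hkl hik hil hjk hjl hlt) h1 h2
    · exact Set.disjoint_left.1 (hD k l i j hkl hij hik.symm hjk.symm hil.symm hjl.symm hlt) h2 h1

namespace XGraph

variable {V H : Type*}

namespace SimpleCycle

variable {G : XGraph V H}

theorem dart_mem_halfEdges (C : G.SimpleCycle) (i) : C.dart i ∈ C.halfEdges := ⟨i, Or.inl rfl⟩

theorem opp_dart_mem_halfEdges (C : G.SimpleCycle) (i) : G.opp (C.dart i) ∈ C.halfEdges :=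
  ⟨i, Or.inr rfl⟩

theorem opp_mem_halfEdges {C : G.SimpleCycle} {h : H} (hh : h ∈ C.halfEdges) :
    G.opp h ∈ C.halfEdges := by
  obtain ⟨i, rfl | rfl⟩ := hh
  · exact C.opp_dart_mem_halfEdges i
  · rw [G.opp_opp]; exact C.dart_mem_halfEdges i

theorem vert_opp_dart_sub_one (C : G.SimpleCycle) (i) :
    G.vert (G.opp (C.dart (i - 1))) = G.vert (C.dart i) := by
  rw [C.vert_opp_dart, sub_add_cancel]

/-- A cycle has exactly two half-edges at each of its vertices. -/
theorem mem_halfEdges_iff (C : G.SimpleCycle) {i} {h : H} (hv : G.vert h = G.vert (C.dart i)) :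
    h ∈ C.halfEdges ↔ h = C.dart i ∨ h = G.opp (C.dart (i - 1)) := by
  constructor
  · rintro ⟨j, rfl | rfl⟩
    · left; rw [C.vert_injective hv]
    · right
      rw [C.vert_opp_dart] at hv
      rw [← C.vert_injective hv, add_sub_cancel_right]
  · rintro (rfl | rfl)
    · exact C.dart_mem_halfEdges i
    · exact C.opp_dart_mem_halfEdges _

theorem Visits.exists_dart {C : G.SimpleCycle} {v : V} (hv : C.Visits v) :
    ∃ i, G.vert (C.dart i) = v := by
  obtain ⟨h, ⟨i, rfl | rfl⟩, rfl⟩ := hv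
  · exact ⟨i, rfl⟩
  · exact ⟨i + 1, (C.vert_opp_dart i).symm⟩

end SimpleCycle

/-- Four distinct half-edges at a vertex are all half-edges at this vertex. -/
theorem exists_eq_of_vert_eq (G : XGraph V H) {v : V} {h : Fin 4 → H} (hi : Function.Injective h)
    (hv : ∀ i, G.vert (h i) = v) {k : H} (hk : G.vert k = v) : ∃ i, k = h i := by
  have hfin : {x | G.vert x = v}.Finite :=
    Set.finite_of_ncard_ne_zero (by rw [G.degree_eq_four]; decide)
  have hsub : Set.range h ⊆ {x | G.vert x = v} := by rintro _ ⟨i, rfl⟩; exact hv i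
  have heq := Set.eq_of_subset_of_ncard_le hsub (by
    rw [G.degree_eq_four, ← Set.image_univ, Set.ncard_image_of_injective _ hi]
    simp [Set.ncard_univ]) hfin
  have : k ∈ Set.range h := heq ▸ hk
  obtain ⟨i, rfl⟩ := this
  exact ⟨i, rfl⟩

namespace PlaneDrawing

variable {G : XGraph V H} (Δ : G.PlaneDrawing)

/-- The arc of a half-edge, as a function of a real parameter (constant outside `[0, 1]`). -/
noncomputable def arcExt (h : H) (t : ℝ) : EuclideanSpace ℝ (Fin 2) :=
  Δ.arc h (Set.projIcc 0 1 zero_le_one t)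

theorem continuous_arcExt (h : H) : Continuous (Δ.arcExt h) :=
  (Δ.arc h).continuous.comp continuous_projIcc

theorem arcExt_coe (h : H) (t : unitInterval) : Δ.arcExt h t = Δ.arc h t := by
  simp [arcExt]

theorem arcExt_zero (h : H) : Δ.arcExt h 0 = Δ.pos (G.vert h) := by
  have := Δ.arcExt_coe h 0
  rw [Δ.arc_zero] at this
  simpa using this

theorem arcExt_opp (h : H) {t : ℝ} (ht : t ∈ Set.Icc (0 : ℝ) 1) :
    Δ.arcExt (G.opp h) t = Δ.arcExt h (1 - t) := by
  have := Δ.arc_opp h ⟨t, ht⟩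
  rw [← Δ.arcExt_coe, ← Δ.arcExt_coe] at this
  exact this

theorem arcExt_mem_image (h : H) (t : ℝ) : Δ.arcExt h t ∈ Δ.image :=
  Or.inr (Set.mem_iUnion.2 ⟨h, _, rfl⟩)

theorem arcExt_ne_pos (h : H) (v : V) {t : ℝ} (ht : t ∈ Set.Ioo (0 : ℝ) 1) :
    Δ.arcExt h t ≠ Δ.pos v := by
  have := Δ.arc_ne_pos h v ⟨t, ht.1.le, ht.2.le⟩ ⟨ht.1, ht.2⟩
  rwa [← Δ.arcExt_coe] at this

theorem eq_of_arcExt_eq {h k : H} {s t : ℝ} (hs : s ∈ Set.Ioo (0 : ℝ) 1)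
    (ht : t ∈ Set.Ioo (0 : ℝ) 1) (heq : Δ.arcExt h s = Δ.arcExt k t) :
    (k = h ∧ t = s) ∨ (k = G.opp h ∧ t = 1 - s) := by
  have := Δ.arc_eq_arc h k ⟨s, hs.1.le, hs.2.le⟩ ⟨hs.1, hs.2⟩ ⟨t, ht.1.le, ht.2.le⟩ ⟨ht.1, ht.2⟩
    (by rw [← Δ.arcExt_coe, ← Δ.arcExt_coe]; exact heq)
  simpa [Subtype.ext_iff] using this

/-- The part of the drawing covered by the edges of a cycle. -/
def cycleImage (C : G.SimpleCycle) : Set (EuclideanSpace ℝ (Fin 2)) :=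
  {q | ∃ h ∈ C.halfEdges, ∃ t ∈ Set.Icc (0 : ℝ) 1, q = Δ.arcExt h t}

theorem cycleImage_subset_image (C : G.SimpleCycle) : Δ.cycleImage C ⊆ Δ.image := by
  rintro _ ⟨h, -, t, -, rfl⟩
  exact Δ.arcExt_mem_image h t

/-- A point of a cycle is a vertex of the cycle or an interior point of one of its edges. -/
theorem exists_of_mem_cycleImage {C : G.SimpleCycle} {q : EuclideanSpace ℝ (Fin 2)}
    (hq : q ∈ Δ.cycleImage C) :
    (∃ w, C.Visits w ∧ q = Δ.pos w) ∨
      ∃ h ∈ C.halfEdges, ∃ t ∈ Set.Ioo (0 : ℝ) 1, q = Δ.arcExt h t := by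
  obtain ⟨h, hh, t, ht, rfl⟩ := hq
  rcases ht.1.eq_or_lt with rfl | h0
  · exact Or.inl ⟨_, ⟨h, hh, rfl⟩, Δ.arcExt_zero h⟩
  rcases ht.2.eq_or_lt with rfl | h1
  · refine Or.inl ⟨_, ⟨_, SimpleCycle.opp_mem_halfEdges hh, rfl⟩, ?_⟩
    rw [← Δ.arcExt_zero, Δ.arcExt_opp h ⟨le_rfl, zero_le_one⟩, sub_zero]
  · exact Or.inr ⟨h, hh, t, ⟨h0, h1⟩, rfl⟩

theorem arcExt_notMem_cycleImage {C : G.SimpleCycle} {h : H} (hh : h ∉ C.halfEdges) {t : ℝ}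
    (ht : t ∈ Set.Ioo (0 : ℝ) 1) : Δ.arcExt h t ∉ Δ.cycleImage C := by
  intro hq
  rcases Δ.exists_of_mem_cycleImage hq with ⟨w, -, hw⟩ | ⟨k, hk, s, hs, heq⟩
  · exact Δ.arcExt_ne_pos h w ht hw
  · rcases Δ.eq_of_arcExt_eq hs ht heq.symm with ⟨rfl, -⟩ | ⟨rfl, -⟩
    · exact hh hk
    · exact hh (SimpleCycle.opp_mem_halfEdges hk)

theorem pos_notMem_cycleImage {C : G.SimpleCycle} {w : V} (hw : ¬ C.Visits w) :
    Δ.pos w ∉ Δ.cycleImage C := by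
  intro hq
  rcases Δ.exists_of_mem_cycleImage hq with ⟨u, hu, hp⟩ | ⟨k, -, s, hs, heq⟩
  · exact hw (Δ.pos_injective hp ▸ hu)
  · exact Δ.arcExt_ne_pos k w hs heq.symm

theorem joinedIn_arcExt (h : H) {s t : ℝ} {S : Set (EuclideanSpace ℝ (Fin 2))}
    (hS : ∀ u ∈ Set.Icc s t, Δ.arcExt h u ∈ S) (hst : s ≤ t) :
    JoinedIn S (Δ.arcExt h s) (Δ.arcExt h t) := by
  have hc : IsPathConnected (Δ.arcExt h '' Set.Icc s t) :=
    ((convex_Icc s t).isPathConnected (Set.nonempty_Icc.2 hst)).image (Δ.continuous_arcExt h)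
  refine (hc.joinedIn _ ⟨s, ⟨le_rfl, hst⟩, rfl⟩ _ ⟨t, ⟨hst, le_rfl⟩, rfl⟩).mono ?_
  rintro _ ⟨u, hu, rfl⟩
  exact hS u hu

/-- Consecutive half-edges at `v`, in the order in which a small closed curve around `v` meets
them, are joined by sets `R j` (pieces of this curve) that meet the drawing at their ends only. -/
theorem AlternatesAt.exists_rim {v : V} (hv : Δ.AlternatesAt v) :
    ∃ (h : Fin 4 → H) (s : Fin 4 → ℝ) (R : Fin 4 → Set (EuclideanSpace ℝ (Fin 2))),
      Function.Injective h ∧ (∀ i, G.vert (h i) = v) ∧ G.partner (h 0) = h 2 ∧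
      G.partner (h 1) = h 3 ∧ (∀ i, 0 < s i ∧ s i < 1 / 2) ∧
      (∀ j, JoinedIn (R j) (Δ.arcExt (h j) (s j)) (Δ.arcExt (h (j + 1)) (s (j + 1)))) ∧
      (∀ j, ∀ q ∈ R j, q ∈ Δ.image → q = Δ.arcExt (h j) (s j) ∨
        q = Δ.arcExt (h (j + 1)) (s (j + 1))) ∧
      (∀ j, Δ.pos v ∉ R j) ∧ Disjoint (R 0) (R 2) ∧ Disjoint (R 1) (R 3) := by
  obtain ⟨γ, hγ, ⟨hγv, -⟩, -, h, t, hi, hvert, hp0, hp1, ht, ht01, hs, himg⟩ := hv 1 one_pos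
  choose s hs2 hsγ using hs
  have hs0 : ∀ i, 0 < (s i : ℝ) := by
    intro i
    rcases (s i).2.1.eq_or_lt with h0 | h0
    · exfalso
      apply hγv
      refine ⟨t i, ?_⟩
      rw [hsγ i, show s i = 0 from Subtype.ext h0.symm, Δ.arc_zero, hvert i]
    · exact h0
  have h01 : t 0 < t 1 := ht (by decide)
  have h12 : t 1 < t 2 := ht (by decide)
  have h23 : t 2 < t 3 := ht (by decide)
  have hper : γ (t 0 + 1) = γ (t 0) := hγ.periodic (t 0)
  let hi' : Fin 4 → ℝ := ![t 1, t 2, t 3, t 0 + 1]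
  have hγhi : ∀ j, γ (hi' j) = γ (t (j + 1)) := by
    intro j
    fin_cases j
    exacts [rfl, rfl, rfl, hper]
  have hle : ∀ j, t j ≤ hi' j := by
    intro j
    fin_cases j
    exacts [h01.le, h12.le, h23.le, by
      have := (ht01 3).2; have := (ht01 0).1; change t 3 ≤ t 0 + 1; linarith]
  refine ⟨h, fun i => s i, fun j => γ '' Set.Icc (t j) (hi' j), hi, hvert, hp0, hp1,
    fun i => ⟨hs0 i, hs2 i⟩, ?_, ?_, ?_, ?_, ?_⟩
  · intro j
    rw [Δ.arcExt_coe, Δ.arcExt_coe, ← hsγ, ← hsγ, ← hγhi]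
    exact (((convex_Icc (t j) (hi' j)).isPathConnected (Set.nonempty_Icc.2 (hle j))).image
      hγ.continuous).joinedIn _ ⟨_, ⟨le_rfl, hle j⟩, rfl⟩ _ ⟨_, ⟨hle j, le_rfl⟩, rfl⟩
  · rintro j _ ⟨u, hu, rfl⟩ hq
    rw [Δ.arcExt_coe, Δ.arcExt_coe, ← hsγ, ← hsγ]
    by_cases hu1 : u < 1
    · obtain ⟨i, rfl⟩ := himg u ⟨(ht01 j).1.trans hu.1, hu1⟩ hq
      have hji : j ≤ i := ht.le_iff_le.1 hu.1
      have hj : j = 3 ∨ i ≤ j + 1 := by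
        have h2 := hu.2
        clear * - h2 ht
        fin_cases j
        exacts [Or.inr (ht.le_iff_le.1 h2), Or.inr (ht.le_iff_le.1 h2), Or.inr (ht.le_iff_le.1 h2),
          Or.inl rfl]
      have : ∀ i j : Fin 4, j ≤ i → (j = 3 ∨ i ≤ j + 1) → i = j ∨ i = j + 1 := by decide
      have := this i j hji hj
      rcases this with rfl | rfl
      · exact Or.inl rfl
      · exact Or.inr rfl
    · have hj : j = 3 := by
        have h2 := hu.2
        have ha := (ht01 1).2
        have hb := (ht01 2).2
        have hc := (ht01 3).2
        clear * - h2 ha hb hc hu1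
        fin_cases j
        · exact absurd (lt_of_le_of_lt h2 ha) hu1
        · exact absurd (lt_of_le_of_lt h2 hb) hu1
        · exact absurd (lt_of_le_of_lt h2 hc) hu1
        · rfl
      subst hj
      have hu2 : u ≤ t 0 + 1 := hu.2
      have hγu : γ (u - 1) = γ u := by
        have := hγ.periodic (u - 1)
        rw [sub_add_cancel] at this
        exact this.symm
      have h0 := ht01 0
      obtain ⟨i, hi⟩ := himg (u - 1) ⟨by linarith, by linarith [h0.2]⟩ (hγu ▸ hq)
      have : i ≤ 0 := ht.le_iff_le.1 (by linarith)
      have : i = 0 := le_antisymm this (Fin.zero_le _)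
      subst this
      right
      rw [← hγu, hi]
      rfl
  · rintro j ⟨u, -, hu⟩
    exact hγv ⟨u, hu⟩
  · rw [Set.disjoint_left]
    rintro _ ⟨u, hu, rfl⟩ ⟨u', hu', heq⟩
    have hu1 : u ≤ t 1 := hu.2
    have hu2 : u' ≤ t 3 := hu'.2
    have hu3 := hu.1
    have hu4 := hu'.1
    have := hγ.injOn (x₁ := u') (x₂ := u) ⟨by linarith [(ht01 2).1], by linarith [(ht01 3).2]⟩
      ⟨by linarith [(ht01 0).1], by linarith [(ht01 1).2]⟩ heq
    linarith
  · rw [Set.disjoint_left]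
    rintro _ ⟨u, hu, rfl⟩ ⟨u', hu', heq⟩
    have hu1 : u ≤ t 2 := hu.2
    have hu2 : u' ≤ t 0 + 1 := hu'.2
    have hu3 := hu.1
    have hu4 := hu'.1
    have hmem : u ∈ Set.Ico (0 : ℝ) 1 := ⟨by linarith [(ht01 1).1], by linarith [(ht01 2).2]⟩
    by_cases hlt : u' < 1
    · have := hγ.injOn (x₁ := u') (x₂ := u) ⟨by linarith [(ht01 3).1], hlt⟩ hmem heq
      linarith
    · have hγu : γ (u' - 1) = γ u' := by
        have := hγ.periodic (u' - 1)
        rw [sub_add_cancel] at this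
        exact this.symm
      have := hγ.injOn (x₁ := u' - 1) (x₂ := u)
        ⟨by linarith, by linarith [(ht01 0).2]⟩ hmem (hγu.trans heq)
      linarith

/-- Going once around a cycle, from the middle of the first edge after `v` to the middle of the last
edge before `v`, through sets joining the middles of consecutive edges. -/
theorem joinedIn_around (C : G.SimpleCycle) (S : Set (EuclideanSpace ℝ (Fin 2)))
    (hmem : ∀ i, Δ.arcExt (C.dart i) (1 / 2) ∈ S) (i₀ : ZMod C.len)
    (hS : ∀ i, i ≠ i₀ →
      JoinedIn S (Δ.arcExt (C.dart (i - 1)) (1 / 2)) (Δ.arcExt (C.dart i) (1 / 2))) :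
    JoinedIn S (Δ.arcExt (C.dart i₀) (1 / 2)) (Δ.arcExt (C.dart (i₀ - 1)) (1 / 2)) := by
  have key : ∀ n : ℕ, n < C.len →
      JoinedIn S (Δ.arcExt (C.dart i₀) (1 / 2)) (Δ.arcExt (C.dart (i₀ + n)) (1 / 2)) := by
    intro n
    induction n with
    | zero => intro _; simpa using JoinedIn.refl (hmem i₀)
    | succ n ih =>
      intro hn
      refine (ih (by omega)).trans ?_
      have := hS (i₀ + (n + 1 : ℕ)) (by
        intro h
        have h0 : ((n + 1 : ℕ) : ZMod C.len) = 0 := by simpa using h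
        have := Nat.le_of_dvd (Nat.succ_pos n) ((ZMod.natCast_eq_zero_iff _ _).1 h0)
        omega)
      rwa [show i₀ + ((n + 1 : ℕ) : ZMod C.len) - 1 = i₀ + n by push_cast; ring] at this
  have h := key (C.len - 1) (by have := C.len_pos; omega)
  have hc : ((C.len - 1 : ℕ) : ZMod C.len) = -1 := by
    rw [Nat.cast_sub C.len_pos]
    simp
  rwa [hc, ← sub_eq_add_neg] at h

end PlaneDrawing
end XGraph

namespace XGraph

variable {V H : Type*} {G : XGraph V H}

theorem SimpleCycle.EdgeDisjoint.notMem_left {C D : G.SimpleCycle} (h : C.EdgeDisjoint D) {k : H}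
    (hk : k ∈ D.halfEdges) : k ∉ C.halfEdges := fun hC => Set.disjoint_left.1 h hC hk

theorem SimpleCycle.EdgeDisjoint.symm {C D : G.SimpleCycle} (h : C.EdgeDisjoint D) :
    D.EdgeDisjoint C := Disjoint.symm h

theorem SimpleCycle.IsCrossingVertex.symm {C D : G.SimpleCycle} {v : V}
    (h : C.IsCrossingVertex D v) : D.IsCrossingVertex C v := ⟨h.2.1, h.1, h.2.2.symm⟩

theorem SimpleCycle.dart_ne_opp_dart_sub_one (C : G.SimpleCycle) (i) :
    C.dart i ≠ G.opp (C.dart (i - 1)) := C.dart_ne_opp_dart i _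

/-- Two edge-disjoint cycles through a vertex use all its half-edges. -/
theorem SimpleCycle.EdgeDisjoint.mem_or_mem {C D : G.SimpleCycle} (h : C.EdgeDisjoint D) {v : V}
    (hC : C.Visits v) (hD : D.Visits v) {k : H} (hk : G.vert k = v) :
    k ∈ C.halfEdges ∨ k ∈ D.halfEdges := by
  obtain ⟨i, hi⟩ := hC.exists_dart
  obtain ⟨j, hj⟩ := hD.exists_dart
  have hCD : ∀ x ∈ C.halfEdges, ∀ y ∈ D.halfEdges, x ≠ y := fun x hx y hy hxy =>
    h.notMem_left hy (hxy ▸ hx)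
  have c1 := C.dart_mem_halfEdges i
  have c2 := C.opp_dart_mem_halfEdges (i - 1)
  have d1 := D.dart_mem_halfEdges j
  have d2 := D.opp_dart_mem_halfEdges (j - 1)
  have hinj : Function.Injective
      ![C.dart i, G.opp (C.dart (i - 1)), D.dart j, G.opp (D.dart (j - 1))] := by
    have e1 := C.dart_ne_opp_dart_sub_one i
    have e2 := D.dart_ne_opp_dart_sub_one j
    have e3 := hCD _ c1 _ d1
    have e4 := hCD _ c1 _ d2
    have e5 := hCD _ c2 _ d1
    have e6 := hCD _ c2 _ d2
    intro x y hxy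
    fin_cases x <;> fin_cases y <;> first
      | rfl
      | exact absurd hxy e1 | exact absurd hxy e2 | exact absurd hxy e3 | exact absurd hxy e4
      | exact absurd hxy e5 | exact absurd hxy e6 | exact absurd hxy.symm e1
      | exact absurd hxy.symm e2 | exact absurd hxy.symm e3 | exact absurd hxy.symm e4
      | exact absurd hxy.symm e5 | exact absurd hxy.symm e6
  obtain ⟨m, rfl⟩ := G.exists_eq_of_vert_eq hinj (v := v) (by
    intro x
    fin_cases x
    exacts [hi, (C.vert_opp_dart_sub_one i).trans hi, hj, (D.vert_opp_dart_sub_one j).trans hj]) hk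
  fin_cases m
  exacts [Or.inl c1, Or.inl c2, Or.inr d1, Or.inr d2]

namespace PlaneDrawing

variable (Δ : G.PlaneDrawing)

theorem arcExt_opp_half (h : H) : Δ.arcExt (G.opp h) (1 / 2) = Δ.arcExt h (1 / 2) := by
  rw [Δ.arcExt_opp h ⟨by norm_num, by norm_num⟩]
  norm_num

/-- The rest of a cycle joins its two half-edges at `v`, through sets joining the half-edges at the
other vertices of the cycle. -/
theorem joinedIn_around_vertex (C : G.SimpleCycle) (S : Set (EuclideanSpace ℝ (Fin 2)))
    (hmem : ∀ i, Δ.arcExt (C.dart i) (1 / 2) ∈ S) {v : V}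
    (hS : ∀ h ∈ C.halfEdges, ∀ k ∈ C.halfEdges, G.vert h = G.vert k → G.vert h ≠ v → h ≠ k →
      JoinedIn S (Δ.arcExt h (1 / 2)) (Δ.arcExt k (1 / 2))) {h k : H}
    (hh : h ∈ C.halfEdges) (hk : k ∈ C.halfEdges) (hv : G.vert h = v) (hv' : G.vert k = v)
    (hhk : h ≠ k) :
    JoinedIn S (Δ.arcExt h (1 / 2)) (Δ.arcExt k (1 / 2)) := by
  obtain ⟨i, hi⟩ := SimpleCycle.Visits.exists_dart (C := C) ⟨h, hh, hv⟩
  have key := Δ.joinedIn_around C S hmem i (fun j hj => by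
    rw [← Δ.arcExt_opp_half (C.dart (j - 1))]
    refine hS _ (C.opp_dart_mem_halfEdges _) _ (C.dart_mem_halfEdges _)
      (C.vert_opp_dart_sub_one j) ?_ (C.dart_ne_opp_dart_sub_one j).symm
    rw [C.vert_opp_dart_sub_one]
    exact fun h => hj (C.vert_injective (h.trans hi.symm)))
  rw [← Δ.arcExt_opp_half (C.dart (i - 1))] at key
  rcases (C.mem_halfEdges_iff (hv.trans hi.symm)).1 hh with rfl | rfl <;>
    rcases (C.mem_halfEdges_iff (hv'.trans hi.symm)).1 hk with rfl | rfl
  · exact absurd rfl hhk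
  · exact key
  · exact key.symm
  · exact absurd rfl hhk

/-- In an alternating drawing two edge-disjoint cycles cannot have `v` as their only crossing vertex
if `C` passes through it along a pair: at any other common vertex the cycle `D` stays on one side
of `C`, so that the rest of `D` joins opposite points of a wheel around `v` avoiding `C`. -/
theorem not_unique_crossing_of_passesAlongPair (hΔ : ∀ v, Δ.AlternatesAt v) (C D : G.SimpleCycle)
    (hCD : C.EdgeDisjoint D) (v : V) (hC : C.PassesAlongPair v) (hD : D.Visits v)
    (huniq : ∀ w, C.IsCrossingVertex D w → w = v) : False := by
  have hhalf : (1 / 2 : ℝ) ∈ Set.Ioo (0 : ℝ) 1 := ⟨by norm_num, by norm_num⟩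
  have hCv : C.Visits v := by
    obtain ⟨h, hv, hh, -⟩ := hC
    exact ⟨h, hh, hv⟩
  have hCimage : ∀ h ∈ C.halfEdges, ∀ t ∈ Set.Icc (0 : ℝ) 1, Δ.arcExt h t ∈ Δ.cycleImage C :=
    fun h hh t ht => ⟨h, hh, t, ht, rfl⟩
  -- the rest of `D` avoids `C`
  have hDj : ∀ h ∈ D.halfEdges, ∀ k ∈ D.halfEdges, G.vert h = v → G.vert k = v → h ≠ k →
      JoinedIn (Δ.cycleImage C)ᶜ (Δ.arcExt h (1 / 2)) (Δ.arcExt k (1 / 2)) := by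
    intro h hh k hk hv hv' hhk
    refine Δ.joinedIn_around_vertex D _
      (fun i => Δ.arcExt_notMem_cycleImage (hCD.notMem_left (D.dart_mem_halfEdges i)) hhalf)
      ?_ hh hk hv hv' hhk
    intro h hh k hk hvk hvv hhk
    by_cases hCw : C.Visits (G.vert h)
    · have hpart : G.partner h ≠ k := by
        rintro rfl
        exact hvv (huniq _ ⟨hCw, ⟨h, hh, rfl⟩, Or.inr ⟨h, rfl, hh, hk⟩⟩)
      obtain ⟨e, s, R, hei, hev, hp0, hp1, hs, hR, hRi, -⟩ := (hΔ (G.vert h)).exists_rim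
      -- `D` takes two consecutive half-edges here, and a piece of the rim joins these
      have hstep : ∀ j, e j ∈ D.halfEdges → e (j + 1) ∈ D.halfEdges →
          JoinedIn (Δ.cycleImage C)ᶜ (Δ.arcExt (e j) (1 / 2)) (Δ.arcExt (e (j + 1)) (1 / 2)) := by
        intro j h1 h2
        have hspoke : ∀ j, e j ∈ D.halfEdges →
            JoinedIn (Δ.cycleImage C)ᶜ (Δ.arcExt (e j) (s j)) (Δ.arcExt (e j) (1 / 2)) := by
          intro j hj
          refine Δ.joinedIn_arcExt _ (fun u hu => ?_) (hs j).2.le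
          exact Δ.arcExt_notMem_cycleImage (hCD.notMem_left hj)
            ⟨(hs j).1.trans_le hu.1, hu.2.trans_lt (by norm_num)⟩
        refine ((hspoke j h1).symm.trans ((hR j).mono ?_)).trans (hspoke (j + 1) h2)
        intro q hq hqC
        have hsI : ∀ j, s j ∈ Set.Ioo (0 : ℝ) 1 := fun j =>
          ⟨(hs j).1, (hs j).2.trans (by norm_num)⟩
        rcases hRi j q hq (Δ.cycleImage_subset_image C hqC) with rfl | rfl
        · exact Δ.arcExt_notMem_cycleImage (hCD.notMem_left h1) (hsI _) hqC
        · exact Δ.arcExt_notMem_cycleImage (hCD.notMem_left h2) (hsI _) hqC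
      obtain ⟨a, rfl⟩ := G.exists_eq_of_vert_eq hei hev rfl
      obtain ⟨b, rfl⟩ := G.exists_eq_of_vert_eq hei hev hvk.symm
      have hadj : b = a + 1 ∨ a = b + 1 := by
        have hp2 : G.partner (e 2) = e 0 := by rw [← hp0, G.partner_partner]
        have hp3 : G.partner (e 3) = e 1 := by rw [← hp1, G.partner_partner]
        clear * - hp0 hp1 hp2 hp3 hpart hhk
        fin_cases a <;> fin_cases b <;> first
          | exact absurd rfl hhk
          | exact absurd hp0 hpart
          | exact absurd hp1 hpart
          | exact absurd hp2 hpart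
          | exact absurd hp3 hpart
          | decide
      rcases hadj with rfl | rfl
      · exact hstep a hh hk
      · exact (hstep b hk hh).symm
    · have hspoke : ∀ k ∈ D.halfEdges, G.vert k = G.vert h →
          JoinedIn (Δ.cycleImage C)ᶜ (Δ.pos (G.vert h)) (Δ.arcExt k (1 / 2)) := by
        intro k hk hkv
        rw [← hkv, ← Δ.arcExt_zero]
        refine Δ.joinedIn_arcExt _ (fun u hu => ?_) (by norm_num)
        rcases hu.1.eq_or_lt with rfl | h0
        · rw [Δ.arcExt_zero, hkv]
          exact Δ.pos_notMem_cycleImage hCw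
        · exact Δ.arcExt_notMem_cycleImage (hCD.notMem_left hk) ⟨h0, hu.2.trans_lt (by norm_num)⟩
      exact (hspoke h hh rfl).symm.trans (hspoke k hk hvk.symm)
  -- the rest of `C` avoids `v`
  have hCj : ∀ h ∈ C.halfEdges, ∀ k ∈ C.halfEdges, G.vert h = v → G.vert k = v → h ≠ k →
      JoinedIn (Δ.cycleImage C \ {Δ.pos v}) (Δ.arcExt h (1 / 2)) (Δ.arcExt k (1 / 2)) := by
    intro h hh k hk hv hv' hhk
    refine Δ.joinedIn_around_vertex C (Δ.cycleImage C \ {Δ.pos v})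
      (fun i => ⟨hCimage _ (C.dart_mem_halfEdges i) _ ⟨by norm_num, by norm_num⟩,
        Δ.arcExt_ne_pos _ _ hhalf⟩) ?_ hh hk hv hv' hhk
    intro h hh k hk hvk hvv hhk
    have hspoke : ∀ k ∈ C.halfEdges, G.vert k = G.vert h →
        JoinedIn (Δ.cycleImage C \ {Δ.pos v}) (Δ.pos (G.vert h)) (Δ.arcExt k (1 / 2)) := by
      intro k hk hkv
      rw [← hkv, ← Δ.arcExt_zero]
      refine Δ.joinedIn_arcExt _ (fun u hu =>
        ⟨hCimage k hk u ⟨hu.1, hu.2.trans (by norm_num)⟩, ?_⟩) (by norm_num)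
      rcases hu.1.eq_or_lt with rfl | h0
      · rw [Δ.arcExt_zero, hkv]
        exact fun h => hvv (Δ.pos_injective h)
      · exact Δ.arcExt_ne_pos k v (t := u) ⟨h0, hu.2.trans_lt (by norm_num)⟩
    exact (hspoke h hh rfl).symm.trans (hspoke k hk hvk.symm)
  -- the wheel around `v`
  obtain ⟨e, s, R, hei, hev, hp0, hp1, hs, hR, hRi, hRv, hR02, hR13⟩ := (hΔ v).exists_rim
  have hsI : ∀ j, ∀ u, s j ≤ u → u ≤ 1 / 2 → u ∈ Set.Ioo (0 : ℝ) 1 := fun j u h1 h2 =>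
    ⟨(hs j).1.trans_le h1, h2.trans_lt (by norm_num)⟩
  have hDj' : ∀ a b, e a ∈ D.halfEdges → e b ∈ D.halfEdges → a ≠ b →
      JoinedIn (Δ.cycleImage C)ᶜ (Δ.arcExt (e a) (s a)) (Δ.arcExt (e b) (s b)) := by
    intro a b ha hb hab
    have hspoke : ∀ j, e j ∈ D.halfEdges →
        JoinedIn (Δ.cycleImage C)ᶜ (Δ.arcExt (e j) (s j)) (Δ.arcExt (e j) (1 / 2)) := fun j hj =>
      Δ.joinedIn_arcExt _ (fun u hu => Δ.arcExt_notMem_cycleImage (hCD.notMem_left hj)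
        (hsI j u hu.1 hu.2)) (hs j).2.le
    exact ((hspoke a ha).trans (hDj _ ha _ hb (hev a) (hev b) (hei.ne hab))).trans
      (hspoke b hb).symm
  have hCj' : ∀ a b, e a ∈ C.halfEdges → e b ∈ C.halfEdges → a ≠ b →
      JoinedIn (Δ.cycleImage C \ {Δ.pos v}) (Δ.arcExt (e a) (s a)) (Δ.arcExt (e b) (s b)) := by
    intro a b ha hb hab
    have hspoke : ∀ j, e j ∈ C.halfEdges → JoinedIn (Δ.cycleImage C \ {Δ.pos v})
        (Δ.arcExt (e j) (s j)) (Δ.arcExt (e j) (1 / 2)) := fun j hj =>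
      Δ.joinedIn_arcExt _ (fun u hu => ⟨hCimage _ hj u (Set.Ioo_subset_Icc_self
        (hsI j u hu.1 hu.2)), Δ.arcExt_ne_pos _ _ (hsI j u hu.1 hu.2)⟩) (hs j).2.le
    exact ((hspoke a ha).trans (hCj _ ha _ hb (hev a) (hev b) (hei.ne hab))).trans
      (hspoke b hb).symm
  let S : Fin 4 → Set (EuclideanSpace ℝ (Fin 2)) := fun j => Δ.arcExt (e j) '' Set.Icc 0 (s j)
  have hS : ∀ j, JoinedIn (S j) (Δ.pos v) (Δ.arcExt (e j) (s j)) := by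
    intro j
    rw [← hev j, ← Δ.arcExt_zero]
    exact Δ.joinedIn_arcExt _ (fun u hu => ⟨u, hu, rfl⟩) (hs j).1.le
  have hSC : ∀ j, e j ∈ C.halfEdges → Disjoint (S j) (Δ.cycleImage C)ᶜ := by
    intro j hj
    rw [Set.disjoint_left]
    rintro _ ⟨u, hu, rfl⟩ hq
    exact hq (hCimage _ hj u ⟨hu.1, by linarith [hu.2, (hs j).2]⟩)
  have hSD : ∀ j, e j ∈ D.halfEdges → Disjoint (S j) (Δ.cycleImage C \ {Δ.pos v}) := by
    intro j hj
    rw [Set.disjoint_left]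
    rintro _ ⟨u, hu, rfl⟩ hq
    rcases hu.1.eq_or_lt with rfl | h0
    · exact hq.2 (by rw [Δ.arcExt_zero, hev j]; rfl)
    · exact Δ.arcExt_notMem_cycleImage (hCD.notMem_left hj)
        ⟨h0, by linarith [hu.2, (hs j).2]⟩ hq.1
  have hSR : ∀ j k, k ≠ j → k ≠ j + 1 → Disjoint (S k) (R j) := by
    intro j k hkj hkj'
    rw [Set.disjoint_left]
    rintro _ ⟨u, hu, rfl⟩ hq
    rcases hu.1.eq_or_lt with rfl | h0
    · rw [Δ.arcExt_zero, hev k] at hq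
      exact hRv j hq
    · have hne : ∀ i, k ≠ i → Δ.arcExt (e k) u ≠ Δ.arcExt (e i) (s i) := by
        intro i hki heq
        have h1 := hs i
        have h2 := hs k
        rcases Δ.eq_of_arcExt_eq ⟨h0, by linarith [hu.2]⟩ ⟨h1.1, by linarith⟩ heq with
          ⟨h, -⟩ | ⟨-, h⟩
        · exact hki (hei h).symm
        · linarith [hu.2]
      rcases hRi j _ hq (Δ.arcExt_mem_image _ _) with h | h
      · exact hne _ hkj h
      · exact hne _ hkj' h
  have hXY : Disjoint (Δ.cycleImage C \ {Δ.pos v}) (Δ.cycleImage C)ᶜ :=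
    Set.disjoint_left.2 fun q h1 h2 => h2 h1.1
  -- `C` takes one pair, and `D` takes the other one
  obtain ⟨h, hhv, hh, hph⟩ := hC
  have hmem : ∀ a, e a ∈ C.halfEdges ∨ e a ∈ D.halfEdges := fun a =>
    hCD.mem_or_mem hCv hD (hev a)
  have hthree : ∀ a b c, a ≠ b → e a ∈ C.halfEdges → e b ∈ C.halfEdges → e c ∈ C.halfEdges →
      c = a ∨ c = b := by
    intro a b c hab ha hb hc
    obtain ⟨i, hi⟩ := hCv.exists_dart
    have h1 := (C.mem_halfEdges_iff ((hev a).trans hi.symm)).1 ha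
    have h2 := (C.mem_halfEdges_iff ((hev b).trans hi.symm)).1 hb
    have h3 := (C.mem_halfEdges_iff ((hev c).trans hi.symm)).1 hc
    have hab' := hei.ne hab
    rw [← hei.eq_iff, ← hei.eq_iff (a := c) (b := b)]
    rcases h1 with h1 | h1 <;> rcases h2 with h2 | h2 <;> rcases h3 with h3 | h3 <;>
      simp_all
  have hcases : (e 0 ∈ C.halfEdges ∧ e 2 ∈ C.halfEdges) ∨
      (e 1 ∈ C.halfEdges ∧ e 3 ∈ C.halfEdges) := by
    obtain ⟨a, rfl⟩ := G.exists_eq_of_vert_eq hei hev hhv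
    have hp2 : G.partner (e 2) = e 0 := by rw [← hp0, G.partner_partner]
    have hp3 : G.partner (e 3) = e 1 := by rw [← hp1, G.partner_partner]
    fin_cases a
    · exact Or.inl ⟨hh, hp0 ▸ hph⟩
    · exact Or.inr ⟨hh, hp1 ▸ hph⟩
    · exact Or.inl ⟨hp2 ▸ hph, hh⟩
    · exact Or.inr ⟨hp3 ▸ hph, hh⟩
  rcases hcases with ⟨h0, h2⟩ | ⟨h1, h3⟩
  · have h1 : e 1 ∈ D.halfEdges := (hmem 1).resolve_left fun h =>
      absurd (hthree 0 2 1 (by decide) h0 h2 h) (by decide)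
    have h3 : e 3 ∈ D.halfEdges := (hmem 3).resolve_left fun h =>
      absurd (hthree 0 2 3 (by decide) h0 h2 h) (by decide)
    exact not_exists_planar_wheel_with_diagonals (Δ.pos v) (fun j => Δ.arcExt (e j) (s j)) S R _ _
      hS hR (hCj' 0 2 h0 h2 (by decide)) (hDj' 1 3 h1 h3 (by decide)) hSR hR02 hR13 hXY
      (hSD 1 h1) (hSD 3 h3) (hSC 0 h0) (hSC 2 h2)
  · have h0 : e 0 ∈ D.halfEdges := (hmem 0).resolve_left fun h =>
      absurd (hthree 1 3 0 (by decide) h1 h3 h) (by decide)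
    have h2 : e 2 ∈ D.halfEdges := (hmem 2).resolve_left fun h =>
      absurd (hthree 1 3 2 (by decide) h1 h3 h) (by decide)
    exact not_exists_planar_wheel_with_diagonals (Δ.pos v) (fun j => Δ.arcExt (e j) (s j)) S R _ _
      hS hR (hDj' 0 2 h0 h2 (by decide)) (hCj' 1 3 h1 h3 (by decide)) hSR hR02 hR13 hXY.symm
      (hSC 1 h1) (hSC 3 h3) (hSD 0 h0) (hSD 2 h2)

end PlaneDrawing

theorem IsXPlanar.not_exists_unique_crossing (hG : G.IsXPlanar) :
    ¬ ∃ C D : G.SimpleCycle, C.EdgeDisjoint D ∧ ∃! v, C.IsCrossingVertex D v := by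
  obtain ⟨Δ, hΔ⟩ := hG
  rintro ⟨C, D, hCD, v, ⟨hC, hD, hpair | hpair⟩, huniq⟩
  · exact Δ.not_unique_crossing_of_passesAlongPair hΔ C D hCD v hpair hD huniq
  · exact Δ.not_unique_crossing_of_passesAlongPair hΔ D C hCD.symm v hpair hC
      (fun w hw => huniq w hw.symm)

end XGraph

/-! ### Smoothings and chains modulo two -/

namespace XGraph

variable {V H : Type*}

/-- A smoothing of all vertices that follows no pair: the four half-edges at each vertex are matched
by an involution `turn` so that a half-edge and its partner are never matched. -/
structure Smoothing (G : XGraph V H) where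
  turn : H → H
  turn_turn : ∀ h, turn (turn h) = h
  turn_ne : ∀ h, turn h ≠ h
  turn_ne_partner : ∀ h, turn h ≠ G.partner h
  vert_turn : ∀ h, G.vert (turn h) = G.vert h
  turn_partner : ∀ h, turn (G.partner h) = G.partner (turn h)

variable {G : XGraph V H}

theorem partner_injective : Function.Injective G.partner :=
  Function.LeftInverse.injective G.partner_partner

theorem opp_injective : Function.Injective G.opp := Function.LeftInverse.injective G.opp_opp

theorem opp_eq_comm {h k : H} : G.opp h = k ↔ h = G.opp k := by
  constructor <;> rintro rfl <;> rw [G.opp_opp]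

theorem exists_vert_eq (v : V) : ∃ h, G.vert h = v := by
  have : {h | G.vert h = v}.Nonempty := by
    apply Set.nonempty_of_ncard_ne_zero
    rw [G.degree_eq_four]
    decide
  exact this

theorem finite_halfEdges [Finite V] (G : XGraph V H) : Finite H := by
  have : (Set.univ : Set H) = ⋃ v, {h | G.vert h = v} := by
    ext h; simp
  rw [← Set.finite_univ_iff, this]
  exact Set.finite_iUnion fun v => Set.finite_of_ncard_ne_zero (by rw [G.degree_eq_four]; decide)

namespace Smoothing

variable (σ : G.Smoothing)

theorem turn_injective : Function.Injective σ.turn := Function.LeftInverse.injective σ.turn_turn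

/-- The four half-edges at the vertex of `h`. -/
def star (h : H) : Fin 4 → H := ![h, G.partner h, σ.turn h, G.partner (σ.turn h)]

theorem star_injective (h : H) : Function.Injective (σ.star h) := by
  have e1 : h ≠ G.partner h := (G.partner_ne h).symm
  have e2 : h ≠ σ.turn h := (σ.turn_ne h).symm
  have e3 : h ≠ G.partner (σ.turn h) := by
    intro hh
    apply σ.turn_ne_partner h
    rw [hh, G.partner_partner, ← hh]
  have e4 : G.partner h ≠ σ.turn h := (σ.turn_ne_partner h).symm
  have e5 : G.partner h ≠ G.partner (σ.turn h) := partner_injective.ne e2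
  have e6 : σ.turn h ≠ G.partner (σ.turn h) := (G.partner_ne _).symm
  intro x y hxy
  fin_cases x <;> fin_cases y <;> first
    | rfl
    | exact absurd hxy e1 | exact absurd hxy e2 | exact absurd hxy e3 | exact absurd hxy e4
    | exact absurd hxy e5 | exact absurd hxy e6 | exact absurd hxy.symm e1
    | exact absurd hxy.symm e2 | exact absurd hxy.symm e3 | exact absurd hxy.symm e4
    | exact absurd hxy.symm e5 | exact absurd hxy.symm e6

theorem vert_star (h : H) (i) : G.vert (σ.star h i) = G.vert h := by
  fin_cases i
  exacts [rfl, G.vert_partner h, σ.vert_turn h, (G.vert_partner _).trans (σ.vert_turn h)]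

theorem eq_or_eq_of_vert_eq {h k : H} (hk : G.vert k = G.vert h) :
    k = h ∨ k = G.partner h ∨ k = σ.turn h ∨ k = G.partner (σ.turn h) := by
  obtain ⟨i, rfl⟩ := G.exists_eq_of_vert_eq (σ.star_injective h) (σ.vert_star h) hk
  fin_cases i <;> simp [star]

end Smoothing

theorem exists_smoothing (G : XGraph V H) : Nonempty G.Smoothing := by
  classical
  choose a ha using exists_vert_eq (G := G)
  have hb : ∀ v, ∃ k, G.vert k = v ∧ k ≠ a v ∧ k ≠ G.partner (a v) := by
    intro v
    by_contra! hcon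
    have hsub : {h | G.vert h = v} ⊆ {a v, G.partner (a v)} := by
      intro k hk
      by_cases h : k = a v
      · exact Or.inl h
      · exact Or.inr (hcon k hk h)
    have := Set.ncard_le_ncard hsub
    rw [G.degree_eq_four, Set.ncard_pair (G.partner_ne _).symm] at this
    omega
  choose b hb hba hbp using hb
  have hpp := G.partner_partner
  have hpb : ∀ v, G.partner (b v) ≠ a v := fun v h => hbp v (by rw [← h, hpp])
  have hfour : ∀ h, h = a (G.vert h) ∨ h = G.partner (a (G.vert h)) ∨ h = b (G.vert h) ∨
      h = G.partner (b (G.vert h)) := by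
    intro h
    obtain ⟨i, hi⟩ := G.exists_eq_of_vert_eq (v := G.vert h)
      (h := ![a (G.vert h), G.partner (a (G.vert h)), b (G.vert h), G.partner (b (G.vert h))]) (by
        have e1 := (G.partner_ne (a (G.vert h))).symm
        have e2 := (hba (G.vert h)).symm
        have e3 := (hpb (G.vert h)).symm
        have e4 := (hbp (G.vert h)).symm
        have e5 := (partner_injective (G := G)).ne e2
        have e6 := (G.partner_ne (b (G.vert h))).symm
        intro x y hxy
        fin_cases x <;> fin_cases y <;> first
          | rfl
          | exact absurd hxy e1 | exact absurd hxy e2 | exact absurd hxy e3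
          | exact absurd hxy e4 | exact absurd hxy e5 | exact absurd hxy e6
          | exact absurd hxy.symm e1 | exact absurd hxy.symm e2 | exact absurd hxy.symm e3
          | exact absurd hxy.symm e4 | exact absurd hxy.symm e5 | exact absurd hxy.symm e6) (by
        intro i
        fin_cases i
        exacts [ha _, (G.vert_partner _).trans (ha _), hb _, (G.vert_partner _).trans (hb _)]) rfl
    fin_cases i
    exacts [Or.inl hi, Or.inr (Or.inl hi), Or.inr (Or.inr (Or.inl hi)),
      Or.inr (Or.inr (Or.inr hi))]
  let c : H → H := fun h =>
    if h = a (G.vert h) then b (G.vert h)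
    else if h = b (G.vert h) then a (G.vert h)
    else if h = G.partner (a (G.vert h)) then G.partner (b (G.vert h))
    else G.partner (a (G.vert h))
  have c1 : ∀ v, c (a v) = b v := fun v => by simp [c, ha]
  have c2 : ∀ v, c (b v) = a v := fun v => by simp [c, hb, hba]
  have c3 : ∀ v, c (G.partner (a v)) = G.partner (b v) := fun v => by
    simp [c, ha, G.vert_partner, G.partner_ne, (hbp v).symm]
  have c4 : ∀ v, c (G.partner (b v)) = G.partner (a v) := fun v => by
    simp [c, hb, G.vert_partner, G.partner_ne, hpb, (partner_injective (G := G)).eq_iff, hba]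
  refine ⟨⟨c, ?_, ?_, ?_, ?_, ?_⟩⟩
  all_goals
    intro h
    generalize hv : G.vert h = v
    rcases hfour h with hh | hh | hh | hh <;> rw [hv] at hh <;> subst hh
  all_goals simp only [c1, c2, c3, c4, hpp, ha, hb, G.vert_partner, ne_eq]
  · exact hba v
  · exact fun h => hba v (partner_injective h)
  · exact (hba v).symm
  · exact fun h => hba v (partner_injective h).symm
  · exact hbp v
  · exact hpb v
  · exact (hpb v).symm
  · exact (hbp v).symm

/-- The sum of a function modulo two over the half-edges at a vertex. -/
noncomputable def boundary [Fintype H] (G : XGraph V H) (f : H → ZMod 2) (v : V) : ZMod 2 :=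
  open Classical in ∑ h, if G.vert h = v then f h else 0

theorem boundary_add [Fintype H] (f g : H → ZMod 2) (v : V) :
    G.boundary (f + g) v = G.boundary f v + G.boundary g v := by
  simp only [boundary, ← Finset.sum_add_distrib]
  refine Finset.sum_congr rfl fun h _ => ?_
  split_ifs <;> simp

theorem Smoothing.boundary_eq [Fintype H] (σ : G.Smoothing) (f : H → ZMod 2) (h : H) :
    G.boundary f (G.vert h) =
      f h + f (G.partner h) + f (σ.turn h) + f (G.partner (σ.turn h)) := by
  classical
  have : ∑ i, f (σ.star h i) = f h + f (G.partner h) + f (σ.turn h) +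
      f (G.partner (σ.turn h)) := by
    rw [Fin.sum_univ_four]; rfl
  rw [← this, boundary, ← Finset.sum_filter]
  symm
  refine Finset.sum_bij (fun i _ => σ.star h i) ?_ ?_ ?_ ?_
  · intro i _; simp [σ.vert_star]
  · intro i _ j _ hij; exact σ.star_injective h hij
  · intro k hk
    obtain ⟨i, rfl⟩ := G.exists_eq_of_vert_eq (σ.star_injective h) (σ.vert_star h)
      (Finset.mem_filter.1 hk).2
    exact ⟨i, Finset.mem_univ _, rfl⟩
  · intro i _; rfl

/-- The indicator function modulo two of a set of edges that meets every vertex evenly. -/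
structure IsEven [Fintype H] (G : XGraph V H) (f : H → ZMod 2) : Prop where
  opp : ∀ h, f (G.opp h) = f h
  boundary : ∀ v, G.boundary f v = 0

theorem IsEven.add [Fintype H] {f g : H → ZMod 2} (hf : G.IsEven f) (hg : G.IsEven g) :
    G.IsEven (f + g) :=
  ⟨fun h => by simp [hf.opp h, hg.opp h],
    fun v => by rw [boundary_add, hf.boundary, hg.boundary, add_zero]⟩

/-- The sum modulo two of the first `n` edges of a sequence of darts. -/
noncomputable def chain (G : XGraph V H) (s : ℕ → H) (n : ℕ) (h : H) : ZMod 2 :=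
  open Classical in
  ∑ a ∈ Finset.range n, ((if h = s a then 1 else 0) + (if h = G.opp (s a) then 1 else 0))

theorem chain_opp (s : ℕ → H) (n : ℕ) (h : H) : G.chain s n (G.opp h) = G.chain s n h := by
  unfold chain
  refine Finset.sum_congr rfl fun a _ => ?_
  have e1 : (G.opp h = G.opp (s a)) = (h = s a) := propext (opp_injective (G := G)).eq_iff
  have e2 : (G.opp h = s a) = (h = G.opp (s a)) := propext opp_eq_comm
  classical
  rw [add_comm]
  exact congrArg₂ _ (if_congr (iff_of_eq e1) rfl rfl) (if_congr (iff_of_eq e2) rfl rfl)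

theorem exists_of_chain_ne_zero {s : ℕ → H} {n : ℕ} {h : H} (hne : G.chain s n h ≠ 0) :
    ∃ a < n, h = s a ∨ h = G.opp (s a) := by
  by_contra! hcon
  apply hne
  refine Finset.sum_eq_zero fun a ha => ?_
  have := hcon a (Finset.mem_range.1 ha)
  simp [this.1, this.2]

/-- The chain of a path has the two ends of the path as its boundary. -/
theorem boundary_chain [Fintype H] [DecidableEq V] {s : ℕ → H} {n : ℕ}
    (hs : ∀ a < n, G.vert (G.opp (s a)) = G.vert (s (a + 1))) (v : V) :
    G.boundary (G.chain s n) v =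
      (if G.vert (s 0) = v then 1 else 0) + (if G.vert (s n) = v then 1 else 0) := by
  classical
  induction n with
  | zero => simp [boundary, chain, CharTwo.add_self_eq_zero]
  | succ n ih =>
    have hadd : G.chain s (n + 1) = G.chain s n +
        fun h => ((if h = s n then 1 else 0) + (if h = G.opp (s n) then 1 else 0)) := by
      funext h
      simp [chain, Finset.sum_range_succ]
    have hone : G.boundary (fun h => ((if h = s n then 1 else 0) +
        (if h = G.opp (s n) then 1 else 0))) v =
        (if G.vert (s n) = v then 1 else 0) + (if G.vert (G.opp (s n)) = v then 1 else 0) := by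
      have : ∀ k : H, (∑ h, if G.vert h = v then (if h = k then (1 : ZMod 2) else 0) else 0) =
          if G.vert k = v then 1 else 0 := by
        intro k
        rw [Finset.sum_eq_single k]
        · simp
        · intro b _ hb; simp [hb]
        · simp
      rw [← this (s n), ← this (G.opp (s n)), boundary, ← Finset.sum_add_distrib]
      refine Finset.sum_congr rfl fun h _ => ?_
      by_cases h : G.vert h = v <;> simp [h]
    rw [hadd, boundary_add, ih fun a ha => hs a (by omega), hone, hs n (by omega)]
    generalize (if G.vert (s 0) = v then (1 : ZMod 2) else 0) = x
    generalize (if G.vert (s n) = v then (1 : ZMod 2) else 0) = y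
    generalize (if G.vert (s (n + 1)) = v then (1 : ZMod 2) else 0) = z
    linear_combination y * (by decide : (2 : ZMod 2) = 0)

theorem isEven_chain [Fintype H] {s : ℕ → H} {n : ℕ}
    (hs : ∀ a < n, G.vert (G.opp (s a)) = G.vert (s (a + 1)))
    (hclosed : G.vert (s n) = G.vert (s 0)) : G.IsEven (G.chain s n) := by
  classical
  refine ⟨chain_opp s n, fun v => ?_⟩
  rw [boundary_chain hs, hclosed, CharTwo.add_self_eq_zero]

/-- The vertices where two sets of edges pass along the two different pairs. -/
def crossings (G : XGraph V H) (f g : H → ZMod 2) : Set V :=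
  {v | ∃ h k, G.vert h = v ∧ G.vert k = v ∧ f h = 1 ∧ f (G.partner h) = 1 ∧ g k = 1 ∧
    g (G.partner k) = 1}

theorem crossings_comm (f g : H → ZMod 2) : G.crossings f g = G.crossings g f := by
  ext v
  constructor <;> rintro ⟨h, k, h1, h2, h3, h4, h5, h6⟩ <;> exact ⟨k, h, h2, h1, h5, h6, h3, h4⟩

theorem Smoothing.mem_crossings_iff (σ : G.Smoothing) {f g : H → ZMod 2} (hfg : ∀ h, f h * g h = 0)
    (h : H) : G.vert h ∈ G.crossings f g ↔
      (f h = 1 ∧ f (G.partner h) = 1 ∧ g (σ.turn h) = 1 ∧ g (G.partner (σ.turn h)) = 1) ∨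
      (f (σ.turn h) = 1 ∧ f (G.partner (σ.turn h)) = 1 ∧ g h = 1 ∧ g (G.partner h) = 1) := by
  have hno : ∀ k, f k = 1 → g k = 1 → False := fun k h1 h2 => by
    have := hfg k
    rw [h1, h2] at this
    exact absurd this (by decide)
  constructor
  · rintro ⟨k, l, hk, hl, f1, f2, g1, g2⟩
    rcases σ.eq_or_eq_of_vert_eq hk with rfl | rfl | rfl | rfl <;>
      rcases σ.eq_or_eq_of_vert_eq hl with rfl | rfl | rfl | rfl <;>
      (try simp only [G.partner_partner] at f2 g2) <;>
      first
        | exact (hno _ f1 g1).elim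
        | exact (hno _ f1 g2).elim
        | exact Or.inl ⟨f1, f2, g1, g2⟩
        | exact Or.inl ⟨f1, f2, g2, g1⟩
        | exact Or.inl ⟨f2, f1, g1, g2⟩
        | exact Or.inl ⟨f2, f1, g2, g1⟩
        | exact Or.inr ⟨f1, f2, g1, g2⟩
        | exact Or.inr ⟨f1, f2, g2, g1⟩
        | exact Or.inr ⟨f2, f1, g1, g2⟩
        | exact Or.inr ⟨f2, f1, g2, g1⟩
  · rintro (⟨f1, f2, g1, g2⟩ | ⟨f1, f2, g1, g2⟩)
    · exact ⟨h, σ.turn h, rfl, σ.vert_turn h, f1, f2, g1, g2⟩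
    · exact ⟨σ.turn h, h, σ.vert_turn h, rfl, f1, f2, g1, g2⟩

end XGraph

/-! ### Reduction of the number of crossings -/

namespace XGraph

variable {V H : Type*} {G : XGraph V H}

/-- The indicator function modulo two of the half-edges of a cycle. -/
noncomputable def SimpleCycle.indicator (C : G.SimpleCycle) (h : H) : ZMod 2 :=
  open Classical in if h ∈ C.halfEdges then 1 else 0

theorem SimpleCycle.indicator_eq_one (C : G.SimpleCycle) {h : H} :
    C.indicator h = 1 ↔ h ∈ C.halfEdges := by
  by_cases hh : h ∈ C.halfEdges <;> simp [indicator, hh]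

theorem SimpleCycle.indicator_eq_zero (C : G.SimpleCycle) {h : H} :
    C.indicator h = 0 ↔ h ∉ C.halfEdges := by
  by_cases hh : h ∈ C.halfEdges <;> simp [indicator, hh]

theorem eq_zero_or_one (x : ZMod 2) : x = 0 ∨ x = 1 := by
  revert x; decide

theorem SimpleCycle.isEven_indicator [Fintype H] (C : G.SimpleCycle) : G.IsEven C.indicator := by
  classical
  constructor
  · intro h
    by_cases hh : h ∈ C.halfEdges
    · rw [C.indicator_eq_one.2 hh, C.indicator_eq_one.2 (opp_mem_halfEdges hh)]
    · rw [C.indicator_eq_zero.2 hh, C.indicator_eq_zero.2 fun h' => hh (by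
        have := opp_mem_halfEdges h'; rwa [G.opp_opp] at this)]
  · intro v
    by_cases hv : C.Visits v
    · obtain ⟨i, rfl⟩ := hv.exists_dart
      have : ∀ h, (if G.vert h = G.vert (C.dart i) then C.indicator h else 0) =
          (if h = C.dart i then 1 else 0) + (if h = G.opp (C.dart (i - 1)) then 1 else 0) := by
        intro h
        by_cases hh : G.vert h = G.vert (C.dart i)
        · simp only [hh, if_true, indicator, C.mem_halfEdges_iff hh]
          have := C.dart_ne_opp_dart_sub_one i
          by_cases h1 : h = C.dart i
          · subst h1; simp [this]
          · simp [h1]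
        · have h1 : h ≠ C.dart i := by rintro rfl; exact hh rfl
          have h2 : h ≠ G.opp (C.dart (i - 1)) := by
            rintro rfl; exact hh (C.vert_opp_dart_sub_one i)
          simp [hh, h1, h2]
      simp only [boundary, this, Finset.sum_add_distrib, Finset.sum_ite_eq', Finset.mem_univ,
        if_true]
      decide
    · refine Finset.sum_eq_zero fun h _ => ?_
      split_ifs with hh
      · exact C.indicator_eq_zero.2 fun hC => hv ⟨h, hC, hh⟩
      · rfl

/-- Every non-empty even set of edges contains a cycle: a walk in this set that never turns back
returns to a vertex, and its shortest closed part is a cycle. -/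
theorem IsEven.exists_simpleCycle [Finite V] [Fintype H] {f : H → ZMod 2} (hf : G.IsEven f)
    {h₀ : H} (h₀f : f h₀ = 1) : ∃ C : G.SimpleCycle, ∀ h ∈ C.halfEdges, f h = 1 := by
  obtain ⟨σ⟩ := G.exists_smoothing
  have hnext : ∀ h, f h = 1 → ∃ k, f k = 1 ∧ G.vert (G.opp h) = G.vert k ∧ k ≠ G.opp h := by
    intro h hh
    have hb := hf.boundary (G.vert (G.opp h))
    rw [σ.boundary_eq, hf.opp, hh] at hb
    have hi := σ.star_injective (G.opp h)
    rcases eq_zero_or_one (f (G.partner (G.opp h))) with h1 | h1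
    · rcases eq_zero_or_one (f (σ.turn (G.opp h))) with h2 | h2
      · refine ⟨_, ?_, (σ.vert_star (G.opp h) 3).symm, hi.ne (a₁ := 3) (a₂ := 0) (by decide)⟩
        rw [h1, h2] at hb
        rcases eq_zero_or_one (f (G.partner (σ.turn (G.opp h)))) with h3 | h3
        · rw [h3] at hb; exact absurd hb (by decide)
        · exact h3
      · exact ⟨_, h2, (σ.vert_turn _).symm, σ.turn_ne _⟩
    · exact ⟨_, h1, (G.vert_partner _).symm, G.partner_ne _⟩
  choose! nx hnx1 hnx2 hnx3 using hnext
  let s : ℕ → H := fun n => nx^[n] h₀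
  have hs1 : ∀ n, f (s n) = 1 := by
    intro n
    induction n with
    | zero => exact h₀f
    | succ n ih =>
      simp only [s, Function.iterate_succ_apply']
      exact hnx1 _ ih
  have hs2 : ∀ n, G.vert (G.opp (s n)) = G.vert (s (n + 1)) := by
    intro n
    simp only [s, Function.iterate_succ_apply']
    exact hnx2 _ (hs1 n)
  have hs3 : ∀ n, s (n + 1) ≠ G.opp (s n) := by
    intro n
    simp only [s, Function.iterate_succ_apply']
    exact hnx3 _ (hs1 n)
  -- the first return to a vertex
  have hex : ∃ n, 0 < n ∧ ∃ i, G.vert (s i) = G.vert (s (i + n)) := by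
    obtain ⟨i, j, hij, heq⟩ := Finite.exists_ne_map_eq_of_infinite fun n => G.vert (s n)
    rcases lt_or_gt_of_ne hij with h | h
    · exact ⟨j - i, by omega, i, by rw [show i + (j - i) = j by omega]; exact heq⟩
    · exact ⟨i - j, by omega, j, by rw [show j + (i - j) = i by omega]; exact heq.symm⟩
  classical
  obtain ⟨hn0, i, hi⟩ := Nat.find_spec hex
  have hmin := fun m hm => Nat.find_min hex (m := m) hm
  generalize Nat.find hex = n at hn0 hi hmin
  have hinj : ∀ a b, a < n → b < n → G.vert (s (i + a)) = G.vert (s (i + b)) → a = b := by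
    have : ∀ a b, a < b → b < n → G.vert (s (i + a)) ≠ G.vert (s (i + b)) := by
      intro a b hab hb heq
      refine hmin (b - a) (by omega) ⟨by omega, i + a, ?_⟩
      rw [heq]; congr 2; omega
    intro a b ha hb heq
    rcases lt_trichotomy a b with h | h | h
    · exact absurd heq (this a b h hb)
    · exact h
    · exact absurd heq.symm (this b a h ha)
  have : NeZero n := ⟨hn0.ne'⟩
  have hval : ∀ k : ZMod n, (k + 1).val = if k.val + 1 = n then 0 else k.val + 1 := by
    intro k
    have hk := ZMod.val_lt k
    split_ifs with h
    · rw [ZMod.val_add, ZMod.val_one_eq_one_mod, Nat.add_mod_mod, h, Nat.mod_self]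
    · rw [ZMod.val_add, ZMod.val_one_eq_one_mod, Nat.add_mod_mod, Nat.mod_eq_of_lt (by omega)]
  have hnextv : ∀ k : ZMod n, G.vert (G.opp (s (i + k.val))) = G.vert (s (i + (k + 1).val)) := by
    intro k
    rw [hs2, hval k]
    split_ifs with h
    · rw [add_assoc, h, ← hi, add_zero]
    · rw [add_assoc]
  let C : G.SimpleCycle :=
    { len := n
      len_pos := hn0
      dart := fun k => s (i + k.val)
      vert_opp_dart := hnextv
      vert_injective := fun a b hab =>
        ZMod.val_injective n (hinj _ _ (ZMod.val_lt a) (ZMod.val_lt b) hab)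
      dart_ne_opp_dart := by
        intro a b hab
        -- both ends agree, so that `a` and `b` follow each other in both ways
        have h1 : (a.val : ℕ) = (b + 1).val := by
          apply hinj _ _ (ZMod.val_lt _) (ZMod.val_lt _)
          rw [hab, hnextv]
        have h2 : (b.val : ℕ) = (a + 1).val := by
          apply hinj _ _ (ZMod.val_lt _) (ZMod.val_lt _)
          rw [← hnextv, hab, G.opp_opp]
        rw [hval] at h1 h2
        have hab' : s (i + b.val) = G.opp (s (i + a.val)) := by rw [hab, G.opp_opp]
        split_ifs at h1 h2 with h3 h4 h4
        · have : a.val = b.val := by omega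
          rw [this] at hab
          exact G.opp_ne _ hab.symm
        · rw [h2, ← add_assoc] at hab'
          exact hs3 _ hab'
        · rw [h1, ← add_assoc] at hab
          exact hs3 _ hab
        · omega }
  refine ⟨C, ?_⟩
  rintro h ⟨k, rfl | rfl⟩
  · exact hs1 _
  · rw [hf.opp]; exact hs1 _

/-- Two vertices of a cycle are the boundary of a part of this cycle. -/
theorem SimpleCycle.exists_chain [Fintype H] [DecidableEq V] (C : G.SimpleCycle) {x y : V}
    (hx : C.Visits x) (hy : C.Visits y) : ∃ α : H → ZMod 2, (∀ h, α (G.opp h) = α h) ∧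
      (∀ h, α h = 1 → C.indicator h = 1) ∧
      ∀ v, G.boundary α v = (if x = v then 1 else 0) + (if y = v then 1 else 0) := by
  obtain ⟨i, rfl⟩ := hx.exists_dart
  obtain ⟨j, rfl⟩ := hy.exists_dart
  have : NeZero C.len := ⟨C.len_pos.ne'⟩
  refine ⟨G.chain (fun a => C.dart (i + a)) (j - i).val, chain_opp _ _, fun h hh => ?_,
    fun v => ?_⟩
  · obtain ⟨a, -, rfl | rfl⟩ := exists_of_chain_ne_zero (G := G) (by rw [hh]; decide)
    · exact C.indicator_eq_one.2 (C.dart_mem_halfEdges _)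
    · exact C.indicator_eq_one.2 (C.opp_dart_mem_halfEdges _)
  · rw [boundary_chain fun a _ => by rw [C.vert_opp_dart]; push_cast; rw [add_assoc]]
    simp

end XGraph

namespace XGraph

variable {V H : Type*} {G : XGraph V H}

/-- The local form of a crossing, for the values of two functions on the four half-edges at a
vertex. -/
def CrossAt (f g : Fin 4 → ZMod 2) : Prop :=
  (f 0 = 1 ∧ f 1 = 1 ∧ g 2 = 1 ∧ g 3 = 1) ∨ (f 2 = 1 ∧ f 3 = 1 ∧ g 0 = 1 ∧ g 1 = 1)

instance (f g : Fin 4 → ZMod 2) : Decidable (CrossAt f g) := by unfold CrossAt; infer_instance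

theorem Smoothing.mem_crossings_iff_crossAt (σ : G.Smoothing) {f g : H → ZMod 2}
    (hfg : ∀ h, f h * g h = 0) (h : H) :
    G.vert h ∈ G.crossings f g ↔ CrossAt (f ∘ σ.star h) (g ∘ σ.star h) :=
  σ.mem_crossings_iff hfg h

theorem Smoothing.boundary_eq_sum_star [Fintype H] (σ : G.Smoothing) (f : H → ZMod 2) (h : H) :
    G.boundary f (G.vert h) = f (σ.star h 0) + f (σ.star h 1) + f (σ.star h 2) + f (σ.star h 3) :=
  σ.boundary_eq f h

/-- The values `(p, q, g)` allowed on a half-edge when `p`, `q` and `g` are disjoint. -/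
def splitTable : Fin 4 → Fin 3 → ZMod 2 := ![![0, 0, 0], ![1, 0, 0], ![0, 1, 0], ![0, 0, 1]]

/-- At a vertex, `p + q` crosses `g` if and only if `p` or `q` does, and never both of them do. -/
theorem crossAt_add_left_table : ∀ a b c d : Fin 4,
    let p : Fin 4 → ZMod 2 := fun s => splitTable s 0
    let q : Fin 4 → ZMod 2 := fun s => splitTable s 1
    let g : Fin 4 → ZMod 2 := fun s => splitTable s 2
    p a + p b + p c + p d = 0 →
      (CrossAt ![p a + q a, p b + q b, p c + q c, p d + q d] ![g a, g b, g c, g d] ↔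
        CrossAt ![p a, p b, p c, p d] ![g a, g b, g c, g d] ∨
          CrossAt ![q a, q b, q c, q d] ![g a, g b, g c, g d]) ∧
      ¬ (CrossAt ![p a, p b, p c, p d] ![g a, g b, g c, g d] ∧
          CrossAt ![q a, q b, q c, q d] ![g a, g b, g c, g d]) := by
  decide +kernel

/-- The values `(f, α, g, β)` allowed on a half-edge when `f` and `g` are disjoint, `α` is a part of
`f` and `β` is a part of `g`. -/
def swapTable : Fin 5 → Fin 4 → ZMod 2 :=
  ![![0, 0, 0, 0], ![1, 0, 0, 0], ![1, 1, 0, 0], ![0, 0, 1, 0], ![0, 0, 1, 1]]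

/-- At a vertex, one of the two recombinations of `f` and `g` crosses if and only if `f` and `g`
cross and are not recombined there, and never both of them do. -/
theorem crossAt_swap_table : ∀ s₀ s₁ s₂ s₃ : Fin 5,
    let f : Fin 5 → ZMod 2 := fun s => swapTable s 0
    let α : Fin 5 → ZMod 2 := fun s => swapTable s 1
    let g : Fin 5 → ZMod 2 := fun s => swapTable s 2
    let β : Fin 5 → ZMod 2 := fun s => swapTable s 3
    let F₁ := α + β
    let G₁ := f + g + α + β
    let F₂ := α + g + β
    let G₂ := f + α + β
    f s₀ + f s₁ + f s₂ + f s₃ = 0 → g s₀ + g s₁ + g s₂ + g s₃ = 0 →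
    α s₀ + α s₁ + α s₂ + α s₃ = β s₀ + β s₁ + β s₂ + β s₃ →
    ¬ (f s₀ = 1 ∧ f s₁ = 1 ∧ f s₂ = 1 ∧ f s₃ = 1) →
    ¬ (g s₀ = 1 ∧ g s₁ = 1 ∧ g s₂ = 1 ∧ g s₃ = 1) →
    (α s₀ + α s₁ + α s₂ + α s₃ = 1 →
      CrossAt ![f s₀, f s₁, f s₂, f s₃] ![g s₀, g s₁, g s₂, g s₃]) →
    (CrossAt ![F₁ s₀, F₁ s₁, F₁ s₂, F₁ s₃] ![G₁ s₀, G₁ s₁, G₁ s₂, G₁ s₃] ∨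
      CrossAt ![F₂ s₀, F₂ s₁, F₂ s₂, F₂ s₃] ![G₂ s₀, G₂ s₁, G₂ s₂, G₂ s₃] ↔
        CrossAt ![f s₀, f s₁, f s₂, f s₃] ![g s₀, g s₁, g s₂, g s₃] ∧
          α s₀ + α s₁ + α s₂ + α s₃ = 0) ∧
    ¬ (CrossAt ![F₁ s₀, F₁ s₁, F₁ s₂, F₁ s₃] ![G₁ s₀, G₁ s₁, G₁ s₂, G₁ s₃] ∧
      CrossAt ![F₂ s₀, F₂ s₁, F₂ s₂, F₂ s₃] ![G₂ s₀, G₂ s₁, G₂ s₂, G₂ s₃]) := by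
  decide +kernel

theorem comp_eq_vec {A B : Type*} (f : A → B) (e : Fin 4 → A) :
    f ∘ e = ![f (e 0), f (e 1), f (e 2), f (e 3)] := by
  funext i
  fin_cases i <;> rfl

/-- The crossings of an even set of edges with a disjoint union of even sets. -/
theorem ncard_crossings_add [Finite V] [Fintype H] {p q g : H → ZMod 2} (hp : G.IsEven p)
    (hpq : ∀ h, p h * q h = 0) (hpg : ∀ h, p h * g h = 0) (hqg : ∀ h, q h * g h = 0) :
    (G.crossings (p + q) g).ncard = (G.crossings p g).ncard + (G.crossings q g).ncard := by
  obtain ⟨σ⟩ := G.exists_smoothing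
  have hst : ∀ x y z : ZMod 2, x * y = 0 → x * z = 0 → y * z = 0 → ∃ s : Fin 4,
      x = splitTable s 0 ∧ y = splitTable s 1 ∧ z = splitTable s 2 := by
    intro x y z hxy hxz hyz
    rcases eq_zero_or_one x with rfl | rfl
    · rcases eq_zero_or_one y with rfl | rfl
      · rcases eq_zero_or_one z with rfl | rfl
        exacts [⟨0, rfl, rfl, rfl⟩, ⟨3, rfl, rfl, rfl⟩]
      · rw [one_mul] at hyz
        exact ⟨2, rfl, rfl, hyz⟩
    · rw [one_mul] at hxy hxz
      exact ⟨1, rfl, hxy, hxz⟩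
  have key : ∀ v, (v ∈ G.crossings (p + q) g ↔ v ∈ G.crossings p g ∨ v ∈ G.crossings q g) ∧
      ¬ (v ∈ G.crossings p g ∧ v ∈ G.crossings q g) := by
    intro v
    obtain ⟨h, rfl⟩ := exists_vert_eq (G := G) v
    have hpqg : ∀ h, (p + q) h * g h = 0 := fun h => by
      rw [Pi.add_apply, add_mul, hpg, hqg, add_zero]
    rw [σ.mem_crossings_iff_crossAt hpqg, σ.mem_crossings_iff_crossAt hpg,
      σ.mem_crossings_iff_crossAt hqg]
    have hb := hp.boundary (G.vert h)
    rw [σ.boundary_eq_sum_star] at hb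
    simp only [comp_eq_vec, Pi.add_apply]
    choose s h1 h2 h3 using fun i => hst _ _ _ (hpq (σ.star h i)) (hpg (σ.star h i))
      (hqg (σ.star h i))
    simp only [h1, h2, h3] at hb ⊢
    exact crossAt_add_left_table _ _ _ _ hb
  rw [← Set.ncard_union_eq (Set.disjoint_left.2 fun v h1 h2 => (key v).2 ⟨h1, h2⟩)]
  congr 1
  ext v
  exact (key v).1

/-- A cycle does not use all half-edges at a vertex. -/
theorem SimpleCycle.not_all_star (C : G.SimpleCycle) (σ : G.Smoothing) (h : H) :
    ¬ (C.indicator (σ.star h 0) = 1 ∧ C.indicator (σ.star h 1) = 1 ∧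
      C.indicator (σ.star h 2) = 1 ∧ C.indicator (σ.star h 3) = 1) := by
  rintro ⟨h0, h1, h2, -⟩
  rw [C.indicator_eq_one] at h0 h1 h2
  obtain ⟨i, hi⟩ := Visits.exists_dart (C := C) ⟨_, h0, rfl⟩
  have hv : ∀ j, G.vert (σ.star h j) = G.vert (C.dart i) := fun j => by
    rw [hi, σ.vert_star, σ.vert_star]
  have e0 := (C.mem_halfEdges_iff (hv 0)).1 h0
  have e1 := (C.mem_halfEdges_iff (hv 1)).1 h1
  have e2 := (C.mem_halfEdges_iff (hv 2)).1 h2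
  have hne := fun a b => (σ.star_injective h).ne (a₁ := a) (a₂ := b)
  have n01 := hne 0 1 (by decide)
  have n02 := hne 0 2 (by decide)
  have n12 := hne 1 2 (by decide)
  rcases e0 with e0 | e0 <;> rcases e1 with e1 | e1 <;> rcases e2 with e2 | e2 <;> simp_all

/-- Two cycles with the crossing vertices `x ≠ y` can be recombined at `x` and `y` in two ways; both
crossings disappear, and each of the other crossings survives in exactly one of the two ways. -/
theorem ncard_crossings_swap [Finite V] [Fintype H] [DecidableEq V] (C D : G.SimpleCycle)
    (hCD : ∀ h, C.indicator h * D.indicator h = 0) {x y : V} (hxy : x ≠ y)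
    (hx : x ∈ G.crossings C.indicator D.indicator) (hy : y ∈ G.crossings C.indicator D.indicator)
    {α β : H → ZMod 2} (hα : ∀ h, α h = 1 → C.indicator h = 1)
    (hβ : ∀ h, β h = 1 → D.indicator h = 1)
    (hα' : ∀ v, G.boundary α v = (if x = v then 1 else 0) + (if y = v then 1 else 0))
    (hβ' : ∀ v, G.boundary β v = (if x = v then 1 else 0) + (if y = v then 1 else 0)) :
    (∀ h, (α + β) h * (C.indicator + D.indicator + α + β) h = 0) ∧
    (∀ h, (α + D.indicator + β) h * (C.indicator + α + β) h = 0) ∧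
    (G.crossings (α + β) (C.indicator + D.indicator + α + β)).ncard +
      (G.crossings (α + D.indicator + β) (C.indicator + α + β)).ncard + 2 =
      (G.crossings C.indicator D.indicator).ncard := by
  obtain ⟨σ⟩ := G.exists_smoothing
  have hst : ∀ f a g b : ZMod 2, f * g = 0 → (a = 1 → f = 1) → (b = 1 → g = 1) → ∃ s : Fin 5,
      f = swapTable s 0 ∧ a = swapTable s 1 ∧ g = swapTable s 2 ∧ b = swapTable s 3 := by decide
  have hd1 : ∀ h, (α + β) h * (C.indicator + D.indicator + α + β) h = 0 := by
    intro h
    obtain ⟨s, h1, h2, h3, h4⟩ := hst _ _ _ _ (hCD h) (hα h) (hβ h)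
    simp only [Pi.add_apply, h1, h2, h3, h4]
    clear * -
    revert s; decide
  have hd2 : ∀ h, (α + D.indicator + β) h * (C.indicator + α + β) h = 0 := by
    intro h
    obtain ⟨s, h1, h2, h3, h4⟩ := hst _ _ _ _ (hCD h) (hα h) (hβ h)
    simp only [Pi.add_apply, h1, h2, h3, h4]
    clear * -
    revert s; decide
  refine ⟨hd1, hd2, ?_⟩
  have key : ∀ v, ((v ∈ G.crossings (α + β) (C.indicator + D.indicator + α + β) ∨
      v ∈ G.crossings (α + D.indicator + β) (C.indicator + α + β)) ↔
        v ∈ G.crossings C.indicator D.indicator ∧ G.boundary α v = 0) ∧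
      ¬ (v ∈ G.crossings (α + β) (C.indicator + D.indicator + α + β) ∧
        v ∈ G.crossings (α + D.indicator + β) (C.indicator + α + β)) := by
    intro v
    have hab : G.boundary α v = G.boundary β v := by rw [hα', hβ']
    have ha1 : G.boundary α v = 1 → v ∈ G.crossings C.indicator D.indicator := by
      rw [hα']
      intro h
      by_cases h1 : x = v
      · exact h1 ▸ hx
      · by_cases h2 : y = v
        · exact h2 ▸ hy
        · simp [h1, h2] at h
    obtain ⟨h, rfl⟩ := exists_vert_eq (G := G) v
    have hf := C.isEven_indicator.boundary (G.vert h)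
    have hg := D.isEven_indicator.boundary (G.vert h)
    have nf := C.not_all_star σ h
    have ng := D.not_all_star σ h
    rw [σ.mem_crossings_iff_crossAt hCD] at ha1 ⊢
    rw [σ.mem_crossings_iff_crossAt hd1, σ.mem_crossings_iff_crossAt hd2]
    simp only [σ.boundary_eq_sum_star, comp_eq_vec] at ha1 hab hf hg ⊢
    choose s h1 h2 h3 h4 using fun i =>
      hst _ _ _ _ (hCD (σ.star h i)) (hα (σ.star h i)) (hβ (σ.star h i))
    have := crossAt_swap_table (s 0) (s 1) (s 2) (s 3)
    simp only [Pi.add_apply] at this ⊢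
    simp only [h1, h2, h3, h4] at ha1 hab hf hg nf ng ⊢
    exact this hf hg hab nf ng ha1
  have hxy' : {x, y} ⊆ G.crossings C.indicator D.indicator := by
    rintro v (rfl | rfl)
    exacts [hx, hy]
  rw [← Set.ncard_union_eq (Set.disjoint_left.2 fun v h1 h2 => (key v).2 ⟨h1, h2⟩),
    ← Set.ncard_sdiff_add_ncard_of_subset hxy', Set.ncard_pair hxy]
  congr 2
  ext v
  rw [Set.mem_union, (key v).1, hα']
  simp only [Set.mem_sdiff, Set.mem_insert_iff, Set.mem_singleton_iff, not_or, eq_comm (a := v)]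
  by_cases h1 : x = v
  · subst h1; simp [hxy.symm]
  · by_cases h2 : y = v <;> simp [h1, h2]

theorem SimpleCycle.edgeDisjoint_of_indicator {C D : G.SimpleCycle}
    (hCD : ∀ h, C.indicator h * D.indicator h = 0) : C.EdgeDisjoint D := by
  rw [EdgeDisjoint, Set.disjoint_left]
  intro h hC hD
  have := hCD h
  rw [C.indicator_eq_one.2 hC, D.indicator_eq_one.2 hD] at this
  exact absurd this (by decide)

theorem SimpleCycle.isCrossingVertex_iff {C D : G.SimpleCycle}
    (hCD : ∀ h, C.indicator h * D.indicator h = 0) (v : V) :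
    C.IsCrossingVertex D v ↔ v ∈ G.crossings C.indicator D.indicator := by
  have hdis := edgeDisjoint_of_indicator hCD
  have aux : ∀ C D : G.SimpleCycle, C.EdgeDisjoint D → C.Visits v → D.Visits v →
      C.PassesAlongPair v → v ∈ G.crossings C.indicator D.indicator := by
    rintro C D hdis hC hD ⟨h, rfl, h1, h2⟩
    obtain ⟨σ⟩ := G.exists_smoothing
    have hm := fun i => hdis.mem_or_mem hC hD (σ.vert_star h i)
    have hne := fun a b => (σ.star_injective h).ne (a₁ := a) (a₂ := b)
    have h3 : ∀ i, i ≠ 0 → i ≠ 1 → σ.star h i ∈ D.halfEdges := by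
      intro i hi0 hi1
      refine (hm i).resolve_left fun h3 => ?_
      obtain ⟨j, hj⟩ := hC.exists_dart
      have e0 := (C.mem_halfEdges_iff hj.symm).1 h1
      have e1 := (C.mem_halfEdges_iff ((σ.vert_star h 1).trans hj.symm)).1 h2
      have e2 := (C.mem_halfEdges_iff ((σ.vert_star h i).trans hj.symm)).1 h3
      have n01 := hne 0 1 (by decide)
      have n02 := hne i 0 hi0
      have n12 := hne i 1 hi1
      have s0 : σ.star h 0 = h := rfl
      have s1 : σ.star h 1 = G.partner h := rfl
      rw [s0] at n01 n02
      rw [s1] at n01 n12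
      rw [s1] at e1
      rcases e0 with e0 | e0 <;> rcases e1 with e1 | e1 <;> rcases e2 with e2 | e2 <;>
        first
          | exact n01 (e0.trans e1.symm)
          | exact n02 (e2.trans e0.symm)
          | exact n12 (e2.trans e1.symm)
    exact ⟨h, σ.turn h, rfl, σ.vert_turn h, C.indicator_eq_one.2 h1, C.indicator_eq_one.2 h2,
      D.indicator_eq_one.2 (h3 2 (by decide) (by decide)),
      D.indicator_eq_one.2 (h3 3 (by decide) (by decide))⟩
  constructor
  · rintro ⟨hC, hD, h | h⟩
    · exact aux C D hdis hC hD h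
    · rw [crossings_comm]
      exact aux D C hdis.symm hD hC h
  · rintro ⟨h, k, hv, kv, h1, h2, h3, -⟩
    rw [C.indicator_eq_one] at h1 h2
    rw [D.indicator_eq_one] at h3
    exact ⟨⟨h, h1, hv⟩, ⟨k, h3, kv⟩, Or.inl ⟨h, hv, h1, h2⟩⟩

/-- If two disjoint even sets of edges have an odd number of crossings, then there are two
edge-disjoint cycles with exactly one crossing vertex. Take such sets with as few crossings and then
as few edges as possible: both are cycles, as the number of crossings is additive, and two crossings
could be removed by recombining the cycles. -/
theorem exists_unique_crossing_of_odd [Finite V] [Fintype H] (f g : H → ZMod 2)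
    (hf : G.IsEven f) (hg : G.IsEven g) (hfg : ∀ h, f h * g h = 0)
    (hodd : Odd (G.crossings f g).ncard) :
    ∃ C D : G.SimpleCycle, C.EdgeDisjoint D ∧ ∃! v, C.IsCrossingVertex D v := by
  classical
  induction hm : (G.crossings f g).ncard using Nat.strong_induction_on generalizing f g with
  | _ m ihm =>
  induction hN : {h | f h = 1}.ncard + {h | g h = 1}.ncard using Nat.strong_induction_on
    generalizing f g with
  | _ N ihN =>
  have hsub : ∀ a b : ZMod 2, (a = 1 → b = 1) → a * (b + a) = 0 := by decide
  have hsub1 : ∀ a b : ZMod 2, (a = 1 → b = 1) → b + a = 1 → b = 1 := by decide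
  have hsub2 : ∀ a b : ZMod 2, a + (b + a) = b := by decide
  have hle : ∀ a b c : ZMod 2, (a = 1 → b = 1) → b * c = 0 → a * c = 0 := by decide
  obtain ⟨v, h₀, k₀, -, -, hh₀, -, hk₀, -⟩ : (G.crossings f g).Nonempty := by
    apply Set.nonempty_of_ncard_ne_zero
    intro h
    rw [h] at hodd
    exact absurd hodd (by decide)
  -- by minimality, a non-empty even part `p` of `f` is all of `f`
  have hstep : ∀ f g p : H → ZMod 2, G.IsEven f → G.IsEven g → (∀ h, f h * g h = 0) →
      Odd (G.crossings f g).ncard → (G.crossings f g).ncard = m →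
      {h | f h = 1}.ncard + {h | g h = 1}.ncard = N →
      G.IsEven p → (∀ h, p h = 1 → f h = 1) → (∃ h, p h = 1) →
      (∀ f' g' : H → ZMod 2, G.IsEven f' → G.IsEven g' → (∀ h, f' h * g' h = 0) →
        Odd (G.crossings f' g').ncard → (G.crossings f' g').ncard ≤ m →
        {h | f' h = 1}.ncard + {h | g' h = 1}.ncard < N →
        ∃ C D : G.SimpleCycle, C.EdgeDisjoint D ∧ ∃! v, C.IsCrossingVertex D v) →
      (∃ C D : G.SimpleCycle, C.EdgeDisjoint D ∧ ∃! v, C.IsCrossingVertex D v) ∨ f = p := by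
    intro f g p hf hg hfg hodd hm hN hp hpf hne ih
    by_cases hall : ∀ h, f h = 1 → p h = 1
    · right
      funext h
      rcases eq_zero_or_one (f h) with h1 | h1 <;> rcases eq_zero_or_one (p h) with h2 | h2
      · rw [h1, h2]
      · exact absurd (h1.symm.trans (hpf h h2)) (by decide)
      · exact absurd (h2.symm.trans (hall h h1)) (by decide)
      · rw [h1, h2]
    left
    push Not at hall
    obtain ⟨k, hk1, hk2⟩ := hall
    obtain ⟨l, hl⟩ := hne
    have hpg : ∀ h, p h * g h = 0 := fun h => hle _ _ _ (hpf h) (hfg h)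
    have hqf : ∀ h, (f + p) h = 1 → f h = 1 := fun h => hsub1 _ _ (hpf h)
    have hqg : ∀ h, (f + p) h * g h = 0 := fun h => hle _ _ _ (hqf h) (hfg h)
    have hsum : (G.crossings f g).ncard =
        (G.crossings p g).ncard + (G.crossings (f + p) g).ncard := by
      rw [← ncard_crossings_add (q := f + p) hp (fun h => hsub _ _ (hpf h)) hpg hqg]
      congr 2
      funext h
      exact (hsub2 _ _).symm
    have hlt1 : {h | p h = 1}.ncard < {h | f h = 1}.ncard :=
      Set.ncard_lt_ncard ⟨fun h hh => hpf h hh, fun hs => hk2 (hs hk1)⟩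
    have hlt2 : {h | (f + p) h = 1}.ncard < {h | f h = 1}.ncard :=
      Set.ncard_lt_ncard ⟨fun h hh => hqf h hh, fun hs => by
        have : (f + p) l = 1 := hs (hpf l hl)
        rw [Pi.add_apply, hpf l hl, hl] at this
        exact absurd this (by decide)⟩
    rcases Nat.even_or_odd (G.crossings p g).ncard with he | ho
    · refine ih (f + p) g (hf.add hp) hg hqg ?_ (by omega) (by omega)
      rw [hsum] at hodd
      exact (Nat.odd_add'.1 hodd).2 he
    · exact ih p g hp hg hpg ho (by omega) (by omega)
  have ih : ∀ f' g' : H → ZMod 2, G.IsEven f' → G.IsEven g' → (∀ h, f' h * g' h = 0) →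
        Odd (G.crossings f' g').ncard → (G.crossings f' g').ncard ≤ m →
        {h | f' h = 1}.ncard + {h | g' h = 1}.ncard < N →
        ∃ C D : G.SimpleCycle, C.EdgeDisjoint D ∧ ∃! v, C.IsCrossingVertex D v := by
    intro f' g' hf' hg' hfg' hodd' hle' hlt'
    rcases hle'.eq_or_lt with h | h
    · exact ihN _ hlt' f' g' hf' hg' hfg' hodd' h rfl
    · exact ihm _ h f' g' hf' hg' hfg' hodd' rfl
  obtain ⟨C, hC⟩ := hf.exists_simpleCycle hh₀
  obtain ⟨D, hD⟩ := hg.exists_simpleCycle hk₀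
  have hne : ∀ C : G.SimpleCycle, ∃ h, C.indicator h = 1 := fun C =>
    ⟨C.dart 0, C.indicator_eq_one.2 (C.dart_mem_halfEdges 0)⟩
  rcases hstep f g C.indicator hf hg hfg hodd hm hN C.isEven_indicator
    (fun h hh => hC h (C.indicator_eq_one.1 hh)) (hne C) ih with h | rfl
  · exact h
  rcases hstep g C.indicator D.indicator hg hf (fun h => by rw [mul_comm]; exact hfg h)
    (by rwa [crossings_comm]) (by rwa [crossings_comm]) (by rwa [add_comm]) D.isEven_indicator
    (fun h hh => hD h (D.indicator_eq_one.1 hh)) (hne D) ih with h | rfl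
  · exact h
  have hdis := SimpleCycle.edgeDisjoint_of_indicator hfg
  by_cases h1 : (G.crossings C.indicator D.indicator).ncard = 1
  · obtain ⟨v, hv⟩ := Set.ncard_eq_one.1 h1
    refine ⟨C, D, hdis, v, ?_, ?_⟩
    · exact (SimpleCycle.isCrossingVertex_iff hfg v).2 (hv ▸ rfl)
    · intro w hw
      have := (SimpleCycle.isCrossingVertex_iff hfg w).1 hw
      rw [hv] at this
      exact this
  · obtain ⟨x, hx, y, hy, hxy⟩ := (Set.one_lt_ncard (Set.toFinite _)).1
      (show 1 < (G.crossings C.indicator D.indicator).ncard by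
        have := hodd.pos; omega)
    have hx' := (SimpleCycle.isCrossingVertex_iff hfg x).2 hx
    have hy' := (SimpleCycle.isCrossingVertex_iff hfg y).2 hy
    obtain ⟨α, hαo, hα, hα'⟩ := C.exists_chain hx'.1 hy'.1
    obtain ⟨β, hβo, hβ, hβ'⟩ := D.exists_chain hx'.2.1 hy'.2.1
    obtain ⟨hd1, hd2, hsum⟩ := ncard_crossings_swap C D hfg hxy hx hy hα hβ hα' hβ'
    have hαβ : G.IsEven (α + β) :=
      ⟨fun h => by simp only [Pi.add_apply, hαo, hβo], fun v => by
        rw [boundary_add, hα', hβ', CharTwo.add_self_eq_zero]⟩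
    have hE1 : G.IsEven (C.indicator + D.indicator + α + β) := by
      rw [add_assoc]
      exact (hf.add hg).add hαβ
    have hE2 : G.IsEven (α + D.indicator + β) := by
      rw [add_right_comm]
      exact hαβ.add hg
    have hE3 : G.IsEven (C.indicator + α + β) := by
      rw [add_assoc]
      exact hf.add hαβ
    rcases Nat.even_or_odd (G.crossings (α + β) (C.indicator + D.indicator + α + β)).ncard
      with he | ho
    · refine ihm _ (by omega) _ _ hE2 hE3 hd2 ?_ rfl
      rw [← Nat.not_even_iff_odd] at hodd ⊢
      intro he'
      apply hodd
      rw [← hsum]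
      exact (he.add he').add (by decide)
    · exact ihm _ (by omega) _ _ hαβ hE1 hd1 ho rfl

end XGraph

/-! ### Circuits of a smoothing -/

namespace XGraph

variable {V H : Type*} {G : XGraph V H}

namespace Smoothing

variable (σ : G.Smoothing)

/-- Going along an edge and turning at its end. -/
def next : Equiv.Perm H where
  toFun h := σ.turn (G.opp h)
  invFun h := G.opp (σ.turn h)
  left_inv h := by simp [σ.turn_turn, G.opp_opp]
  right_inv h := by simp [σ.turn_turn, G.opp_opp]

theorem next_apply (h : H) : σ.next h = σ.turn (G.opp h) := rfl

theorem turn_next (h : H) : σ.turn (σ.next h) = G.opp h := σ.turn_turn _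

/-- A circuit never uses the two half-edges of a turn as outgoing half-edges. -/
theorem pow_next_ne_turn (i : ℕ) (h : H) : (σ.next ^ i) h ≠ σ.turn h := by
  induction i using Nat.twoStepInduction generalizing h with
  | zero => exact (σ.turn_ne h).symm
  | one =>
    intro hh
    rw [pow_one, next_apply] at hh
    exact G.opp_ne h (σ.turn_injective hh)
  | more i ih _ =>
    intro hh
    rw [pow_succ', Equiv.Perm.mul_apply, next_apply] at hh
    have h1 := σ.turn_injective hh
    rw [pow_succ, Equiv.Perm.mul_apply] at h1
    apply ih (σ.next h)
    rw [turn_next]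
    exact opp_eq_comm.1 h1

theorem not_sameCycle_turn [Finite H] (h : H) : ¬ σ.next.SameCycle h (σ.turn h) := by
  intro hs
  obtain ⟨i, -, hi⟩ := hs.exists_pow_eq'
  exact σ.pow_next_ne_turn i h hi

theorem sameCycle_next (h : H) : σ.next.SameCycle h (σ.next h) :=
  (Equiv.Perm.sameCycle_apply_right).2 (Equiv.Perm.SameCycle.refl _ _)

theorem sameCycle_turn_next (h : H) : σ.next.SameCycle (σ.turn h) (σ.turn (σ.next h)) := by
  rw [turn_next]
  have : σ.next (G.opp h) = σ.turn h := by rw [next_apply, G.opp_opp]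
  rw [← this]
  exact (σ.sameCycle_next _).symm

theorem sameCycle_pow_next (i : ℕ) (h : H) : σ.next.SameCycle h ((σ.next ^ i) h) :=
  Equiv.Perm.sameCycle_pow_right.2 (Equiv.Perm.SameCycle.refl _ _)

theorem SameCycle.turn [Finite H] {σ : G.Smoothing} {h k : H} (hs : σ.next.SameCycle h k) :
    σ.next.SameCycle (σ.turn h) (σ.turn k) := by
  obtain ⟨i, -, rfl⟩ := hs.exists_pow_eq'
  clear hs
  induction i with
  | zero => exact Equiv.Perm.SameCycle.refl _ _
  | succ i ih =>
    refine ih.trans ?_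
    rw [pow_succ', Equiv.Perm.mul_apply]
    exact σ.sameCycle_turn_next _

/-- The half-edges `h` and `k` lie on the same circuit of the smoothing. -/
def OnSameCircuit (h k : H) : Prop := σ.next.SameCycle h k ∨ σ.next.SameCycle (σ.turn h) k

theorem onSameCircuit_equivalence [Finite H] : Equivalence σ.OnSameCircuit where
  refl h := Or.inl (Equiv.Perm.SameCycle.refl _ _)
  symm := by
    rintro h k (hs | hs)
    · exact Or.inl hs.symm
    · have := SameCycle.turn hs
      rw [σ.turn_turn] at this
      exact Or.inr this.symm
  trans := by
    rintro h k l (hs | hs) (ht | ht)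
    · exact Or.inl (hs.trans ht)
    · exact Or.inr ((SameCycle.turn hs).trans ht)
    · exact Or.inr (hs.trans ht)
    · have := SameCycle.turn hs
      rw [σ.turn_turn] at this
      exact Or.inl (this.trans ht)

theorem onSameCircuit_turn (h : H) : σ.OnSameCircuit h (σ.turn h) :=
  Or.inr (Equiv.Perm.SameCycle.refl _ _)

theorem onSameCircuit_opp (h : H) : σ.OnSameCircuit h (G.opp h) := by
  right
  rw [← turn_next]
  exact σ.sameCycle_turn_next h

/-- A relation that is compatible with turns and edges contains the relation of lying on the same
circuit. -/
theorem OnSameCircuit.rec_on [Finite H] {σ : G.Smoothing} {r : H → H → Prop} (hr : Equivalence r)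
    (ht : ∀ h, r h (σ.turn h)) (ho : ∀ h, r h (G.opp h)) {h k : H} (hs : σ.OnSameCircuit h k) :
    r h k := by
  have key : ∀ h k, σ.next.SameCycle h k → r h k := by
    intro h k hs
    obtain ⟨i, -, rfl⟩ := hs.exists_pow_eq'
    clear hs
    induction i with
    | zero => exact hr.refl _
    | succ i ih =>
      rw [pow_succ', Equiv.Perm.mul_apply]
      exact hr.trans ih (hr.trans (ho _) (ht _))
  rcases hs with hs | hs
  · exact key _ _ hs
  · exact hr.trans (ht h) (key _ _ hs)

/-- The smoothing that turns the other way at the vertex `v`. -/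
noncomputable def switch (v : V) : G.Smoothing :=
  open Classical in
  { turn := fun h => if G.vert h = v then G.partner (σ.turn h) else σ.turn h
    turn_turn := by
      intro h
      by_cases hv : G.vert h = v
      · simp [hv, G.vert_partner, σ.vert_turn, σ.turn_partner, σ.turn_turn, G.partner_partner]
      · simp [hv, σ.vert_turn, σ.turn_turn]
    turn_ne := by
      intro h
      split_ifs
      · intro hh
        apply σ.turn_ne_partner h
        rw [← partner_injective.eq_iff (f := G.partner), hh, G.partner_partner]
      · exact σ.turn_ne h
    turn_ne_partner := by
      intro h
      split_ifs
      · exact fun hh => σ.turn_ne h (partner_injective hh)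
      · exact σ.turn_ne_partner h
    vert_turn := by
      intro h
      split_ifs
      · rw [G.vert_partner, σ.vert_turn]
      · exact σ.vert_turn h
    turn_partner := by
      intro h
      by_cases hv : G.vert h = v <;> simp [hv, G.vert_partner, σ.turn_partner] }

theorem switch_turn_of_eq {v : V} {h : H} (hv : G.vert h = v) :
    (σ.switch v).turn h = G.partner (σ.turn h) := by
  simp [switch, hv]

theorem switch_turn_of_ne {v : V} {h : H} (hv : G.vert h ≠ v) :
    (σ.switch v).turn h = σ.turn h := by
  simp [switch, hv]

/-- If the circuit through `h` does not return to the vertex of `h`, then the rest of this circuit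
still joins `h` to `turn h` after switching at this vertex. -/
theorem switch_onSameCircuit_turn [Finite H] {h : H} (hne : ¬ σ.OnSameCircuit h (G.partner h)) :
    (σ.switch (G.vert h)).OnSameCircuit h (σ.turn h) := by
  classical
  have heq := (σ.switch (G.vert h)).onSameCircuit_equivalence
  have heq0 := σ.onSameCircuit_equivalence
  have hex : ∃ n, 0 < n ∧ (σ.next ^ n) h = h :=
    ⟨orderOf σ.next, orderOf_pos _, by rw [pow_orderOf_eq_one]; rfl⟩
  obtain ⟨hn0, hn⟩ := Nat.find_spec hex
  have hmin := fun m hm => Nat.find_min hex (m := m) hm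
  generalize Nat.find hex = n at hn0 hn hmin
  have key : ∀ j < n, (σ.switch (G.vert h)).OnSameCircuit h (G.opp ((σ.next ^ j) h)) := by
    intro j
    induction j with
    | zero => intro _; exact (σ.switch _).onSameCircuit_opp h
    | succ j ih =>
      intro hj
      have hstep : (σ.next ^ (j + 1)) h = σ.turn (G.opp ((σ.next ^ j) h)) := by
        rw [pow_succ', Equiv.Perm.mul_apply, next_apply]
      have hcirc : σ.OnSameCircuit h (G.opp ((σ.next ^ j) h)) :=
        heq0.trans (Or.inl (σ.sameCycle_pow_next j h)) (σ.onSameCircuit_opp _)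
      have hv : G.vert (G.opp ((σ.next ^ j) h)) ≠ G.vert h := by
        intro hv
        rcases σ.eq_or_eq_of_vert_eq hv with h1 | h1 | h1 | h1
        · apply σ.pow_next_ne_turn (j + 1) h
          rw [hstep, h1]
        · exact hne (h1 ▸ hcirc)
        · rw [h1, σ.turn_turn] at hstep
          exact hmin (j + 1) hj ⟨Nat.succ_pos j, hstep⟩
        · apply hne
          rw [h1, ← σ.turn_partner] at hcirc
          exact heq0.trans hcirc (heq0.symm (σ.onSameCircuit_turn _))
      refine heq.trans (heq.trans (ih (by omega)) ?_) ((σ.switch _).onSameCircuit_opp _)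
      rw [hstep, ← σ.switch_turn_of_ne hv]
      exact (σ.switch _).onSameCircuit_turn _
  have hlast := key (n - 1) (by omega)
  have : σ.turn h = G.opp ((σ.next ^ (n - 1)) h) := by
    conv_lhs => rw [← hn]
    rw [show n = (n - 1) + 1 by omega, pow_succ', Equiv.Perm.mul_apply, turn_next]
    rfl
  rw [this]
  exact hlast

/-- Switching at a vertex that lies on two circuits merges these circuits. -/
theorem ncard_onSameCircuit_lt_switch [Finite H] {h : H}
    (hne : ¬ σ.OnSameCircuit h (G.partner h)) :
    {x : H × H | σ.OnSameCircuit x.1 x.2}.ncard <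
      {x : H × H | (σ.switch (G.vert h)).OnSameCircuit x.1 x.2}.ncard := by
  have heq := (σ.switch (G.vert h)).onSameCircuit_equivalence
  have heq0 := σ.onSameCircuit_equivalence
  have hfib : ∀ k, G.vert k = G.vert h → ¬ σ.OnSameCircuit k (G.partner k) := by
    intro k hk hcon
    rcases σ.eq_or_eq_of_vert_eq hk with rfl | rfl | rfl | rfl
    · exact hne hcon
    · rw [G.partner_partner] at hcon
      exact hne (heq0.symm hcon)
    · rw [← σ.turn_partner] at hcon
      exact hne (heq0.trans (heq0.trans (σ.onSameCircuit_turn h) hcon)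
        (heq0.symm (σ.onSameCircuit_turn _)))
    · rw [G.partner_partner, ← σ.turn_partner] at hcon
      exact hne (heq0.trans (heq0.trans (σ.onSameCircuit_turn h) (heq0.symm hcon))
        (heq0.symm (σ.onSameCircuit_turn _)))
  have hturn : ∀ k, (σ.switch (G.vert h)).OnSameCircuit k (σ.turn k) := by
    intro k
    by_cases hk : G.vert k = G.vert h
    · rw [← hk]
      exact σ.switch_onSameCircuit_turn (hfib k hk)
    · rw [← σ.switch_turn_of_ne hk]
      exact (σ.switch _).onSameCircuit_turn k
  refine Set.ncard_lt_ncard ⟨?_, ?_⟩ (Set.toFinite _)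
  · rintro ⟨a, b⟩ hab
    exact OnSameCircuit.rec_on heq hturn (σ.switch _).onSameCircuit_opp hab
  · intro hsub
    have h1 : (σ.switch (G.vert h)).OnSameCircuit h (G.partner h) := by
      refine heq.trans (hturn h) ?_
      have := (σ.switch (G.vert h)).onSameCircuit_turn (σ.turn h)
      rwa [σ.switch_turn_of_eq (σ.vert_turn h), σ.turn_turn] at this
    exact hne (hsub (a := (h, G.partner h)) h1)

/-- There is a smoothing such that no vertex lies on two different circuits. -/
theorem _root_.XGraph.exists_smoothing_onSameCircuit_partner [Finite H] (G : XGraph V H) :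
    ∃ σ : G.Smoothing, ∀ h, σ.OnSameCircuit h (G.partner h) := by
  obtain ⟨σ₀⟩ := G.exists_smoothing
  let N : G.Smoothing → ℕ := fun σ => {x : H × H | σ.OnSameCircuit x.1 x.2}.ncard
  have hbdd : BddAbove (Set.range N) :=
    ⟨Nat.card (H × H), by rintro _ ⟨σ, rfl⟩; exact Set.ncard_le_card _⟩
  obtain ⟨σ, hσ⟩ := Nat.sSup_mem (Set.range_nonempty N (h := ⟨σ₀⟩)) hbdd
  refine ⟨σ, fun h => ?_⟩
  by_contra hne
  have h1 : N σ < N (σ.switch (G.vert h)) := σ.ncard_onSameCircuit_lt_switch hne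
  have h2 : N (σ.switch (G.vert h)) ≤ N σ := hσ ▸ le_csSup hbdd ⟨_, rfl⟩
  omega

end Smoothing

/-- The value of a chain on one of its half-edges, if no edge is used twice. -/
theorem chain_eq_one {s : ℕ → H} {n : ℕ} (hinj : ∀ a < n, ∀ b < n, s a = s b → a = b)
    (hopp : ∀ a < n, ∀ b < n, s a ≠ G.opp (s b)) {a : ℕ} (ha : a < n) :
    G.chain s n (s a) = 1 := by
  classical
  unfold chain
  rw [Finset.sum_eq_single_of_mem a (Finset.mem_range.2 ha)]
  · simp [hopp a ha a ha]
  · intro b hb hba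
    have hb := Finset.mem_range.1 hb
    have hne : s a ≠ s b := fun h => hba (hinj a ha b hb h).symm
    simp [hopp a ha b hb, hne]

/-- Suppose that no two disjoint even sets have an odd number of crossings. Then a circuit that
passes a vertex twice leaves it along the two half-edges of one pair: otherwise the vertex cuts the
circuit into two closed trails which cross at this vertex only. -/
theorem Smoothing.sameCycle_partner [Fintype H] (σ : G.Smoothing)
    (hP : ∀ f g : H → ZMod 2, G.IsEven f → G.IsEven g → (∀ h, f h * g h = 0) →
      Even (G.crossings f g).ncard) {h : H} (hh : σ.OnSameCircuit h (G.partner h)) :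
    σ.next.SameCycle h (G.partner h) := by
  classical
  refine hh.resolve_right fun hcon => ?_
  have hs := Smoothing.SameCycle.turn hcon
  rw [σ.turn_turn] at hs
  have hex : ∃ n, 0 < n ∧ (σ.next ^ n) h = h :=
    ⟨orderOf σ.next, orderOf_pos _, by rw [pow_orderOf_eq_one]; rfl⟩
  obtain ⟨hn0, hn⟩ := Nat.find_spec hex
  have hmin := fun m hm => Nat.find_min hex (m := m) hm
  generalize Nat.find hex = n at hn0 hn hmin
  set s : ℕ → H := fun a => (σ.next ^ a) h with hsdef
  have hsucc : ∀ a, s (a + 1) = σ.turn (G.opp (s a)) := fun a => by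
    simp only [hsdef]
    rw [pow_succ', Equiv.Perm.mul_apply, next_apply]
  have hsucc' : ∀ a, σ.turn (s (a + 1)) = G.opp (s a) := fun a => by rw [hsucc, σ.turn_turn]
  have hsn : s n = h := hn
  have hs0 : s 0 = h := rfl
  have hv : ∀ a, G.vert (G.opp (s a)) = G.vert (s (a + 1)) := fun a => by
    rw [hsucc, σ.vert_turn]
  have hinj : ∀ a < n, ∀ b < n, s a = s b → a = b := by
    have : ∀ a b, a < b → b < n → s a ≠ s b := by
      intro a b hab hb heq
      refine hmin (b - a) (by omega) ⟨by omega, ?_⟩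
      apply (σ.next ^ a).injective
      rw [← Equiv.Perm.mul_apply, ← pow_add, show a + (b - a) = b by omega]
      exact heq.symm
    intro a ha b hb heq
    rcases lt_trichotomy a b with h | h | h
    · exact absurd heq (this a b h hb)
    · exact h
    · exact absurd heq.symm (this b a h ha)
  have hopp : ∀ a b, s a ≠ G.opp (s b) := by
    intro a b heq
    rw [← hsucc'] at heq
    apply σ.not_sameCycle_turn (s (b + 1))
    rw [← heq]
    exact (σ.sameCycle_pow_next (b + 1) h).symm.trans (σ.sameCycle_pow_next a h)
  obtain ⟨j, hj, hjn⟩ : ∃ j, s j = σ.turn (G.partner h) ∧ j < n := by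
    obtain ⟨i, -, hi⟩ := hs.exists_pow_eq'
    refine ⟨i % n, ?_, Nat.mod_lt _ hn0⟩
    rw [← hi]
    conv_rhs => rw [← Nat.mod_add_div i n, pow_add, Equiv.Perm.mul_apply, pow_mul]
    have : ∀ q : ℕ, ((σ.next ^ n) ^ q) h = h := by
      intro q
      induction q with
      | zero => rfl
      | succ q ih => rw [pow_succ, Equiv.Perm.mul_apply, hn, ih]
    rw [this]
  have hj0 : 0 < j := by
    rcases Nat.eq_zero_or_pos j with rfl | h0
    · exfalso
      rw [hs0] at hj
      apply σ.turn_ne_partner h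
      conv_lhs => rw [hj]
      rw [σ.turn_turn]
    · exact h0
  -- `p` runs from `h` to `partner h`, and `q` is the rest of the circuit
  set p := G.chain s j with hp
  set q := G.chain (fun a => s (j + a)) (n - j) with hq
  have hpe : G.IsEven p := isEven_chain (fun a _ => hv a) (by
    rw [hj, hs0, σ.vert_turn, G.vert_partner])
  have hqe : G.IsEven q := isEven_chain (fun a _ => by rw [hv, add_assoc]) (by
    rw [show j + (n - j) = n by omega, hsn, add_zero, hj, σ.vert_turn, G.vert_partner])
  have hp1 : ∀ a < j, p (s a) = 1 := fun a ha =>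
    chain_eq_one (fun a ha b hb => hinj a (by omega) b (by omega)) (fun a _ b _ => hopp a b) ha
  have hq1 : ∀ a, j ≤ a → a < n → q (s a) = 1 := by
    intro a hja ha
    have := chain_eq_one (G := G) (s := fun a => s (j + a)) (n := n - j) (a := a - j)
      (fun a ha b hb heq => by have := hinj (j + a) (by omega) (j + b) (by omega) heq; omega)
      (fun a _ b _ => hopp _ _) (by omega)
    simp only [show j + (a - j) = a by omega] at this
    exact this
  have hpo : ∀ a < j, p (G.opp (s a)) = 1 := fun a ha => by rw [hpe.opp, hp1 a ha]
  have hqo : ∀ a, j ≤ a → a < n → q (G.opp (s a)) = 1 := fun a hja ha => by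
    rw [hqe.opp, hq1 a hja ha]
  have hpq : ∀ k, p k * q k = 0 := by
    intro k
    by_contra hne
    obtain ⟨a, ha, ha'⟩ := exists_of_chain_ne_zero (G := G) (left_ne_zero_of_mul hne)
    obtain ⟨b, hb, hb'⟩ := exists_of_chain_ne_zero (G := G) (right_ne_zero_of_mul hne)
    rcases ha' with rfl | rfl <;> rcases hb' with hb' | hb'
    · have := hinj _ (by omega) _ (by omega) hb'; omega
    · exact hopp _ _ hb'
    · exact hopp _ _ hb'.symm
    · have := hinj _ (by omega) _ (by omega) (opp_injective hb'); omega
  have hph : G.partner h = G.opp (s (j - 1)) := by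
    rw [← hsucc', show j - 1 + 1 = j by omega, hj, σ.turn_turn]
  have hth : σ.turn h = G.opp (s (n - 1)) := by
    rw [← hsucc', show n - 1 + 1 = n by omega, hsn]
  have hno : ∀ k, p k = 1 → q k = 1 → False := fun k h1 h2 => by
    have := hpq k
    rw [h1, h2] at this
    exact absurd this (by decide)
  have hone : G.crossings p q = {G.vert h} := by
    ext v
    constructor
    · rintro ⟨k, l, rfl, hlv, p1, p2, q1, q2⟩
      -- inside `p` a turn leads from `k` to another half-edge of `p`
      have hturn : ∀ k', (k' = k) → p (σ.turn k') = 1 → False := by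
        rintro k' rfl hk
        rcases σ.eq_or_eq_of_vert_eq hlv with rfl | rfl | rfl | rfl
        · exact hno _ p1 q1
        · exact hno _ p2 q1
        · exact hno _ hk q1
        · rw [G.partner_partner] at q2
          exact hno _ hk q2
      obtain ⟨a, ha, rfl | rfl⟩ := exists_of_chain_ne_zero (G := G) (n := j) (s := s) (h := k)
        (by rw [← hp, p1]; decide)
      · rcases Nat.eq_zero_or_pos a with rfl | ha0
        · rfl
        · refine (hturn _ rfl ?_).elim
          have := hsucc' (a - 1)
          rw [show a - 1 + 1 = a by omega] at this
          rw [this]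
          exact hpo _ (by omega)
      · by_cases haj : a + 1 = j
        · rw [Set.mem_singleton_iff, hv, haj, hj, σ.vert_turn, G.vert_partner]
        · refine (hturn _ rfl ?_).elim
          rw [← hsucc]
          exact hp1 _ (by omega)
    · rintro rfl
      refine ⟨h, s j, rfl, ?_, hp1 0 hj0, ?_, hq1 j le_rfl hjn, ?_⟩
      · rw [hj, σ.vert_turn, G.vert_partner]
      · rw [hph]; exact hpo _ (by omega)
      · rw [hj, σ.turn_partner, G.partner_partner, hth]
        exact hqo _ (by omega) (by omega)
  have := hP p q hpe hqe hpq
  rw [hone, Set.ncard_singleton] at this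
  exact absurd this (by decide)

/-- The half-edges of an `X`-graph arranged along a line: the circuits of a smoothing are written
one after the other. The passages of the circuits through the vertices get different numbers; `out`
singles out the half-edge with which a passage leaves its vertex. -/
structure Layout (G : XGraph V H) extends Smoothing G where
  out : H → Prop
  num : H → ℕ
  out_turn : ∀ h, out (turn h) ↔ ¬ out h
  out_opp : ∀ h, out (G.opp h) ↔ ¬ out h
  out_partner : ∀ h, out (G.partner h) ↔ out h
  num_turn : ∀ h, num (turn h) = num h
  eq_or_eq_of_num_eq : ∀ h k, num h = num k → k = h ∨ k = turn h
  /-- The edge leaving a passage enters the next one, or else it closes a circuit; in this case the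
  circuit is an interval that contains with one passage through a vertex also the other one. -/
  num_opp : ∀ h, out h → num (G.opp h) = num h + 1 ∨ (num (G.opp h) ≤ num h ∧
    ∀ k, num (G.opp h) ≤ num k → num k ≤ num h →
      num (G.opp h) ≤ num (G.partner k) ∧ num (G.partner k) ≤ num h)
  /-- An interval of this kind ends with the only edge in it that closes a circuit. -/
  num_eq_of_closing : ∀ h k, out h → out k → num (G.opp h) ≤ num h → num (G.opp k) ≤ num k →
    num (G.opp h) ≤ num k → num k ≤ num h → num k = num h

/-- Without odd crossings there is a layout: choose a smoothing all of whose vertices are passed twice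
by one circuit, orient each circuit, and number the passages along the circuits; both passages
through a vertex have partners as outgoing half-edges by `Smoothing.sameCycle_partner`. -/
theorem exists_layout [Fintype H] (G : XGraph V H)
    (hP : ∀ f g : H → ZMod 2, G.IsEven f → G.IsEven g → (∀ h, f h * g h = 0) →
      Even (G.crossings f g).ncard) : Nonempty G.Layout := by
  classical
  obtain ⟨σ, hσ⟩ := G.exists_smoothing_onSameCircuit_partner
  have hσp : ∀ h, σ.next.SameCycle h (G.partner h) := fun h => σ.sameCycle_partner hP (hσ h)
  let S : Setoid H := ⟨σ.OnSameCircuit, σ.onSameCircuit_equivalence⟩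
  let rep : H → H := fun h => (Quotient.mk S h).out
  have hrep : ∀ h, σ.OnSameCircuit (rep h) h := fun h => Quotient.mk_out (s := S) h
  have hrep_eq : ∀ h k, σ.OnSameCircuit h k → rep h = rep k := fun h k hk => by
    simp only [rep]
    rw [Quotient.sound (s := S) hk]
  let out : H → Prop := fun h => σ.next.SameCycle (rep h) h
  have hrt : ∀ h, rep (σ.turn h) = rep h := fun h => (hrep_eq _ _ (σ.onSameCircuit_turn h)).symm
  have hrn : ∀ h, rep (σ.next h) = rep h := fun h =>
    (hrep_eq _ _ (Or.inl (σ.sameCycle_next h))).symm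
  have hrp : ∀ h, rep (G.partner h) = rep h := fun h => (hrep_eq _ _ (hσ h)).symm
  have out_turn : ∀ h, out (σ.turn h) ↔ ¬ out h := by
    intro h
    simp only [out, hrt]
    constructor
    · exact fun h1 h2 => σ.not_sameCycle_turn h (h2.symm.trans h1)
    · intro h1
      have := Smoothing.SameCycle.turn ((hrep h).resolve_left h1)
      rwa [σ.turn_turn] at this
  have out_next : ∀ h, out (σ.next h) ↔ out h := by
    intro h
    simp only [out, hrn]
    exact Equiv.Perm.sameCycle_apply_right
  have out_opp : ∀ h, out (G.opp h) ↔ ¬ out h := by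
    intro h
    rw [← σ.turn_next, out_turn, out_next]
  have out_partner : ∀ h, out (G.partner h) ↔ out h := by
    intro h
    simp only [out, hrp]
    exact ⟨fun h1 => h1.trans (hσp h).symm, fun h1 => h1.trans (hσp h)⟩
  have hpos : ∀ h, out h → ∃ i : ℕ, (σ.next ^ i) (rep h) = h := fun h hh => by
    obtain ⟨i, -, hi⟩ := hh.exists_pow_eq'
    exact ⟨i, hi⟩
  let idx : H → ℕ := fun h => if hh : out h then Nat.find (hpos h hh) else 0
  have hidx : ∀ h, out h → (σ.next ^ idx h) (rep h) = h := by
    intro h hh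
    simp only [idx, hh, dif_pos]
    exact Nat.find_spec (hpos h hh)
  have hidx_le : ∀ h, out h → ∀ i, (σ.next ^ i) (rep h) = h → idx h ≤ i := by
    intro h hh i hi
    simp only [idx, hh, dif_pos]
    exact Nat.find_min' (hpos h hh) hi
  obtain ⟨M, hM⟩ : ∃ M, ∀ h, idx h < M :=
    ⟨Finset.univ.sup idx + 1, fun h => Nat.lt_succ_of_le (Finset.le_sup (Finset.mem_univ h))⟩
  let e : H → ℕ := fun h => Fintype.equivFin H h
  have he : Function.Injective e := fun a b hab =>
    (Fintype.equivFin H).injective (Fin.val_injective hab)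
  -- the circuit of `rep h` gets the block of numbers starting with `M * e (rep h)`
  let num₀ : H → ℕ := fun h => M * e (rep h) + idx h
  have hdiv : ∀ h k, num₀ h ≤ num₀ k → e (rep h) ≤ e (rep k) := by
    intro h k hhk
    by_contra! hlt
    have h1 : M * (e (rep k) + 1) ≤ M * e (rep h) := Nat.mul_le_mul_left M hlt
    have h2 := hM k
    simp only [num₀] at hhk
    rw [mul_add] at h1
    omega
  let num : H → ℕ := fun h => if out h then num₀ h else num₀ (σ.turn h)
  have hnum : ∀ h, out h → num h = num₀ h := fun h hh => by simp [num, hh]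
  have num_turn : ∀ h, num (σ.turn h) = num h := by
    intro h
    by_cases hh : out h
    · have : ¬ out (σ.turn h) := fun h1 => (out_turn h).1 h1 hh
      simp [num, this, hh, σ.turn_turn]
    · simp [num, (out_turn h).2 hh, hh]
  have hexout : ∀ h, ∃ k, out k ∧ (h = k ∨ h = σ.turn k) := by
    intro h
    by_cases hh : out h
    · exact ⟨h, hh, Or.inl rfl⟩
    · exact ⟨σ.turn h, (out_turn h).2 hh, Or.inr (σ.turn_turn h).symm⟩
  have hinj : ∀ h k, out h → out k → num h = num k → h = k := by
    intro h k hh hk hhk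
    rw [hnum h hh, hnum k hk] at hhk
    have h1 : rep h = rep k := he (le_antisymm (hdiv h k hhk.le) (hdiv k h hhk.ge))
    have h2 : idx h = idx k := by
      simp only [num₀, h1] at hhk
      omega
    rw [← hidx h hh, ← hidx k hk, h1, h2]
  have hopp : ∀ h, out h → num (G.opp h) = num₀ (σ.next h) := by
    intro h hh
    rw [← num_turn, ← hnum _ ((out_next h).2 hh)]
    rfl
  -- a step that does not increase the index leads back to the start of the circuit
  have hclose : ∀ h, out h → idx (σ.next h) ≤ idx h → idx (σ.next h) = 0 ∧
      ∀ k, out k → rep k = rep h → idx k ≤ idx h := by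
    intro h hh hlt
    have hno : out (σ.next h) := (out_next h).2 hh
    have hpow : (σ.next ^ (idx h + 1)) (rep h) = σ.next h := by
      rw [pow_succ', Equiv.Perm.mul_apply, hidx h hh]
    -- the next passage has been met before, so that it is the first one
    have hzero : idx (σ.next h) = 0 := by
      by_contra hne
      have h1 := hidx _ hno
      rw [hrn, show idx (σ.next h) = (idx (σ.next h) - 1) + 1 by omega, pow_succ',
        Equiv.Perm.mul_apply] at h1
      have := hidx_le h hh _ (σ.next.injective h1)
      omega
    have hper : (σ.next ^ (idx h + 1)) (rep h) = rep h := by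
      have h1 := hidx _ hno
      rw [hzero, hrn] at h1
      rw [hpow, ← h1]
      rfl
    have hper' : ∀ q : ℕ, ((σ.next ^ (idx h + 1)) ^ q) (rep h) = rep h := by
      intro q
      induction q with
      | zero => rfl
      | succ q ih => rw [pow_succ, Equiv.Perm.mul_apply, hper, ih]
    have hall : ∀ k, out k → rep k = rep h → idx k ≤ idx h := by
      intro k hk hkh
      have h1 := hidx k hk
      rw [← Nat.mod_add_div (idx k) (idx h + 1), pow_add, Equiv.Perm.mul_apply, pow_mul, hkh,
        hper', ← hkh] at h1
      have h2 := hidx_le k hk _ h1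
      have h3 : idx k % (idx h + 1) < idx h + 1 := Nat.mod_lt _ (Nat.succ_pos _)
      omega
    exact ⟨hzero, hall⟩
  refine ⟨⟨σ, out, num, out_turn, out_opp, out_partner, num_turn, ?_, ?_, ?_⟩⟩
  · intro h k hhk
    obtain ⟨h', hh', h1⟩ := hexout h
    obtain ⟨k', hk', k1⟩ := hexout k
    have hnn : num h' = num k' := by
      rcases h1 with rfl | rfl <;> rcases k1 with rfl | rfl <;> simpa only [num_turn] using hhk
    obtain rfl := hinj h' k' hh' hk' hnn
    rcases h1 with rfl | rfl <;> rcases k1 with rfl | rfl <;> simp [σ.turn_turn]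
  · intro h hh
    have hno : out (σ.next h) := (out_next h).2 hh
    rw [hopp h hh, hnum h hh]
    have hpow : (σ.next ^ (idx h + 1)) (rep h) = σ.next h := by
      rw [pow_succ', Equiv.Perm.mul_apply, hidx h hh]
    have hle : idx (σ.next h) ≤ idx h + 1 := hidx_le _ hno _ (by rw [hrn, hpow])
    rcases hle.eq_or_lt with heq | hlt
    · left
      simp only [num₀, hrn, heq]
      ring
    right
    obtain ⟨hzero, hall⟩ := hclose h hh (by omega)
    have hlo : num₀ (σ.next h) = M * e (rep h) := by simp only [num₀, hrn, hzero, add_zero]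
    refine ⟨by rw [hlo]; exact Nat.le_add_right _ _, fun k hk1 hk2 => ?_⟩
    obtain ⟨k', hk', hkk⟩ := hexout k
    have hnk : num k = num₀ k' := by
      rw [← hnum k' hk']
      rcases hkk with rfl | rfl
      · rfl
      · exact num_turn _
    have hpk' : out (G.partner k') := (out_partner k').2 hk'
    have hnpk : num (G.partner k) = num₀ (G.partner k') := by
      rw [← hnum _ hpk']
      rcases hkk with rfl | rfl
      · rfl
      · rw [← σ.turn_partner, num_turn]
    rw [hnk] at hk1 hk2
    have hr : rep k' = rep h := he (le_antisymm (hdiv _ _ hk2) (by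
      have := hdiv _ _ hk1
      rwa [hrn] at this))
    have hr' : rep (G.partner k') = rep h := (hrp k').trans hr
    rw [hnpk, hlo]
    have := hall _ hpk' hr'
    simp only [num₀, hr']
    omega
  · intro h k hh hk h1 h2 h3 h4
    rw [hopp h hh] at h1 h3
    rw [hopp k hk] at h2
    rw [hnum h hh] at h1 h4 ⊢
    rw [hnum k hk] at h2 h3 h4 ⊢
    have hr : rep k = rep h := he (le_antisymm (hdiv _ _ h4) (by
      have := hdiv _ _ h3
      rwa [hrn] at this))
    have := (hclose k hk (by simp only [num₀, hrn] at h2; omega)).2 h hh hr.symm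
    simp only [num₀, hr] at h4 ⊢
    omega

end XGraph

/-! ### Chord diagrams whose interlacement graph is not bipartite -/

/-- Indicator modulo two of `a ≤ x`. -/
def stepFun (a x : ℤ) : ZMod 2 := if a ≤ x then 1 else 0

theorem stepFun_of_le {a x : ℤ} (h : a ≤ x) : stepFun a x = 1 := if_pos h

theorem stepFun_of_lt {a x : ℤ} (h : x < a) : stepFun a x = 0 := if_neg (not_le.2 h)

/-- Two intervals on a line overlap, without one of them containing the other. -/
def Interlaced (l₁ r₁ l₂ r₂ : ℤ) : Prop :=
  (l₁ < l₂ ∧ l₂ < r₁ ∧ r₁ < r₂) ∨ (l₂ < l₁ ∧ l₁ < r₂ ∧ r₂ < r₁)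

/-- The order of the ends of intervals that form an induced cycle of the overlap graph, if the
interval `0` starts first, the intervals not overlapping it lie to its right, and the last interval
starts before the interval `1`. -/
theorem order_of_interlaced_cycle {m : ℕ} (hm : 3 ≤ m) (hm4 : m ≠ 4) (l r : ℕ → ℤ)
    (hne : ∀ i < m, ∀ j < m, i ≠ j → l i ≠ l j ∧ r i ≠ r j ∧ l i ≠ r j)
    (hint : ∀ i j, i < j → j < m →
      (Interlaced (l i) (r i) (l j) (r j) ↔ j = i + 1 ∨ (i = 0 ∧ j = m - 1)))
    (h0 : ∀ i, 0 < i → i < m → l 0 < l i) (hright : ∀ i, 2 ≤ i → i ≤ m - 2 → r 0 < l i)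
    (hlast : l (m - 1) < l 1) :
    l 1 < r 0 ∧ (∀ i, i + 2 ≤ m - 2 → r i < l (i + 2) ∧ l (i + 2) < r (i + 1)) ∧
      (∀ i, i + 1 ≤ m - 2 → r i < r (i + 1)) ∧ r (m - 3) < r (m - 1) ∧
      r (m - 1) < r (m - 2) := by
  have h01 := (hint 0 1 (by omega) (by omega)).2 (Or.inl rfl)
  have h0z := (hint 0 (m - 1) (by omega) (by omega)).2 (Or.inr ⟨rfl, rfl⟩)
  have h1 := h0 1 (by omega) (by omega)
  have hz := h0 (m - 1) (by omega) (by omega)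
  unfold Interlaced at hint h01 h0z
  have e1 : l 1 < r 0 ∧ r 0 < r 1 := by omega
  have e2 : l (m - 1) < r 0 ∧ r 0 < r (m - 1) := by omega
  by_cases hm3 : m = 3
  · subst hm3
    have h12 := (hint 1 2 (by omega) (by omega)).2 (Or.inl rfl)
    simp only [show 3 - 1 = 2 by rfl, show 3 - 2 = 1 by rfl, show 3 - 3 = 0 by rfl] at *
    refine ⟨e1.1, fun i hi => by omega, fun i hi => ?_, by omega, by omega⟩
    obtain rfl : i = 0 := by omega
    exact e1.2
  have key : ∀ i, i + 1 ≤ m - 3 → (∀ k, i + 2 ≤ k → k ≤ m - 2 → r i < l k) ∧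
      l (i + 1) < r i ∧ r i < r (i + 1) ∧ l (m - 1) < l (i + 1) ∧ r (i + 1) < r (m - 1) := by
    intro i
    induction i with
    | zero =>
      intro _
      have h1z := hint 1 (m - 1) (by omega) (by omega)
      have hn := hne 1 (by omega) (m - 1) (by omega) (by omega)
      refine ⟨hright, e1.1, e1.2, hlast, ?_⟩
      rw [zero_add]
      by_contra hcon
      have := h1z.1 (Or.inr ⟨hlast, by omega, by omega⟩)
      omega
    | succ i ih =>
      intro hi
      obtain ⟨ha, hb, hb', hc, hc'⟩ := ih (by omega)
      have hstep := (hint (i + 1) (i + 2) (by omega) (by omega)).2 (Or.inl rfl)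
      have ha2 := ha (i + 2) le_rfl (by omega)
      have hb2 : l (i + 2) < r (i + 1) ∧ r (i + 1) < r (i + 2) := by omega
      change (∀ k, i + 3 ≤ k → k ≤ m - 2 → r (i + 1) < l k) ∧ l (i + 2) < r (i + 1) ∧
        r (i + 1) < r (i + 2) ∧ l (m - 1) < l (i + 2) ∧ r (i + 2) < r (m - 1)
      refine ⟨?_, hb2.1, hb2.2, by omega, ?_⟩
      · intro k hk hk'
        by_contra hcon
        have inside : ∀ d, k + d ≤ m - 2 → l (k + d) < r (i + 1) ∧ r (k + d) < r (i + 1) := by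
          intro d
          have hout : ∀ d, k + d ≤ m - 2 → l (k + d) < r (i + 1) → r (k + d) < r (i + 1) := by
            intro d hd hl
            have hn := hne (i + 1) (by omega) (k + d) (by omega) (by omega)
            have hi' := hint (i + 1) (k + d) (by omega) (by omega)
            have ha' := ha (k + d) (by omega) hd
            by_contra hcon'
            have := hi'.1 (Or.inl ⟨by omega, hl, by omega⟩)
            omega
          induction d with
          | zero =>
            intro hd
            have hn := hne (k + 0) (by omega) (i + 1) (by omega) (by omega)
            have : l (k + 0) < r (i + 1) := by
              rw [add_zero] at hn ⊢
              omega
            exact ⟨this, hout 0 hd this⟩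
          | succ d ihd =>
            intro hd
            have h3 := ihd (by omega)
            have h4 := (hint (k + d) (k + (d + 1)) (by omega) (by omega)).2 (Or.inl rfl)
            have : l (k + (d + 1)) < r (i + 1) := by omega
            exact ⟨this, hout _ hd this⟩
        have h5 := inside (m - 2 - k) (by omega)
        rw [show k + (m - 2 - k) = m - 2 by omega] at h5
        have h6 := (hint (m - 2) (m - 1) (by omega) (by omega)).2 (Or.inl (by omega))
        have h7 := ha (m - 2) (by omega) le_rfl
        omega
      · have hn := hne (i + 2) (by omega) (m - 1) (by omega) (by omega)
        have h3 := hint (i + 2) (m - 1) (by omega) (by omega)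
        by_contra hcon
        have := h3.1 (Or.inr ⟨by omega, by omega, by omega⟩)
        omega
  have hlast2 := (hint (m - 2) (m - 1) (by omega) (by omega)).2 (Or.inl (by omega))
  have hr2 := hright (m - 2) (by omega) le_rfl
  have hz2 : r (m - 1) < r (m - 2) := by omega
  have hk := (key (m - 4) (by omega)).2.2.2.2
  rw [show m - 4 + 1 = m - 3 by omega] at hk
  refine ⟨e1.1, fun i hi => ?_, fun i hi => ?_, hk, hz2⟩
  · obtain ⟨ha, hb, hb', hc, hc'⟩ := key i (by omega)
    have ha2 := ha (i + 2) le_rfl hi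
    have hstep := (hint (i + 1) (i + 2) (by omega) (by omega)).2 (Or.inl rfl)
    exact ⟨ha2, by omega⟩
  · rcases Nat.lt_or_ge (i + 1) (m - 2) with h | h
    · exact (key i (by omega)).2.2.1
    · obtain rfl : i = m - 3 := by omega
      rw [show m - 3 + 1 = m - 2 by omega]
      omega

/-- Disjoint intervals contain `x` altogether at most once. -/
theorem sum_stepFun_intervals_eq_one {M : ℕ} {s e : ℕ → ℤ} (hse : ∀ i < M, s i < e i)
    (hes : ∀ i j, i < j → j < M → e i < s j) {x : ℤ} {i : ℕ} (hi : i < M) (h1 : s i ≤ x)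
    (h2 : x < e i) : ∑ j ∈ Finset.range M, (stepFun (s j) x + stepFun (e j) x) = 1 := by
  rw [Finset.sum_eq_single_of_mem i (Finset.mem_range.2 hi)]
  · rw [stepFun_of_le h1, stepFun_of_lt h2, add_zero]
  · intro j hj hji
    have hj := Finset.mem_range.1 hj
    rcases lt_or_gt_of_ne hji with h | h
    · have := hes j i h hi
      have := hse j hj
      rw [stepFun_of_le (by omega), stepFun_of_le (by omega), CharTwo.add_self_eq_zero]
    · have := hes i j h hj
      have := hse j hj
      rw [stepFun_of_lt (by omega), stepFun_of_lt (by omega), add_zero]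

/-- The two functions attached to an induced odd cycle of chords with ends `a i`, `b i`
(`i ≤ 2 * n + 1`) and a last chord with ends `u`, `v` have disjoint supports. The ends are paired so
that the first function vanishes exactly on the intervals `[a 0, a 1)`, `[b i, a (i + 2))` and
`[b (2 * n), b (2 * n + 1))`, and the second one is supported in these intervals. -/
theorem one_add_sum_mul_sum_eq_zero (n : ℕ) (a b : ℕ → ℤ) (u v : ℤ) (h0u : a 0 < u)
    (hu1 : u < a 1) (hba : ∀ i, i + 2 ≤ 2 * n + 1 → b i < a (i + 2) ∧ a (i + 2) < b (i + 1))
    (hbb : ∀ i, i + 1 ≤ 2 * n + 1 → b i < b (i + 1)) (hbv : b (2 * n) < v)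
    (hvb : v < b (2 * n + 1)) (hends : a 1 < b 0 ∨ b (2 * n + 1) < a 0) (x : ℤ) :
    (1 + ∑ i ∈ Finset.range (2 * n + 2), (stepFun (a i) x + stepFun (b i) x)) *
      (∑ k ∈ Finset.range (n + 1), (stepFun (a (2 * k)) x + stepFun (b (2 * k)) x) +
        (stepFun u x + stepFun v x)) = 0 := by
  have hmono : ∀ j, j ≤ 2 * n + 1 → ∀ i ≤ j, b i ≤ b j := by
    intro j
    induction j with
    | zero => intro _ i hi; obtain rfl : i = 0 := by omega
              exact le_rfl
    | succ j ih =>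
      intro hj i hi
      rcases hi.eq_or_lt with rfl | h
      · exact le_rfl
      · exact (ih (by omega) i (by omega)).trans (hbb j hj).le
  let e : ℕ → ℤ := fun i => if i < 2 * n then a (i + 2) else b (2 * n + 1)
  let e' : ℕ → ℤ := fun k => if k < n then a (2 * k + 2) else v
  have hsum1 : ∑ i ∈ Finset.range (2 * n + 2), (stepFun (a i) x + stepFun (b i) x) =
      (stepFun (a 0) x + stepFun (a 1) x) +
        ∑ i ∈ Finset.range (2 * n + 1), (stepFun (b i) x + stepFun (e i) x) := by
    have he : ∑ i ∈ Finset.range (2 * n + 1), stepFun (e i) x =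
        ∑ i ∈ Finset.range (2 * n), stepFun (a (i + 2)) x + stepFun (b (2 * n + 1)) x := by
      rw [Finset.sum_range_succ]
      congr 1
      · refine Finset.sum_congr rfl fun i hi => ?_
        simp only [e, Finset.mem_range.1 hi, if_true]
      · simp [e]
    rw [Finset.sum_add_distrib, Finset.sum_add_distrib, he,
      Finset.sum_range_succ (fun i => stepFun (b i) x) (2 * n + 1),
      Finset.sum_range_succ' (fun i => stepFun (a i) x) (2 * n + 1),
      Finset.sum_range_succ' (fun i => stepFun (a (i + 1)) x) (2 * n)]
    ring
  have hsum2 : ∑ k ∈ Finset.range (n + 1), (stepFun (a (2 * k)) x + stepFun (b (2 * k)) x) +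
      (stepFun u x + stepFun v x) = (stepFun (a 0) x + stepFun u x) +
        ∑ k ∈ Finset.range (n + 1), (stepFun (b (2 * k)) x + stepFun (e' k) x) := by
    have he : ∑ k ∈ Finset.range (n + 1), stepFun (e' k) x =
        ∑ k ∈ Finset.range n, stepFun (a (2 * k + 2)) x + stepFun v x := by
      rw [Finset.sum_range_succ]
      congr 1
      · refine Finset.sum_congr rfl fun i hi => ?_
        simp only [e', Finset.mem_range.1 hi, if_true]
      · simp [e']
    rw [Finset.sum_add_distrib, Finset.sum_add_distrib, he,
      Finset.sum_range_succ' (fun i => stepFun (a (2 * i)) x) n]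
    simp only [mul_add, mul_one, mul_zero]
    ring
  have hbe : ∀ i < 2 * n + 1, b i < e i := by
    intro i hi
    simp only [e]
    split_ifs with h
    · exact (hba i (by omega)).1
    · obtain rfl : i = 2 * n := by omega
      exact hbb _ le_rfl
  have heb : ∀ i j, i < j → j < 2 * n + 1 → e i < b j := by
    intro i j hij hj
    have : i < 2 * n := by omega
    simp only [e, this, if_true]
    exact (hba i (by omega)).2.trans_le (hmono j (by omega) (i + 1) (by omega))
  have helast : ∀ i < 2 * n + 1, e i ≤ b (2 * n + 1) := by
    intro i hi
    simp only [e]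
    split_ifs with h
    · exact (hba i (by omega)).2.le.trans (hmono _ le_rfl _ (by omega))
    · exact le_rfl
  rw [hsum1, hsum2]
  by_cases hJ : a 0 ≤ x ∧ x < a 1
  · have hzero : ∑ i ∈ Finset.range (2 * n + 1), (stepFun (b i) x + stepFun (e i) x) = 0 := by
      refine Finset.sum_eq_zero fun i hi => ?_
      have hi := Finset.mem_range.1 hi
      have h1 := hbe i hi
      rcases hends with h | h
      · have h2 := hmono i (by omega) 0 (Nat.zero_le _)
        rw [stepFun_of_lt (by omega), stepFun_of_lt (by omega), add_zero]
      · have h2 := helast i hi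
        rw [stepFun_of_le (by omega), stepFun_of_le (by omega), CharTwo.add_self_eq_zero]
    rw [hzero, stepFun_of_le hJ.1, stepFun_of_lt hJ.2, add_zero, add_zero,
      CharTwo.add_self_eq_zero, zero_mul]
  · have h01 : stepFun (a 0) x + stepFun (a 1) x = 0 ∧ stepFun (a 0) x + stepFun u x = 0 := by
      by_cases h : a 0 ≤ x
      · rw [stepFun_of_le h, stepFun_of_le (by omega), stepFun_of_le (by omega)]
        exact ⟨CharTwo.add_self_eq_zero _, CharTwo.add_self_eq_zero _⟩
      · rw [stepFun_of_lt (by omega), stepFun_of_lt (by omega), stepFun_of_lt (by omega)]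
        exact ⟨add_zero _, add_zero _⟩
    rw [h01.1, h01.2, zero_add, zero_add]
    by_cases hex : ∃ k < n + 1, b (2 * k) ≤ x ∧ x < e' k
    · obtain ⟨k, hk, h1, h2⟩ := hex
      have h3 : e' k ≤ e (2 * k) := by
        simp only [e, e']
        by_cases h : k < n
        · simp [h]
        · have : ¬ 2 * k < 2 * n := by omega
          simp only [h, this, if_false]
          exact hvb.le
      rw [sum_stepFun_intervals_eq_one hbe heb (i := 2 * k) (by omega) h1 (by omega),
        CharTwo.add_self_eq_zero, zero_mul]
    · rw [Finset.sum_eq_zero (s := Finset.range (n + 1)), mul_zero]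
      intro k hk
      have hk := Finset.mem_range.1 hk
      have h1 : b (2 * k) < e' k := by
        simp only [e']
        split_ifs with h
        · exact (hba (2 * k) (by omega)).1
        · obtain rfl : k = n := by omega
          exact hbv
      by_cases h : b (2 * k) ≤ x
      · have : e' k ≤ x := by
          by_contra hcon
          exact hex ⟨k, hk, h, by omega⟩
        rw [stepFun_of_le h, stepFun_of_le this, CharTwo.add_self_eq_zero]
      · rw [stepFun_of_lt (by omega), stepFun_of_lt (by omega), add_zero]

/-- A graph that is not bipartite has an induced cycle of odd length, here in the form of a periodic
sequence of vertices: a shortest closed walk of odd length. -/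
theorem SimpleGraph.exists_induced_odd_cycle {V : Type*} (Γ : SimpleGraph V)
    (hΓ : ¬ Γ.Colorable 2) : ∃ (m : ℕ) (c : ℤ → V), Odd m ∧ 3 ≤ m ∧ (∀ i, c (i + m) = c i) ∧
      ∀ (i : ℤ) (d : ℕ), 0 < d → d < m →
        c i ≠ c (i + d) ∧ (Γ.Adj (c i) (c (i + d)) ↔ d = 1 ∨ d = m - 1) := by
  classical
  let IsOdd : ℕ → Prop := fun m => Odd m ∧ ∃ c : ℤ → V, (∀ i, c (i + m) = c i) ∧
    ∀ i, Γ.Adj (c i) (c (i + 1))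
  have hmk : ∀ (n : ℕ) (f : ℕ → V), Odd n → (∀ j, j + 1 < n → Γ.Adj (f j) (f (j + 1))) →
      Γ.Adj (f (n - 1)) (f 0) → IsOdd n := by
    intro n f hn hf hlast
    have hn0 : 0 < n := hn.pos
    refine ⟨hn, fun i => f (i % n).toNat, fun i => by simp, fun i => ?_⟩
    have h1 := Int.emod_nonneg i (b := (n : ℤ)) (by omega)
    have h2 := Int.emod_lt_of_pos i (b := (n : ℤ)) (by omega)
    have h3 : (i + 1) % n = if i % n + 1 = n then 0 else i % n + 1 := by
      rw [Int.add_emod]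
      split_ifs with h
      · by_cases hn1 : n = 1
        · subst hn1; simp
        · rw [Int.emod_eq_of_lt (a := 1) (by omega) (by omega), h, Int.emod_self]
      · have : (1 : ℤ) % n = 1 := by
          apply Int.emod_eq_of_lt <;> omega
        rw [this]
        apply Int.emod_eq_of_lt <;> omega
    beta_reduce
    rw [h3]
    split_ifs with h
    · rw [show (i % n).toNat = n - 1 by omega]
      exact hlast
    · rw [show (i % n + 1).toNat = (i % n).toNat + 1 by omega]
      exact hf _ (by omega)
  have hex : ∃ m, IsOdd m := by
    rw [SimpleGraph.two_colorable_iff_forall_loop_even] at hΓ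
    push Not at hΓ
    obtain ⟨u, w, hw⟩ := hΓ
    rw [Nat.not_even_iff_odd] at hw
    refine ⟨w.length, hmk w.length w.getVert hw (fun j hj => w.adj_getVert_succ (by omega)) ?_⟩
    have hpos := hw.pos
    have := w.adj_getVert_succ (i := w.length - 1) (by omega)
    rw [show w.length - 1 + 1 = w.length by omega, w.getVert_length] at this
    rwa [w.getVert_zero]
  obtain ⟨hm, c, hper, hadj⟩ := Nat.find_spec hex
  have hmin := fun k hk => Nat.find_min hex (m := k) hk
  generalize Nat.find hex = m at hm hper hmin
  have hm3 : 3 ≤ m := by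
    by_contra hlt
    obtain rfl : m = 1 := by
      obtain ⟨k, rfl⟩ := hm
      omega
    have := hadj 0
    rw [show (0 : ℤ) + 1 = 0 + ((1 : ℕ) : ℤ) by norm_num, hper] at this
    exact Γ.loopless.irrefl _ this
  -- a repeated vertex or a chord cuts the closed walk into two, one of which is odd
  have hne : ∀ (i : ℤ) (d : ℕ), 0 < d → d < m → c i ≠ c (i + d) := by
    intro i d hd hdm heq
    rcases Nat.even_or_odd d with he | ho
    · refine hmin (m - d) (by omega) (hmk (m - d) (fun j => c (i + d + j))
        (Nat.Odd.sub_even hdm.le hm he) (fun j _ => ?_) ?_)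
      · push_cast; rw [← add_assoc]; exact hadj _
      · have := hadj (i + d + ((m - d - 1 : ℕ) : ℤ))
        rw [show i + d + ((m - d - 1 : ℕ) : ℤ) + 1 = i + m by omega, hper, heq] at this
        simpa using this
    · refine hmin d hdm (hmk d (fun j => c (i + j)) ho (fun j _ => ?_) ?_)
      · push_cast; rw [← add_assoc]; exact hadj _
      · have := hadj (i + ((d - 1 : ℕ) : ℤ))
        rw [show i + ((d - 1 : ℕ) : ℤ) + 1 = i + d by omega, ← heq] at this
        simpa using this
  refine ⟨m, c, hm, hm3, hper, fun i d hd hdm => ⟨hne i d hd hdm, ?_, ?_⟩⟩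
  · intro h
    by_contra! hcon
    rcases Nat.even_or_odd d with he | ho
    · refine hmin (d + 1) (by omega)
        (hmk (d + 1) (fun j => c (i + j)) he.add_one (fun j _ => ?_) ?_)
      · push_cast; rw [← add_assoc]; exact hadj _
      · simpa using h.symm
    · refine hmin (m - d + 1) (by omega) (hmk (m - d + 1) (fun j => c (i + d + j))
        (Nat.Odd.sub_odd hm ho).add_one (fun j _ => ?_) ?_)
      · push_cast; rw [← add_assoc]; exact hadj _
      · simp only [Nat.add_sub_cancel, Nat.cast_zero, add_zero]
        rw [show i + (d : ℤ) + ((m - d : ℕ) : ℤ) = i + m by omega, hper]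
        exact h
  · rintro (rfl | rfl)
    · exact_mod_cast hadj i
    · have := hadj (i + ((m - 1 : ℕ) : ℤ))
      rw [show i + ((m - 1 : ℕ) : ℤ) + 1 = i + m by omega, hper] at this
      exact this.symm

/-- The interlacement graph of chords with the ends `l v < r v`. -/
def interlaceGraph {V : Type*} (l r : V → ℤ) (hlr : ∀ v, l v < r v) : SimpleGraph V where
  Adj v w := Interlaced (l v) (r v) (l w) (r w)
  symm := ⟨fun _ _ h => Or.symm h⟩
  loopless := ⟨fun v h => by
    have := hlr v
    unfold Interlaced at h
    omega⟩

/-- The ends of the chords of an induced odd cycle of the interlacement graph, brought into a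
standard order. Here `u` and `v` are the ends of the last chord. If the chords not interlaced with
the chord `0` lie under it, then cutting the circle that carries the chords at another point reduces
this to the case in which they lie to the right of it. -/
theorem exists_order_of_induced_odd_cycle {n : ℕ} (l r : ℕ → ℤ)
    (hlr : ∀ i < 2 * n + 3, l i < r i)
    (hne : ∀ i < 2 * n + 3, ∀ j < 2 * n + 3, i ≠ j → l i ≠ l j ∧ r i ≠ r j ∧ l i ≠ r j)
    (hint : ∀ i j, i < j → j < 2 * n + 3 →
      (Interlaced (l i) (r i) (l j) (r j) ↔ j = i + 1 ∨ (i = 0 ∧ j = 2 * n + 2)))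
    (h0 : ∀ i, 0 < i → i < 2 * n + 3 → l 0 < l i)
    (hcase : (l (2 * n + 2) < l 1 ∧ ∀ i, 2 ≤ i → i ≤ 2 * n + 1 → r 0 < l i) ∨
      (r (2 * n + 2) < r 1 ∧ 1 ≤ n ∧ ∀ i, 2 ≤ i → i ≤ 2 * n + 1 → r i < r 0)) :
    ∃ (a b : ℕ → ℤ) (u v : ℤ),
      (∀ i < 2 * n + 2, (a i = l i ∧ b i = r i) ∨ (a i = r i ∧ b i = l i)) ∧
      ((u = l (2 * n + 2) ∧ v = r (2 * n + 2)) ∨ (u = r (2 * n + 2) ∧ v = l (2 * n + 2))) ∧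
      a 0 < u ∧ u < a 1 ∧ (∀ i, i + 2 ≤ 2 * n + 1 → b i < a (i + 2) ∧ a (i + 2) < b (i + 1)) ∧
      (∀ i, i + 1 ≤ 2 * n + 1 → b i < b (i + 1)) ∧ b (2 * n) < v ∧ v < b (2 * n + 1) ∧
      (a 1 < b 0 ∨ b (2 * n + 1) < a 0) := by
  rcases hcase with ⟨hlast, hout⟩ | ⟨hlast, hn, hin⟩
  · obtain ⟨e1, e2, e3, e4, e5⟩ := order_of_interlaced_cycle (m := 2 * n + 3) (by omega) (by omega)
      l r hne hint h0 hout hlast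
    exact ⟨l, r, l (2 * n + 2), r (2 * n + 2), fun _ _ => Or.inl ⟨rfl, rfl⟩, Or.inl ⟨rfl, rfl⟩,
      h0 _ (by omega) (by omega), hlast, e2, e3, e4, e5, Or.inl e1⟩
  · obtain ⟨R, hR⟩ : ∃ R, ∀ i < 2 * n + 3, r i ≤ R := by
      obtain ⟨R, hR⟩ := ((Set.finite_Iio (2 * n + 3)).image r).bddAbove
      exact ⟨R, fun i hi => hR ⟨i, hi, rfl⟩⟩
    have h01 := (hint 0 1 (by omega) (by omega)).2 (Or.inl rfl)
    have h0z := (hint 0 (2 * n + 2) (by omega) (by omega)).2 (Or.inr ⟨rfl, rfl⟩)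
    have g1 := h0 1 (by omega) (by omega)
    have gz := h0 (2 * n + 2) (by omega) (by omega)
    unfold Interlaced at hint h01 h0z
    have k1 : l 1 < r 0 ∧ r 0 < r 1 := by omega
    have kz : l (2 * n + 2) < r 0 ∧ r 0 < r (2 * n + 2) := by omega
    have hR0 := hR 0 (by omega)
    have hR1 := hR 1 (by omega)
    have hRz := hR (2 * n + 2) (by omega)
    have cases3 : ∀ i < 2 * n + 3, i = 0 ∨ i = 1 ∨ i = 2 * n + 2 ∨ (2 ≤ i ∧ i ≤ 2 * n + 1) := by
      omega
    -- the right ends of the three chords are moved in front of all other ends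
    obtain ⟨L, hL1, hL2⟩ : ∃ L : ℕ → ℤ, (∀ i, i = 0 ∨ i = 1 ∨ i = 2 * n + 2 →
        L i = r i - (R - l 0 + 1)) ∧ ∀ i, 2 ≤ i → i ≤ 2 * n + 1 → L i = l i :=
      ⟨fun i => if i = 0 ∨ i = 1 ∨ i = 2 * n + 2 then r i - (R - l 0 + 1) else l i,
        fun i hi => if_pos hi, fun i h1 h2 => if_neg (by omega)⟩
    obtain ⟨K, hK1, hK2⟩ : ∃ K : ℕ → ℤ, (∀ i, i = 0 ∨ i = 1 ∨ i = 2 * n + 2 →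
        K i = l i) ∧ ∀ i, 2 ≤ i → i ≤ 2 * n + 1 → K i = r i :=
      ⟨fun i => if i = 0 ∨ i = 1 ∨ i = 2 * n + 2 then l i else r i,
        fun i hi => if_pos hi, fun i h1 h2 => if_neg (by omega)⟩
    have L0 := hL1 0 (by omega)
    have L1 := hL1 1 (by omega)
    have Lz := hL1 (2 * n + 2) (by omega)
    have K0 := hK1 0 (by omega)
    have K1 := hK1 1 (by omega)
    have Kz := hK1 (2 * n + 2) (by omega)
    have hinside : ∀ i, 2 ≤ i → i ≤ 2 * n + 1 → L i = l i ∧ K i = r i ∧ r i < r 0 ∧ l 0 < l i ∧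
        l i < r i := fun i h1 h2 =>
      ⟨hL2 i h1 h2, hK2 i h1 h2, hin i h1 h2, h0 i (by omega) (by omega), hlr i (by omega)⟩
    have hord := order_of_interlaced_cycle (m := 2 * n + 3) (by omega) (by omega) L K
    refine (fun H => ?_) (hord ?_ ?_ ?_ ?_ ?_)
    · obtain ⟨e1, e2, e3, e4, e5⟩ := H
      refine ⟨fun i => if i = 0 ∨ i = 1 then r i else l i, K, r (2 * n + 2), l (2 * n + 2), ?_,
        Or.inr ⟨rfl, rfl⟩, by simpa using kz.2, by simpa using hlast, ?_, e3, ?_, ?_, Or.inr ?_⟩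
      · intro i hi
        beta_reduce
        by_cases h : i = 0 ∨ i = 1
        · rw [if_pos h]; exact Or.inr ⟨rfl, hK1 i (by omega)⟩
        · rw [if_neg h]; exact Or.inl ⟨rfl, hK2 i (by omega) (by omega)⟩
      · intro i hi
        have := e2 i hi
        rw [hL2 (i + 2) (by omega) hi] at this
        simpa using this
      · rw [← Kz]; exact e4
      · rw [← Kz]; exact e5
      · rw [hK2 _ (by omega) le_rfl]
        simpa using hin (2 * n + 1) (by omega) le_rfl
    · intro i hi j hj hij
      have := hne i hi j hj hij
      have := hne j hj i hi hij.symm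
      have := hR i hi
      have := hR j hj
      have := hlr i hi
      have := hlr j hj
      rcases cases3 i hi with rfl | rfl | rfl | hi' <;>
        rcases cases3 j hj with rfl | rfl | rfl | hj' <;>
        first
        | omega
        | (have := hinside _ hj'.1 hj'.2; omega)
        | (have := hinside _ hi'.1 hi'.2; omega)
        | (have := hinside _ hi'.1 hi'.2; have := hinside _ hj'.1 hj'.2; omega)
    · intro i j hij hj
      rw [show 2 * n + 3 - 1 = 2 * n + 2 by omega, ← hint i j hij hj]
      unfold Interlaced
      have := hR i (hij.trans hj)
      have := hR j hj
      have := hlr i (hij.trans hj)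
      have := hlr j hj
      rcases cases3 i (hij.trans hj) with rfl | rfl | rfl | hi' <;>
        rcases cases3 j hj with rfl | rfl | rfl | hj' <;>
        first
        | omega
        | (have := hinside _ hj'.1 hj'.2; omega)
        | (have := hinside _ hi'.1 hi'.2; omega)
        | (have := hinside _ hi'.1 hi'.2; have := hinside _ hj'.1 hj'.2; omega)
    · intro i hi hi2
      rcases cases3 i hi2 with rfl | rfl | rfl | hi' <;>
        first
        | omega
        | (have := hinside _ hi'.1 hi'.2; omega)
    · intro i hi hi2
      have := hinside _ hi hi2
      omega
    · rw [show 2 * n + 3 - 1 = 2 * n + 2 by omega]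
      omega

/-- An induced odd cycle of the interlacement graph can be traversed so that its chords satisfy the
hypotheses of `exists_order_of_induced_odd_cycle`. -/
theorem exists_traversal_of_not_colorable {V : Type*} (l r : V → ℤ) (hlr : ∀ v, l v < r v)
    (hne : ∀ v w, v ≠ w → l v ≠ l w ∧ r v ≠ r w ∧ l v ≠ r w)
    (h : ¬ (interlaceGraph l r hlr).Colorable 2) :
    ∃ (n : ℕ) (q : ℕ → V), Set.InjOn q (Set.Iio (2 * n + 3)) ∧
      (∀ i j, i < j → j < 2 * n + 3 → (Interlaced (l (q i)) (r (q i)) (l (q j)) (r (q j)) ↔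
        j = i + 1 ∨ (i = 0 ∧ j = 2 * n + 2))) ∧
      (∀ i, 0 < i → i < 2 * n + 3 → l (q 0) < l (q i)) ∧
      ((l (q (2 * n + 2)) < l (q 1) ∧ ∀ i, 2 ≤ i → i ≤ 2 * n + 1 → r (q 0) < l (q i)) ∨
      (r (q (2 * n + 2)) < r (q 1) ∧ 1 ≤ n ∧
        ∀ i, 2 ≤ i → i ≤ 2 * n + 1 → r (q i) < r (q 0))) := by
  obtain ⟨m, c, hm, hm3, hper, hc⟩ := SimpleGraph.exists_induced_odd_cycle _ h
  obtain ⟨n, rfl⟩ : ∃ n, m = 2 * n + 3 := by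
    obtain ⟨k, rfl⟩ := hm
    exact ⟨k - 1, by omega⟩
  obtain ⟨i₀, -, hi₀⟩ := (Finset.range (2 * n + 3)).exists_min_image (fun k : ℕ => l (c k))
    ⟨0, by simp⟩
  -- both directions of traversal from the chord that starts first
  have key : ∀ q : ℕ → V, q 0 = c i₀ → (∀ i j, i < j → j < 2 * n + 3 → q i ≠ q j ∧
      ((interlaceGraph l r hlr).Adj (q i) (q j) ↔ j - i = 1 ∨ j - i = 2 * n + 2)) →
      (∀ i, ∃ j : ℕ, j < 2 * n + 3 ∧ q i = c j) → Set.InjOn q (Set.Iio (2 * n + 3)) ∧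
      (∀ i j, i < j → j < 2 * n + 3 → (Interlaced (l (q i)) (r (q i)) (l (q j)) (r (q j)) ↔
        j = i + 1 ∨ (i = 0 ∧ j = 2 * n + 2))) ∧
      (∀ i, 0 < i → i < 2 * n + 3 → l (q 0) < l (q i)) := by
    intro q hq0 hq hqc
    refine ⟨?_, fun i j hij hj => ?_, fun i hi hi2 => ?_⟩
    · intro i hi j hj hij
      rcases lt_trichotomy i j with h | h | h
      · exact absurd hij (hq i j h hj).1
      · exact h
      · exact absurd hij.symm (hq j i h hi).1
    · refine (hq i j hij hj).2.trans ?_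
      omega
    · obtain ⟨j, hj, hj'⟩ := hqc i
      have h1 := hi₀ j (Finset.mem_range.2 hj)
      have h2 := (hne _ _ (hq 0 i hi hi2).1).1
      rw [← hq0, ← hj'] at h1
      exact lt_of_le_of_ne h1 h2
  have hmod : ∀ i : ℤ, ∃ j : ℕ, j < 2 * n + 3 ∧ c i = c j := by
    intro i
    have h1 := Int.emod_nonneg i (b := ((2 * n + 3 : ℕ) : ℤ)) (by omega)
    have h2 := Int.emod_lt_of_pos i (b := ((2 * n + 3 : ℕ) : ℤ)) (by omega)
    refine ⟨(i % (2 * n + 3 : ℕ)).toNat, by omega, ?_⟩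
    rw [Int.toNat_of_nonneg h1, Int.emod_def, mul_comm]
    exact ((Function.Periodic.int_mul hper (i / (2 * n + 3 : ℕ))).sub_eq i).symm
  have hq := key (fun k => c (i₀ + k)) (by simp) (fun i j hij hj => by
    have := hc (i₀ + i) (j - i) (by omega) (by omega)
    rw [show (i₀ + i + (j - i : ℕ) : ℤ) = i₀ + j by omega] at this
    exact this) (fun i => hmod _)
  have hq' := key (fun k => c (i₀ - k)) (by simp) (fun i j hij hj => by
    have := hc (i₀ - j) (j - i) (by omega) (by omega)
    rw [show (i₀ - j + (j - i : ℕ) : ℤ) = i₀ - i by omega] at this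
    exact ⟨this.1.symm, by rw [SimpleGraph.adj_comm]; exact this.2⟩) (fun i => hmod _)
  have hrev : ∀ i ≤ 2 * n + 3, c (i₀ - i) = c (i₀ + (2 * n + 3 - i : ℕ)) := by
    intro i hi
    rw [← hper (i₀ - i)]
    congr 1
    omega
  -- the chords that are not interlaced with the first one lie on one side of it
  have hside : (∀ i : ℕ, 2 ≤ i → i ≤ 2 * n + 1 → r (c i₀) < l (c (i₀ + i))) ∨
      (1 ≤ n ∧ ∀ i : ℕ, 2 ≤ i → i ≤ 2 * n + 1 → r (c (i₀ + i)) < r (c i₀)) := by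
    obtain ⟨hinj, hint, h0⟩ := hq
    simp only [Nat.cast_zero, add_zero, Interlaced] at hint h0
    by_cases hn : n = 0
    · exact Or.inl (by omega)
    have hor : ∀ i : ℕ, 2 ≤ i → i ≤ 2 * n + 1 →
        r (c i₀) < l (c (i₀ + i)) ∨ r (c (i₀ + i)) < r (c i₀) := by
      intro i hi hi2
      have h1 := hint 0 i (by omega) (by omega)
      have h2 := h0 i (by omega) (by omega)
      simp only [Nat.cast_zero, add_zero] at h1
      have h3 : c i₀ ≠ c (i₀ + i) := fun h => by rw [h] at h2; exact lt_irrefl _ h2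
      have h4 := hne _ _ h3
      have h5 := hne _ _ h3.symm
      omega
    have hstep : ∀ i : ℕ, 2 ≤ i → i + 1 ≤ 2 * n + 1 →
        (r (c i₀) < l (c (i₀ + i)) ↔ r (c i₀) < l (c (i₀ + (i + 1 : ℕ)))) := by
      intro i hi hi2
      have h1 := hor i hi (by omega)
      have h2 := hor (i + 1) (by omega) hi2
      have h3 := (hint i (i + 1) (by omega) (by omega)).2 (Or.inl rfl)
      have h4 := hlr (c (i₀ + i))
      have h5 := hlr (c (i₀ + (i + 1 : ℕ)))
      omega
    by_cases h2 : r (c i₀) < l (c (i₀ + (2 : ℕ)))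
    · refine Or.inl fun i hi => Nat.le_induction (fun _ => h2) (fun k hk ih hk2 => ?_) i hi
      exact (hstep k hk hk2).1 (ih (by omega))
    · refine Or.inr ⟨by omega, fun i hi hi2 => (hor i hi hi2).resolve_left ?_⟩
      revert hi2
      exact Nat.le_induction (fun _ => h2)
        (fun k hk ih hk2 => fun h => ih (by omega) ((hstep k hk hk2).2 h)) i hi
  have hends : c (i₀ + (1 : ℕ)) ≠ c (i₀ + (2 * n + 2 : ℕ)) := fun h => by
    have := hq.1 (show 1 < 2 * n + 3 by omega) (show 2 * n + 2 < 2 * n + 3 by omega) h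
    omega
  have hrev1 : c (i₀ - (1 : ℕ)) = c (i₀ + (2 * n + 2 : ℕ)) := hrev 1 (by omega)
  have hrevz : c (i₀ - (2 * n + 2 : ℕ)) = c (i₀ + (1 : ℕ)) := by
    rw [hrev _ (by omega), show 2 * n + 3 - (2 * n + 2) = 1 by omega]
  rcases hside with hs | ⟨hn, hs⟩
  · rcases lt_or_gt_of_ne (hne _ _ hends).1 with hlt | hlt
    · refine ⟨n, fun k => c (i₀ - k), hq'.1, hq'.2.1, hq'.2.2, Or.inl ⟨?_, fun i hi hi2 => ?_⟩⟩
      · beta_reduce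
        rwa [hrev1, hrevz]
      · beta_reduce
        rw [hrev i (by omega), Nat.cast_zero, sub_zero]
        exact hs _ (by omega) (by omega)
    · refine ⟨n, fun k => c (i₀ + k), hq.1, hq.2.1, hq.2.2, Or.inl ⟨hlt, fun i hi hi2 => ?_⟩⟩
      beta_reduce
      rw [Nat.cast_zero, add_zero]
      exact hs i hi hi2
  · rcases lt_or_gt_of_ne (hne _ _ hends).2.1 with hlt | hlt
    · refine ⟨n, fun k => c (i₀ - k), hq'.1, hq'.2.1, hq'.2.2, Or.inr ⟨?_, hn, fun i hi hi2 => ?_⟩⟩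
      · beta_reduce
        rwa [hrev1, hrevz]
      · beta_reduce
        rw [hrev i (by omega), Nat.cast_zero, sub_zero]
        exact hs _ (by omega) (by omega)
    · refine ⟨n, fun k => c (i₀ + k), hq.1, hq.2.1, hq.2.2, Or.inr ⟨hlt, hn, fun i hi hi2 => ?_⟩⟩
      beta_reduce
      rw [Nat.cast_zero, add_zero]
      exact hs i hi hi2

/-- Sum modulo two of the indicators of the half-open intervals `[l v, r v)`, for `v` in `S`. -/
def intervalSum {V : Type*} (l r : V → ℤ) (S : Finset V) (x : ℤ) : ZMod 2 :=
  ∑ v ∈ S, (stepFun (l v) x + stepFun (r v) x)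

/-- The difference of the values of an interval indicator at the ends of another interval shows
whether the intervals are interlaced. -/
theorem stepFun_ends_of_ne {l₁ r₁ l₂ r₂ : ℤ} (h1 : l₁ < r₁) (h2 : l₂ < r₂) (hl : l₁ ≠ l₂)
    (hr : r₁ ≠ r₂) (hlr : l₁ ≠ r₂) (hrl : l₂ ≠ r₁) [Decidable (Interlaced l₁ r₁ l₂ r₂)] :
    (stepFun l₁ l₂ + stepFun r₁ l₂) + (stepFun l₁ r₂ + stepFun r₁ r₂) =
      if Interlaced l₁ r₁ l₂ r₂ then 1 else 0 := by
  by_cases hI : Interlaced l₁ r₁ l₂ r₂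
  · rw [if_pos hI]
    unfold Interlaced at hI
    unfold stepFun
    split_ifs <;> first | omega | decide
  · rw [if_neg hI]
    unfold Interlaced at hI
    unfold stepFun
    split_ifs <;> first | omega | decide

theorem Interlaced.symm {l₁ r₁ l₂ r₂ : ℤ} (h : Interlaced l₁ r₁ l₂ r₂) : Interlaced l₂ r₂ l₁ r₁ :=
  Or.symm h

theorem stepFun_ends_self {l r : ℤ} (h : l < r) :
    (stepFun l l + stepFun r l) + (stepFun l r + stepFun r r) = 1 := by
  rw [stepFun_of_le le_rfl, stepFun_of_lt h, stepFun_of_le h.le, stepFun_of_le le_rfl]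
  rfl

theorem stepFun_add_stepFun (a x y : ℤ) (hxy : y ≤ x) :
    stepFun a x + stepFun a y = if y < a ∧ a ≤ x then 1 else 0 := by
  unfold stepFun
  split_ifs <;> first | omega | decide

/-- If the interlacement graph of a chord diagram is not bipartite, then there are sets `S`, `T` of
chords such that `intervalSum l r T` is supported where `intervalSum l r S` is `1`, and exactly one
chord of `S ∩ T` is interlaced with an odd number of other chords of `S`. -/
theorem exists_chord_sets_of_not_colorable {V : Type*} (l r : V → ℤ) (hlr : ∀ v, l v < r v)
    (hne : ∀ v w, v ≠ w → l v ≠ l w ∧ r v ≠ r w ∧ l v ≠ r w)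
    (h : ¬ (interlaceGraph l r hlr).Colorable 2) :
    ∃ S T : Finset V, (∀ x, (1 + intervalSum l r S x) * intervalSum l r T x = 0) ∧
      ∃ v₀, ∀ v, (v ∈ S ∧ v ∈ T ∧ intervalSum l r S (l v) = intervalSum l r S (r v)) ↔ v = v₀ := by
  classical
  obtain ⟨n, q, hinj, hint, h0, hcase⟩ := exists_traversal_of_not_colorable l r hlr hne h
  have hqne : ∀ i < 2 * n + 3, ∀ j < 2 * n + 3, i ≠ j → q i ≠ q j :=
    fun i hi j hj hij he => hij (hinj hi hj he)
  obtain ⟨a, b, u, v, hab, huv, h1, h2, h3, h4, h5, h6, h7⟩ :=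
    exists_order_of_induced_odd_cycle (fun i => l (q i)) (fun i => r (q i)) (fun i _ => hlr _)
      (fun i hi j hj hij => hne _ _ (hqne i hi j hj hij)) hint h0 hcase
  let S := (Finset.range (2 * n + 2)).image q
  let T := (Finset.range (n + 2)).image fun k => q (2 * k)
  have hpair : ∀ i < 2 * n + 2, ∀ x,
      stepFun (l (q i)) x + stepFun (r (q i)) x = stepFun (a i) x + stepFun (b i) x := by
    intro i hi x
    rcases hab i hi with ⟨ha, hb⟩ | ⟨ha, hb⟩
    · rw [ha, hb]
    · rw [ha, hb, add_comm]
  have hS : ∀ x, intervalSum l r S x =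
      ∑ i ∈ Finset.range (2 * n + 2), (stepFun (l (q i)) x + stepFun (r (q i)) x) := by
    intro x
    refine Finset.sum_image fun i hi j hj hij => ?_
    simp only [Finset.coe_range, Set.mem_Iio] at hi hj
    exact hinj (show i < 2 * n + 3 by omega) (show j < 2 * n + 3 by omega) hij
  have hT : ∀ x, intervalSum l r T x = ∑ k ∈ Finset.range (n + 1),
      (stepFun (a (2 * k)) x + stepFun (b (2 * k)) x) + (stepFun u x + stepFun v x) := by
    intro x
    have : intervalSum l r T x = ∑ k ∈ Finset.range (n + 2),
        (stepFun (l (q (2 * k))) x + stepFun (r (q (2 * k))) x) := by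
      refine Finset.sum_image fun i hi j hj hij => ?_
      simp only [Finset.coe_range, Set.mem_Iio] at hi hj
      have := hinj (show 2 * i < 2 * n + 3 by omega) (show 2 * j < 2 * n + 3 by omega) hij
      omega
    rw [this, Finset.sum_range_succ]
    congr 1
    · refine Finset.sum_congr rfl fun k hk => hpair _ ?_ x
      have := Finset.mem_range.1 hk
      omega
    · rw [show 2 * (n + 1) = 2 * n + 2 by ring]
      rcases huv with ⟨rfl, rfl⟩ | ⟨rfl, rfl⟩
      · rfl
      · exact add_comm _ _
  refine ⟨S, T, fun x => ?_, q 0, fun w => ?_⟩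
  · rw [hS, hT, Finset.sum_congr rfl fun i hi => hpair i (Finset.mem_range.1 hi) x]
    exact one_add_sum_mul_sum_eq_zero n a b u v h1 h2 h3 h4 h5 h6 h7 x
  have hcount : ∀ k ≤ n, intervalSum l r S (l (q (2 * k))) + intervalSum l r S (r (q (2 * k))) =
      ∑ i ∈ Finset.range (2 * n + 2), ((if i = 2 * k then 1 else 0) +
        ((if i = 2 * k + 1 then 1 else 0) + if i + 1 = 2 * k then 1 else 0)) := by
    intro k hk
    rw [hS, hS, ← Finset.sum_add_distrib]
    refine Finset.sum_congr rfl fun i hi => ?_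
    have hi := Finset.mem_range.1 hi
    by_cases hik : i = 2 * k
    · subst hik
      rw [stepFun_ends_self (hlr _), if_pos rfl, if_neg (by omega), if_neg (by omega)]
      rfl
    · have hn := hne _ _ (hqne i (by omega) (2 * k) (by omega) hik)
      have hn' := hne _ _ (hqne (2 * k) (by omega) i (by omega) (Ne.symm hik))
      rw [stepFun_ends_of_ne (hlr _) (hlr _) hn.1 hn.2.1 hn.2.2 hn'.2.2, if_neg hik]
      rcases lt_or_gt_of_ne hik with hlt | hlt
      · have := hint i (2 * k) hlt (by omega)
        rw [if_neg (show ¬ i = 2 * k + 1 by omega)]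
        by_cases hc : i + 1 = 2 * k
        · rw [if_pos hc, if_pos (this.2 (Or.inl hc.symm))]; rfl
        · rw [if_neg hc, if_neg (fun h => by have := this.1 h; omega)]; rfl
      · have := hint (2 * k) i hlt (by omega)
        rw [if_neg (show ¬ i + 1 = 2 * k by omega)]
        by_cases hc : i = 2 * k + 1
        · rw [if_pos hc, if_pos (this.2 (Or.inl hc)).symm]; rfl
        · rw [if_neg hc, if_neg (fun h => by have := this.1 h.symm; omega)]; rfl
  have hiff : ∀ k ≤ n, intervalSum l r S (l (q (2 * k))) = intervalSum l r S (r (q (2 * k))) ↔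
      k = 0 := by
    intro k hk
    rw [← CharTwo.add_eq_zero, hcount k hk, Finset.sum_add_distrib, Finset.sum_add_distrib,
      Finset.sum_ite_eq', Finset.sum_ite_eq', if_pos (by simp; omega), if_pos (by simp; omega)]
    rcases Nat.eq_zero_or_pos k with rfl | hk0
    · rw [Finset.sum_eq_zero fun i _ => if_neg (by omega)]
      exact ⟨fun _ => rfl, fun _ => rfl⟩
    · obtain ⟨j, hj⟩ : ∃ j, j + 1 = 2 * k := ⟨2 * k - 1, by omega⟩
      simp only [← hj, Nat.add_right_cancel_iff]
      rw [Finset.sum_ite_eq', if_pos (by simp; omega)]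
      constructor
      · exact fun h => absurd h (by decide)
      · omega
  constructor
  · rintro ⟨hwS, hwT, heq⟩
    obtain ⟨i, hi, rfl⟩ := Finset.mem_image.1 hwS
    obtain ⟨k, hk, hki⟩ := Finset.mem_image.1 hwT
    have hi := Finset.mem_range.1 hi
    have hk := Finset.mem_range.1 hk
    have := hinj (show 2 * k < 2 * n + 3 by omega) (show i < 2 * n + 3 by omega) hki
    subst this
    rw [(hiff k (by omega)).1 heq]
  · rintro rfl
    exact ⟨Finset.mem_image.2 ⟨0, by simp, rfl⟩, Finset.mem_image.2 ⟨0, by simp, rfl⟩,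
      (hiff 0 (Nat.zero_le _)).2 rfl⟩

/-! ### Bipartiteness of the chord diagram of a layout -/

namespace XGraph

variable {V H : Type*} {G : XGraph V H}

theorem Smoothing.isEven_one [Fintype H] (σ : G.Smoothing) :
    G.IsEven (1 : H → ZMod 2) where
  opp _ := rfl
  boundary v := by
    obtain ⟨h, rfl⟩ := G.exists_vert_eq v
    rw [σ.boundary_eq]
    rfl

namespace Layout

variable (L : G.Layout)

theorem num_partner_ne (h : H) : L.num (G.partner h) ≠ L.num h := fun he => by
  rcases L.eq_or_eq_of_num_eq _ _ he.symm with h1 | h1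
  · exact G.partner_ne h h1
  · exact L.turn_ne_partner h h1.symm

theorem vert_eq_of_num_eq {h k : H} (he : L.num h = L.num k) : G.vert h = G.vert k := by
  rcases L.eq_or_eq_of_num_eq _ _ he with rfl | rfl
  · rfl
  · exact (L.vert_turn h).symm

theorem exists_first (v : V) :
    ∃ h, G.vert h = v ∧ L.out h ∧ L.num h < L.num (G.partner h) := by
  obtain ⟨h, rfl⟩ := G.exists_vert_eq v
  obtain ⟨k, hk, hko⟩ : ∃ k, G.vert k = G.vert h ∧ L.out k := by
    by_cases ho : L.out h
    · exact ⟨h, rfl, ho⟩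
    · exact ⟨L.turn h, L.vert_turn h, (L.out_turn h).2 ho⟩
  rcases lt_or_gt_of_ne (L.num_partner_ne k) with hlt | hlt
  · refine ⟨G.partner k, by rw [G.vert_partner, hk], (L.out_partner k).2 hko, ?_⟩
    rwa [G.partner_partner]
  · exact ⟨k, hk, hko, hlt⟩

/-- The half-edge with which the first of the two passages through `v` leaves `v`. -/
noncomputable def first (v : V) : H := (L.exists_first v).choose

theorem vert_first (v : V) : G.vert (L.first v) = v := (L.exists_first v).choose_spec.1

theorem out_first (v : V) : L.out (L.first v) := (L.exists_first v).choose_spec.2.1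

/-- The number of the first passage through a vertex: the left end of the chord of this vertex. -/
noncomputable def left (v : V) : ℤ := L.num (L.first v)

/-- The number of the second passage through a vertex: the right end of the chord of this vertex. -/
noncomputable def right (v : V) : ℤ := L.num (G.partner (L.first v))

theorem left_lt_right (v : V) : L.left v < L.right v := by
  unfold left right first
  exact_mod_cast (L.exists_first v).choose_spec.2.2

theorem num_eq_left_or_right {h : H} {v : V} (hv : G.vert h = v) :
    ((L.num h : ℤ) = L.left v ∧ (L.num (G.partner h) : ℤ) = L.right v) ∨
      ((L.num h : ℤ) = L.right v ∧ (L.num (G.partner h) : ℤ) = L.left v) := by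
  unfold left right
  rcases L.eq_or_eq_of_vert_eq (hv.trans (L.vert_first v).symm) with h1 | h1 | h1 | h1 <;>
    simp [h1, L.num_turn, ← L.turn_partner, G.partner_partner]

theorem vert_eq_of_num_eq_left {h : H} {v : V} (hl : L.left v = L.num h) : G.vert h = v := by
  rw [← L.vert_first v]
  exact (L.vert_eq_of_num_eq (by unfold left at hl; exact_mod_cast hl)).symm

theorem vert_eq_of_num_eq_right {h : H} {v : V} (hr : L.right v = L.num h) : G.vert h = v := by
  rw [← L.vert_first v, ← G.vert_partner (L.first v)]
  exact (L.vert_eq_of_num_eq (by unfold right at hr; exact_mod_cast hr)).symm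

theorem ends_ne {v w : V} (hvw : v ≠ w) :
    L.left v ≠ L.left w ∧ L.right v ≠ L.right w ∧ L.left v ≠ L.right w := by
  refine ⟨fun h => hvw ?_, fun h => hvw ?_, fun h => hvw ?_⟩
  · exact (L.vert_first v).symm.trans (L.vert_eq_of_num_eq_left h.symm)
  · exact ((L.vert_first v).symm.trans (G.vert_partner _).symm).trans
      (L.vert_eq_of_num_eq_right h.symm)
  · exact (L.vert_first v).symm.trans (L.vert_eq_of_num_eq_right h.symm)

/-- The function on edges that takes at the edge leaving the `x`-th passage the value of
`intervalSum` at `x`. -/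
noncomputable def edgeSum (S : Finset V) (h : H) : ZMod 2 :=
  open Classical in
  if L.out h then intervalSum L.left L.right S (L.num h)
  else intervalSum L.left L.right S (L.num (G.opp h))

theorem edgeSum_of_out (S : Finset V) {h : H} (ho : L.out h) :
    L.edgeSum S h = intervalSum L.left L.right S (L.num h) := if_pos ho

theorem edgeSum_opp (S : Finset V) (h : H) : L.edgeSum S (G.opp h) = L.edgeSum S h := by
  unfold edgeSum
  by_cases ho : L.out h
  · rw [if_neg (by rwa [L.out_opp, not_not]), if_pos ho, G.opp_opp]
  · rw [if_pos (by rwa [L.out_opp]), if_neg ho]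

/-- The edge entering a passage takes the value of `intervalSum` at the preceding number, also if it
closes a circuit, because the circuit contains no end of a chord or both ends. -/
theorem edgeSum_turn (S : Finset V) {h : H} (ho : L.out h) :
    L.edgeSum S (L.turn h) = intervalSum L.left L.right S (L.num h - 1) := by
  have hout : L.out (G.opp (L.turn h)) := by
    rw [L.out_opp, L.out_turn, not_not]
    exact ho
  rw [← L.edgeSum_opp, L.edgeSum_of_out S hout]
  have := L.num_opp _ hout
  rw [G.opp_opp, L.num_turn] at this
  rcases this with h1 | ⟨hle, hcl⟩
  · rw [h1]; congr 1; push_cast; ring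
  · rw [← CharTwo.add_eq_zero]
    unfold intervalSum
    rw [← Finset.sum_add_distrib]
    refine Finset.sum_eq_zero fun v _ => ?_
    have hfp := hcl (L.first v)
    have hpf := hcl (G.partner (L.first v))
    rw [G.partner_partner] at hpf
    rw [add_add_add_comm, stepFun_add_stepFun _ _ _ (by omega),
      stepFun_add_stepFun _ _ _ (by omega)]
    unfold left right
    by_cases hin : L.num h ≤ L.num (L.first v) ∧ L.num (L.first v) ≤ L.num (G.opp (L.turn h))
    · have := hfp hin.1 hin.2
      rw [if_pos (by omega), if_pos (by omega)]
      rfl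
    · rw [if_neg (by omega), if_neg, add_zero]
      intro hc
      exact hin (hpf (by omega) (by omega))

open Classical in
/-- The edges before and after a passage take different values if the passage ends a chord of `S`. -/
theorem edgeSum_add_edgeSum_turn (S : Finset V) {h : H} (ho : L.out h) :
    L.edgeSum S h + L.edgeSum S (L.turn h) = if G.vert h ∈ S then 1 else 0 := by
  rw [L.edgeSum_of_out S ho, L.edgeSum_turn S ho]
  unfold intervalSum
  rw [← Finset.sum_add_distrib, ← Finset.sum_ite_eq S (G.vert h) fun _ => 1]
  refine Finset.sum_congr rfl fun v _ => ?_
  rw [add_add_add_comm, stepFun_add_stepFun _ _ _ (by omega), stepFun_add_stepFun _ _ _ (by omega)]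
  by_cases hv : G.vert h = v
  · have := L.left_lt_right v
    rw [if_pos hv]
    rcases L.num_eq_left_or_right hv with h1 | h1
    · rw [if_pos (by omega), if_neg (by omega), add_zero]
    · rw [if_neg (by omega), if_pos (by omega), zero_add]
  · rw [if_neg hv, if_neg, if_neg, add_zero]
    · exact fun hc => hv (L.vert_eq_of_num_eq_right (by omega))
    · exact fun hc => hv (L.vert_eq_of_num_eq_left (by omega))

theorem isEven_edgeSum [Fintype H] (S : Finset V) : G.IsEven (L.edgeSum S) where
  opp := L.edgeSum_opp S
  boundary v := by
    classical
    have h1 := L.edgeSum_add_edgeSum_turn S (L.out_first v)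
    have h2 := L.edgeSum_add_edgeSum_turn S ((L.out_partner _).2 (L.out_first v))
    rw [G.vert_partner, L.turn_partner] at h2
    have := L.boundary_eq (L.edgeSum S) (L.first v)
    rw [L.vert_first] at this
    rw [this, add_assoc, add_add_add_comm, h1, h2]
    exact CharTwo.add_self_eq_zero _

/-- The chord diagram of a layout has a bipartite interlacement graph: otherwise the edge sums of the
sets of `exists_chord_sets_of_not_colorable` yield disjoint even sets with exactly one crossing. -/
theorem colorable_interlaceGraph [Fintype H]
    (hP : ∀ f g : H → ZMod 2, G.IsEven f → G.IsEven g → (∀ h, f h * g h = 0) →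
      Even (G.crossings f g).ncard) :
    (interlaceGraph L.left L.right L.left_lt_right).Colorable 2 := by
  classical
  by_contra hcol
  obtain ⟨S, T, hST, v₀, hv₀⟩ :=
    exists_chord_sets_of_not_colorable _ _ L.left_lt_right (fun _ _ h => L.ends_ne h) hcol
  have hdisj : ∀ h, (1 + L.edgeSum S) h * L.edgeSum T h = 0 := by
    intro h
    rw [Pi.add_apply, Pi.one_apply]
    unfold edgeSum
    split_ifs
    · exact hST _
    · exact hST _
  have heven := hP _ _ (L.isEven_one.add (L.isEven_edgeSum S)) (L.isEven_edgeSum T) hdisj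
  suffices G.crossings (1 + L.edgeSum S) (L.edgeSum T) = {v₀} by
    rw [this, Set.ncard_singleton] at heven
    exact absurd heven (by decide)
  ext v
  rw [Set.mem_singleton_iff, ← hv₀ v, left, right]
  have hp := (L.out_partner _).2 (L.out_first v)
  rw [← L.edgeSum_of_out S (L.out_first v), ← L.edgeSum_of_out S hp]
  have key := L.mem_crossings_iff hdisj (L.first v)
  rw [L.vert_first] at key
  rw [key]
  have s1 := L.edgeSum_add_edgeSum_turn S (L.out_first v)
  have s2 := L.edgeSum_add_edgeSum_turn S hp
  have t1 := L.edgeSum_add_edgeSum_turn T (L.out_first v)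
  have t2 := L.edgeSum_add_edgeSum_turn T hp
  have d1 := hdisj (L.first v)
  have d2 := hdisj (G.partner (L.first v))
  have d3 := hdisj (L.turn (L.first v))
  have d4 := hdisj (G.partner (L.turn (L.first v)))
  rw [G.vert_partner, L.vert_first, L.turn_partner] at s2 t2
  rw [L.vert_first] at s1 t1
  simp only [Pi.add_apply, Pi.one_apply] at d1 d2 d3 d4 ⊢
  generalize L.edgeSum S (L.first v) = a1 at *
  generalize L.edgeSum S (G.partner (L.first v)) = a2 at *
  generalize L.edgeSum S (L.turn (L.first v)) = a3 at *
  generalize L.edgeSum S (G.partner (L.turn (L.first v))) = a4 at *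
  generalize L.edgeSum T (L.first v) = b1 at *
  generalize L.edgeSum T (G.partner (L.first v)) = b2 at *
  generalize L.edgeSum T (L.turn (L.first v)) = b3 at *
  generalize L.edgeSum T (G.partner (L.turn (L.first v))) = b4 at *
  clear key hv₀ hST heven hP hdisj hcol hp
  by_cases hS : v ∈ S <;> by_cases hT : v ∈ T <;>
    simp only [hS, hT, if_true, if_false, true_and, false_and] at s1 s2 t1 t2 ⊢ <;>
    clear hS hT <;> revert a1 a2 a3 a4 b1 b2 b3 b4 <;> decide

end Layout

end XGraph

/-! ### The arches of a layout -/

namespace XGraph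

variable {V H : Type*} {G : XGraph V H}

/-- A combinatorial description of a drawing by parabolic arches. The vertex `v` lies on a
horizontal line at `foot v`, and the half-edge `h` is an arch from there to the point `far h` of the
line, the middle of the edge; the arch lies above the line, below it or on it according to the
sign `bend h`. -/
structure ArchDiagram (G : XGraph V H) where
  foot : V → ℤ
  far : H → ℤ
  bend : H → ℤ
  foot_injective : Function.Injective foot
  far_ne_foot : ∀ h v, far h ≠ foot v
  far_opp : ∀ h, far (G.opp h) = far h
  eq_or_eq_of_far_eq : ∀ h k, far h = far k → k = h ∨ k = G.opp h
  bend_eq : ∀ h, bend h = 1 ∨ bend h = -1 ∨ bend h = 0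
  far_of_bend_eq_zero : ∀ h, bend h = 0 →
    far h = foot (G.vert h) + 1 ∨ far h = foot (G.vert h) - 1
  /-- Arches on the same side are nested or lie side by side. -/
  nested : ∀ h k, h ≠ k → bend h = bend k → ∀ l r l' r' : ℤ,
    l = min (foot (G.vert h)) (far h) → r = max (foot (G.vert h)) (far h) →
    l' = min (foot (G.vert k)) (far k) → r' = max (foot (G.vert k)) (far k) →
    r ≤ l' ∨ r' ≤ l ∨ (bend h ≠ 0 ∧ ((l ≤ l' ∧ r' ≤ r ∧ (l < l' ∨ r' < r)) ∨
      (l' ≤ l ∧ r ≤ r' ∧ (l' < l ∨ r < r'))))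
  bend_eq_zero_of_far_lt : ∀ h, far h < foot (G.vert h) → bend h = 0
  /-- The order of the arches around a vertex, counterclockwise from the downward direction. -/
  exists_order : ∀ v, ∃ h : Fin 4 → H, (∀ i, G.vert (h i) = v) ∧ G.partner (h 0) = h 2 ∧
    G.partner (h 1) = h 3 ∧ ∀ i j, i < j → foot v < far (h i) ∧
      (far (h j) < foot v ∨ bend (h i) * (far (h i) - foot v) < bend (h j) * (far (h j) - foot v))

namespace Layout

variable (L : G.Layout)

theorem eq_of_num_eq_of_out_iff {h k : H} (hn : L.num h = L.num k) (ho : L.out h ↔ L.out k) :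
    h = k := by
  rcases L.eq_or_eq_of_num_eq h k hn with rfl | rfl
  · rfl
  · rw [L.out_turn] at ho
    tauto

open Classical in
/-- Twice the number between those of the passages joined by an edge, or twice the last number of a
circuit closed by this edge, plus one. -/
noncomputable def far (h : H) : ℤ := 2 * L.num (if L.out h then h else G.opp h) + 1

open Classical in
/-- The side of the line of an arch: for the second passage through a vertex it is given by a
colouring `c`. The first passage runs along the line, unless it starts a circuit; the edge closing
the circuit goes to the side opposite to that of the second passage. -/
noncomputable def bend (c : V → ℤ) (h : H) : ℤ :=
  if (L.num h : ℤ) = L.right (G.vert h) then c (G.vert h)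
  else if ¬ L.out h ∧ L.num h ≤ L.num (G.opp h) then - c (G.vert h) else 0

/-- A closing edge returns to a first passage, since the circuit contains both passages. -/
theorem num_eq_of_not_out {h : H} (ho : ¬ L.out h) :
    (L.num h : ℤ) = L.num (G.opp h) + 1 ∨ ((L.num h : ℤ) = L.left (G.vert h) ∧
      L.num h ≤ L.num (G.opp h) ∧ ∀ w, (L.left (G.vert h) ≤ L.left w ∧ L.left w ≤ L.num (G.opp h)) ↔
        (L.left (G.vert h) ≤ L.right w ∧ L.right w ≤ L.num (G.opp h))) := by
  have hout : L.out (G.opp h) := (L.out_opp h).2 ho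
  have := L.num_opp _ hout
  rw [G.opp_opp] at this
  rcases this with h1 | ⟨hle, hcl⟩
  · exact Or.inl (by omega)
  · have hleft : (L.num h : ℤ) = L.left (G.vert h) := by
      rcases L.num_eq_left_or_right (h := h) rfl with h1 | h1
      · exact h1.1
      · have := hcl h le_rfl hle
        have := L.left_lt_right (G.vert h)
        omega
    refine Or.inr ⟨hleft, hle, fun w => ?_⟩
    rw [← hleft]
    have h1 := hcl (L.first w)
    have h2 := hcl (G.partner (L.first w))
    rw [G.partner_partner] at h2
    unfold left right
    constructor
    · intro h3
      have := h1 (by omega) (by omega)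
      omega
    · intro h3
      have := h2 (by omega) (by omega)
      omega

/-- The kinds of arches: those of second passages, those running along the line, and those of edges
that close a circuit. -/
theorem arch_cases (c : V → ℤ) (h : H) :
    ((L.num h : ℤ) = L.right (G.vert h) ∧ L.bend c h = c (G.vert h) ∧
      ((L.out h ∧ L.far h = 2 * L.right (G.vert h) + 1) ∨
        (¬ L.out h ∧ L.far h = 2 * L.right (G.vert h) - 1))) ∨
    ((L.num h : ℤ) = L.left (G.vert h) ∧ L.bend c h = 0 ∧
      ((L.out h ∧ L.far h = 2 * L.left (G.vert h) + 1) ∨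
        (¬ L.out h ∧ L.far h = 2 * L.left (G.vert h) - 1))) ∨
    ((L.num h : ℤ) = L.left (G.vert h) ∧ L.bend c h = - c (G.vert h) ∧
      ¬ L.out h ∧ L.num h ≤ L.num (G.opp h) ∧ L.far h = 2 * L.num (G.opp h) + 1) := by
  have hlr := L.left_lt_right (G.vert h)
  unfold bend far
  by_cases ho : L.out h
  · rw [if_pos ho]
    simp only [ho, not_true, false_and, if_false, true_and, or_false]
    rcases L.num_eq_left_or_right (h := h) rfl with h1 | h1
    · rw [if_neg (by omega)]
      exact Or.inr (Or.inl ⟨h1.1, rfl, by omega⟩)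
    · rw [if_pos h1.1]
      exact Or.inl ⟨h1.1, rfl, by omega⟩
  · rw [if_neg ho]
    simp only [ho, not_false_iff, false_and, true_and, false_or]
    rcases L.num_eq_of_not_out ho with h2 | ⟨h2, h3, h4⟩
    · rcases L.num_eq_left_or_right (h := h) rfl with h1 | h1
      · rw [if_neg (by omega), if_neg (by omega)]
        exact Or.inr (Or.inl ⟨h1.1, rfl, by omega⟩)
      · rw [if_pos h1.1]
        exact Or.inl ⟨h1.1, rfl, by omega⟩
    · rw [if_neg (by omega), if_pos h3]
      exact Or.inr (Or.inr ⟨h2, rfl, h3, trivial⟩)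

/-- The intervals below or above which the arches run. -/
theorem arch_interval (c : V → ℤ) (h : H) {l r : ℤ}
    (hl : l = min (2 * L.left (G.vert h)) (L.far h))
    (hr : r = max (2 * L.left (G.vert h)) (L.far h)) :
    ((L.num h : ℤ) = L.right (G.vert h) ∧ L.bend c h = c (G.vert h) ∧ l = 2 * L.left (G.vert h) ∧
      ((L.out h ∧ r = 2 * L.right (G.vert h) + 1) ∨
        (¬ L.out h ∧ r = 2 * L.right (G.vert h) - 1))) ∨
    ((L.num h : ℤ) = L.left (G.vert h) ∧ L.bend c h = 0 ∧ r = l + 1 ∧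
      ((L.out h ∧ l = 2 * L.left (G.vert h)) ∨ (¬ L.out h ∧ r = 2 * L.left (G.vert h)))) ∨
    ((L.num h : ℤ) = L.left (G.vert h) ∧ L.bend c h = - c (G.vert h) ∧
      ¬ L.out h ∧ L.num h ≤ L.num (G.opp h) ∧ l = 2 * L.left (G.vert h) ∧
      r = 2 * L.num (G.opp h) + 1) := by
  have hlr := L.left_lt_right (G.vert h)
  rcases L.arch_cases c h with ⟨h1, h2, h3⟩ | ⟨h1, h2, h3⟩ | ⟨h1, h2, h3, h4, h5⟩
  · refine Or.inl ⟨h1, h2, by omega, h3.imp ?_ ?_⟩ <;> exact fun h => ⟨h.1, by omega⟩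
  · refine Or.inr (Or.inl ⟨h1, h2, by omega, h3.imp ?_ ?_⟩) <;> exact fun h => ⟨h.1, by omega⟩
  · exact Or.inr (Or.inr ⟨h1, h2, h3, h4, by omega⟩)

/-- Arches on the same side of the line do not cross. For two second passages this holds since chords
of one colour are not interlaced, and otherwise since the interval of a closing edge contains both
ends or no end of a chord and no other closing edge. -/
theorem nested_arches {c : V → ℤ} (hc : ∀ v, c v = 1 ∨ c v = -1)
    (hcI : ∀ v w, Interlaced (L.left v) (L.right v) (L.left w) (L.right w) → c v ≠ c w)
    {h k : H} (hne : h ≠ k) (hb : L.bend c h = L.bend c k) {l r l' r' : ℤ}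
    (hl : l = min (2 * L.left (G.vert h)) (L.far h))
    (hr : r = max (2 * L.left (G.vert h)) (L.far h))
    (hl' : l' = min (2 * L.left (G.vert k)) (L.far k))
    (hr' : r' = max (2 * L.left (G.vert k)) (L.far k)) :
    r ≤ l' ∨ r' ≤ l ∨ (L.bend c h ≠ 0 ∧ ((l ≤ l' ∧ r' ≤ r ∧ (l < l' ∨ r' < r)) ∨
      (l' ≤ l ∧ r ≤ r' ∧ (l' < l ∨ r < r')))) := by
  have hv := L.left_lt_right (G.vert h)
  have hcv := hc (G.vert h)
  have hI := hcI (G.vert h) (G.vert k)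
  unfold Interlaced at hI
  have hout : L.num h = L.num k → ¬ (L.out h ↔ L.out k) :=
    fun hn ho => hne (L.eq_of_num_eq_of_out_iff hn ho)
  have hA := L.arch_interval c h hl hr
  have hB := L.arch_interval c k hl' hr'
  clear hl hr hl' hr'
  by_cases hvw : G.vert h = G.vert k
  · rw [← hvw] at hB
    clear hI
    rcases hA with ⟨h1, h2, h3, h4⟩ | ⟨h1, h2, h3, h4⟩ | ⟨h1, h2, h3, h4, h5, h6⟩ <;>
      rcases hB with ⟨k1, k2, k3, k4⟩ | ⟨k1, k2, k3, k4⟩ | ⟨k1, k2, k3, k4, k5, k6⟩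
    · have := hout (by omega)
      rcases h4 with ⟨h4, h5⟩ | ⟨h4, h5⟩ <;> rcases k4 with ⟨k4, k5⟩ | ⟨k4, k5⟩ <;>
        simp only [h4, k4, not_true] at this <;> omega
    · omega
    · omega
    · omega
    · have := hout (by omega)
      rcases h4 with ⟨h4, h5⟩ | ⟨h4, h5⟩ <;> rcases k4 with ⟨k4, k5⟩ | ⟨k4, k5⟩ <;>
        simp only [h4, k4, not_true] at this <;> omega
    · omega
    · omega
    · omega
    · exact absurd (iff_of_false h3 k3) (hout (by omega))
  · have hw := L.left_lt_right (G.vert k)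
    have hcw := hc (G.vert k)
    have hn := L.ends_ne hvw
    have hn' := L.ends_ne (Ne.symm hvw)
    have hclosed : ∀ h, ¬ L.out h → L.num h ≤ L.num (G.opp h) → ∀ w,
        (L.left (G.vert h) ≤ L.left w ∧ L.left w ≤ L.num (G.opp h)) ↔
        (L.left (G.vert h) ≤ L.right w ∧ L.right w ≤ L.num (G.opp h)) := by
      intro h ho hle
      rcases L.num_eq_of_not_out ho with h1 | h1
      · omega
      · exact h1.2.2
    rcases hA with ⟨h1, h2, h3, h4⟩ | ⟨h1, h2, h3, h4⟩ | ⟨h1, h2, h3, h4, h5, h6⟩ <;>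
      rcases hB with ⟨k1, k2, k3, k4⟩ | ⟨k1, k2, k3, k4⟩ | ⟨k1, k2, k3, k4, k5, k6⟩
    · have hcc : c (G.vert h) = c (G.vert k) := by omega
      have hnI : ¬ _ := fun h => hI h hcc
      clear hI hcw
      omega
    · omega
    · clear hI
      have := hclosed k k3 k4 (G.vert h)
      omega
    · omega
    · clear hI
      omega
    · omega
    · clear hI
      have := hclosed h h3 h4 (G.vert k)
      omega
    · omega
    · clear hI
      have oh := (L.out_opp h).2 h3
      have ok := (L.out_opp k).2 k3
      have e1 := L.num_eq_of_closing _ _ oh ok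
      have e2 := L.num_eq_of_closing _ _ ok oh
      simp only [G.opp_opp] at e1 e2
      have e3 : L.num (G.opp h) ≠ L.num (G.opp k) := fun he => hne
        (G.opp_injective (L.eq_of_num_eq_of_out_iff he (iff_of_true oh ok)))
      omega

/-- The arches of a layout, given a colouring of its chords. -/
noncomputable def archDiagram (c : V → ℤ) (hc : ∀ v, c v = 1 ∨ c v = -1)
    (hcI : ∀ v w, Interlaced (L.left v) (L.right v) (L.left w) (L.right w) → c v ≠ c w) :
    G.ArchDiagram where
  foot v := 2 * L.left v
  far := L.far
  bend := L.bend c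
  foot_injective v w h := by
    by_contra hvw
    have := L.ends_ne hvw
    simp only at h
    omega
  far_ne_foot h v := by unfold far; omega
  far_opp h := by
    unfold far
    by_cases ho : L.out h
    · rw [if_neg (by rwa [L.out_opp, not_not]), if_pos ho, G.opp_opp]
    · rw [if_pos (by rwa [L.out_opp]), if_neg ho]
  eq_or_eq_of_far_eq h k hhk := by
    classical
    unfold far at hhk
    have hn : L.num (if L.out h then h else G.opp h) = L.num (if L.out k then k else G.opp k) := by
      omega
    have ho : ∀ h, L.out (if L.out h then h else G.opp h) := by
      intro h
      split_ifs with ho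
      · exact ho
      · rwa [L.out_opp]
    have := L.eq_of_num_eq_of_out_iff hn (iff_of_true (ho h) (ho k))
    split_ifs at this
    · exact Or.inl this.symm
    · exact Or.inr (by rw [this, G.opp_opp])
    · exact Or.inr this.symm
    · exact Or.inl (G.opp_injective this).symm
  bend_eq h := by
    have := hc (G.vert h)
    unfold bend
    split_ifs <;> omega
  far_of_bend_eq_zero h hb := by
    have := hc (G.vert h)
    have := L.arch_cases c h
    omega
  nested _ _ hne hb _ _ _ _ hl hr hl' hr' := L.nested_arches hc hcI hne hb hl hr hl' hr'
  bend_eq_zero_of_far_lt h hf := by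
    have := L.left_lt_right (G.vert h)
    have := L.arch_cases c h
    omega
  exists_order v := by
    have hlr := L.left_lt_right v
    have hv := L.vert_first v
    have ho := L.out_first v
    have hv2 : G.vert (G.partner (L.first v)) = v := by rw [G.vert_partner, hv]
    have ho2 := (L.out_partner _).2 ho
    have hv3 : G.vert (L.turn (L.first v)) = v := by rw [L.vert_turn, hv]
    have ho3 : ¬ L.out (L.turn (L.first v)) := by rw [L.out_turn, not_not]; exact ho
    have hv4 : G.vert (G.partner (L.turn (L.first v))) = v := by rw [G.vert_partner, hv3]
    have ho4 : ¬ L.out (G.partner (L.turn (L.first v))) := by rwa [L.out_partner]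
    have e1 : (L.num (L.first v) : ℤ) = L.left v := rfl
    have e2 : (L.num (G.partner (L.first v)) : ℤ) = L.right v := rfl
    have e3 : (L.num (L.turn (L.first v)) : ℤ) = L.left v := by rw [L.num_turn]; rfl
    have e4 : (L.num (G.partner (L.turn (L.first v))) : ℤ) = L.right v := by
      rw [← L.turn_partner, L.num_turn]; rfl
    have a1 := L.arch_cases c (L.first v)
    have a2 := L.arch_cases c (G.partner (L.first v))
    have a3 := L.arch_cases c (L.turn (L.first v))
    have a4 := L.arch_cases c (G.partner (L.turn (L.first v)))
    rw [hv] at a1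
    rw [hv2] at a2
    rw [hv3] at a3
    rw [hv4] at a4
    simp only [ho, ho2, ho3, ho4, true_and, false_and, and_false, not_true, not_false_iff, or_false,
      false_or]
      at a1 a2 a3 a4
    have b1 : L.bend c (L.first v) = 0 ∧ L.far (L.first v) = 2 * L.left v + 1 := by omega
    have b2 : L.bend c (G.partner (L.first v)) = c v ∧
        L.far (G.partner (L.first v)) = 2 * L.right v + 1 := by omega
    have b4 : L.bend c (G.partner (L.turn (L.first v))) = c v ∧
        L.far (G.partner (L.turn (L.first v))) = 2 * L.right v - 1 := by omega
    have b3 : (L.bend c (L.turn (L.first v)) = 0 ∧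
        L.far (L.turn (L.first v)) = 2 * L.left v - 1) ∨
        (L.bend c (L.turn (L.first v)) = - c v ∧ 2 * L.left v < L.far (L.turn (L.first v))) := by
      omega
    have p1 := G.partner_partner (L.first v)
    have p3 := G.partner_partner (L.turn (L.first v))
    generalize hx : L.first v = x at *
    generalize hy : G.partner x = y at *
    generalize hz : L.turn x = z at *
    generalize hw : G.partner z = w at *
    clear a1 a2 a3 a4 e1 e2 e3 e4
    -- The half-edges are the outgoing ones `x`, `y` and the incoming ones `z`, `w` of the first and
    -- the second passage. The arches of `y` and `w` run together, `y` outside, and `x` runs along the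
    -- line to the right; `z` runs to the left, or opposite to `y` and `w` if it starts a circuit.
    rcases hc v with hcv | hcv <;> rw [hcv] at b2 b3 b4
    · rcases b3 with b3 | b3
      · refine ⟨![x, w, y, z], fun i => ?_, hy, p3, fun i j hij => ?_⟩
        · fin_cases i <;> assumption
        · fin_cases i <;> fin_cases j <;> simp at hij <;>
            simp [b1, b2, b3, b4] <;> omega
      · refine ⟨![z, x, w, y], fun i => ?_, hw, hy, fun i j hij => ?_⟩
        · fin_cases i <;> assumption
        · fin_cases i <;> fin_cases j <;> simp at hij <;>
            simp [b1, b2, b3, b4] <;> omega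
    · refine ⟨![y, w, x, z], fun i => ?_, p1, p3, fun i j hij => ?_⟩
      · fin_cases i <;> assumption
      · rcases b3 with b3 | b3 <;> fin_cases i <;> fin_cases j <;> simp at hij <;>
          simp [b1, b2, b3, b4] <;> omega

end Layout

end XGraph

/-! ### The drawing by arches -/

namespace XGraph

variable {V H : Type*} {G : XGraph V H}

namespace ArchDiagram

variable (A : G.ArchDiagram)

/-- The position of a vertex. -/
noncomputable def pos (v : V) : EuclideanSpace ℝ (Fin 2) := !₂[(A.foot v : ℝ), 0]

/-- The half of an edge next to the half-edge `h`: a parabolic arch, or a segment of the line. -/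
noncomputable def halfArc (h : H) (t : ℝ) : EuclideanSpace ℝ (Fin 2) :=
  !₂[A.foot (G.vert h) + ((A.far h : ℝ) - A.foot (G.vert h)) * t,
    A.bend h * ((A.far h : ℝ) - A.foot (G.vert h)) ^ 2 * (t * (1 - t))]

theorem continuous_halfArc (h : H) : Continuous (A.halfArc h) := by
  unfold halfArc
  refine (PiLp.continuous_toLp 2 _).comp (continuous_pi fun i => ?_)
  fin_cases i <;> simp <;> fun_prop

theorem halfArc_zero (h : H) : A.halfArc h 0 = A.pos (G.vert h) := by
  simp [halfArc, pos]

theorem halfArc_opp_one (h : H) : A.halfArc (G.opp h) 1 = A.halfArc h 1 := by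
  simp [halfArc, A.far_opp]

/-- An inner point of an arch lies above or below the interval between its ends. -/
theorem exists_interval (h : H) {s : ℝ} (hs : s ∈ Set.Ioo (0 : ℝ) 1) :
    ∃ l r : ℤ, l = min (A.foot (G.vert h)) (A.far h) ∧ r = max (A.foot (G.vert h)) (A.far h) ∧
      (l : ℝ) < A.halfArc h s 0 ∧ A.halfArc h s 0 < (r : ℝ) ∧
      A.halfArc h s 1 = (A.bend h : ℝ) * ((A.halfArc h s 0 - (l : ℝ)) * ((r : ℝ) - A.halfArc h s 0)) := by
  obtain ⟨hs0, hs1⟩ := hs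
  refine ⟨_, _, rfl, rfl, ?_⟩
  simp only [halfArc, PiLp.toLp_apply, Matrix.cons_val_zero, Matrix.cons_val_one]
  rcases lt_or_gt_of_ne (A.far_ne_foot h (G.vert h)) with hlt | hlt
  · rw [min_eq_right hlt.le, max_eq_left hlt.le]
    have : (A.far h : ℝ) < A.foot (G.vert h) := by exact_mod_cast hlt
    refine ⟨by nlinarith, by nlinarith, by ring⟩
  · rw [min_eq_left hlt.le, max_eq_right hlt.le]
    have : (A.foot (G.vert h) : ℝ) < A.far h := by exact_mod_cast hlt
    refine ⟨by nlinarith, by nlinarith, by ring⟩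

/-- An inner point of an arch that lies on the line is not an integer point. -/
theorem ne_int_of_eq_zero (h : H) {s : ℝ} (hs : s ∈ Set.Ioo (0 : ℝ) 1)
    (h0 : A.halfArc h s 1 = 0) (n : ℤ) : A.halfArc h s 0 ≠ (n : ℝ) := by
  intro hn
  obtain ⟨l, r, hl, hr, h1, h2, h3⟩ := A.exists_interval h hs
  rw [h0] at h3
  have h4 := mul_pos (sub_pos.2 h1) (sub_pos.2 h2)
  have hb : A.bend h = 0 := by
    rcases mul_eq_zero.1 h3.symm with h | h
    · exact (Int.cast_eq_zero (α := ℝ)).1 h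
    · exact absurd h h4.ne'
  have := A.far_of_bend_eq_zero h hb
  rw [hn] at h1 h2
  have h1 : l < n := (Int.cast_lt (R := ℝ)).1 h1
  have h2 : n < r := (Int.cast_lt (R := ℝ)).1 h2
  omega

theorem halfArc_ne_pos (h : H) (v : V) {s : ℝ} (hs : s ∈ Set.Ioc (0 : ℝ) 1) :
    A.halfArc h s ≠ A.pos v := by
  intro he
  have h0 : A.halfArc h s 0 = A.foot v := by rw [he]; rfl
  have h1 : A.halfArc h s 1 = 0 := by rw [he]; rfl
  rcases hs.2.eq_or_lt with rfl | hlt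
  · have : (A.far h : ℝ) = A.foot v := by simpa [halfArc] using h0
    exact A.far_ne_foot h v (by exact_mod_cast this)
  · exact A.ne_int_of_eq_zero h ⟨hs.1, hlt⟩ h1 _ h0

theorem halfArc_injective (h : H) {s t : ℝ} (he : A.halfArc h s = A.halfArc h t) : s = t := by
  have h0 : A.halfArc h s 0 = A.halfArc h t 0 := by rw [he]
  simp only [halfArc, PiLp.toLp_apply, Matrix.cons_val_zero] at h0
  have : (A.far h : ℝ) - A.foot (G.vert h) ≠ 0 := by
    rw [sub_ne_zero]
    exact_mod_cast A.far_ne_foot h (G.vert h)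
  exact mul_left_cancel₀ this (add_left_cancel h0)

theorem halfArc_eq_halfArc (h k : H) {s t : ℝ} (hs : s ∈ Set.Ioc (0 : ℝ) 1)
    (ht : t ∈ Set.Ioc (0 : ℝ) 1) (he : A.halfArc h s = A.halfArc k t) :
    (k = h ∧ t = s) ∨ (k = G.opp h ∧ s = 1 ∧ t = 1) := by
  have h0 : A.halfArc h s 0 = A.halfArc k t 0 := by rw [he]
  have h1 : A.halfArc h s 1 = A.halfArc k t 1 := by rw [he]
  have hx : ∀ h, A.halfArc h 1 0 = (A.far h : ℝ) := fun h => by simp [halfArc]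
  have hy : ∀ h, A.halfArc h 1 1 = 0 := fun h => by simp [halfArc]
  rcases hs.2.eq_or_lt with rfl | hs1
  · rcases ht.2.eq_or_lt with rfl | ht1
    · rw [hx, hx] at h0
      rcases A.eq_or_eq_of_far_eq h k (Int.cast_injective (α := ℝ) h0) with h | h
      · exact Or.inl ⟨h, rfl⟩
      · exact Or.inr ⟨h, rfl, rfl⟩
    · rw [hx] at h0
      rw [hy] at h1
      exact absurd h0.symm (A.ne_int_of_eq_zero k ⟨ht.1, ht1⟩ h1.symm _)
  · rcases ht.2.eq_or_lt with rfl | ht1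
    · rw [hx] at h0
      rw [hy] at h1
      exact absurd h0 (A.ne_int_of_eq_zero h ⟨hs.1, hs1⟩ h1 _)
    left
    by_cases hhk : h = k
    · subst hhk
      exact ⟨rfl, (A.halfArc_injective h he).symm⟩
    exfalso
    obtain ⟨l, r, hl, hr, a1, a2, a3⟩ := A.exists_interval h ⟨hs.1, hs1⟩
    obtain ⟨l', r', hl', hr', b1, b2, b3⟩ := A.exists_interval k ⟨ht.1, ht1⟩
    rw [← h0] at b1 b2 b3
    rw [← h1] at b3
    generalize A.halfArc h s 0 = x at *
    generalize A.halfArc h s 1 = y at *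
    have p1 := mul_pos (sub_pos.2 a1) (sub_pos.2 a2)
    have p2 := mul_pos (sub_pos.2 b1) (sub_pos.2 b2)
    by_cases hb : A.bend h = A.bend k
    · have c1 : l < r' := by exact_mod_cast a1.trans b2
      have c2 : l' < r := by exact_mod_cast b1.trans a2
      have := A.nested h k hhk hb l r l' r' hl hr hl' hr'
      have hn : A.bend h ≠ 0 ∧ ((l ≤ l' ∧ r' ≤ r ∧ (l < l' ∨ r' < r)) ∨
        (l' ≤ l ∧ r ≤ r' ∧ (l' < l ∨ r < r'))) := by omega
      obtain ⟨hn0, hn⟩ := hn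
      have heq : (x - l) * (r - x) = (x - l') * (r' - x) := by
        rw [a3, hb] at b3
        rw [hb] at hn0
        exact mul_left_cancel₀ (by exact_mod_cast hn0) b3
      have key : ∀ l r l' r' : ℝ, l ≤ l' → r' ≤ r → (l < l' ∨ r' < r) → l' < x → x < r' →
          (x - l) * (r - x) ≠ (x - l') * (r' - x) := by
        intro l r l' r' h1 h2 h3 h4 h5 h6
        rcases h3 with h3 | h3 <;> nlinarith
      rcases hn with ⟨n1, n2, n3⟩ | ⟨n1, n2, n3⟩
      · exact key l r l' r' (by exact_mod_cast n1) (by exact_mod_cast n2) (by exact_mod_cast n3)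
          b1 b2 heq
      · exact key l' r' l r (by exact_mod_cast n1) (by exact_mod_cast n2) (by exact_mod_cast n3)
          a1 a2 heq.symm
    · generalize (x - l) * (r - x) = p at *
      generalize (x - l') * (r' - x) = q at *
      rcases A.bend_eq h with e1 | e1 | e1 <;> rcases A.bend_eq k with e2 | e2 | e2 <;>
        rw [e1, e2] at hb <;> rw [e1] at a3 <;> rw [e2] at b3 <;> push_cast at a3 b3 <;>
        first
        | exact hb rfl
        | linarith

/-- The edge of `h`, parametrized by the unit interval. -/
noncomputable def arcFun (h : H) (t : ℝ) : EuclideanSpace ℝ (Fin 2) :=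
  if t ≤ 1 / 2 then A.halfArc h (2 * t) else A.halfArc (G.opp h) (2 * (1 - t))

theorem arcFun_opp (h : H) (t : ℝ) : A.arcFun (G.opp h) t = A.arcFun h (1 - t) := by
  unfold arcFun
  rcases lt_trichotomy t (1 / 2) with ht | rfl | ht
  · rw [if_pos ht.le, if_neg (by linarith), sub_sub_cancel]
  · rw [if_pos le_rfl, if_pos (by norm_num)]
    norm_num [A.halfArc_opp_one]
  · rw [if_neg (by linarith), if_pos (by linarith), G.opp_opp]

theorem continuous_arcFun (h : H) : Continuous (A.arcFun h) := by
  unfold arcFun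
  refine Continuous.if_le ((A.continuous_halfArc h).comp (by fun_prop))
    ((A.continuous_halfArc _).comp (by fun_prop)) continuous_id continuous_const ?_
  rintro t rfl
  norm_num [A.halfArc_opp_one]

/-- The plane drawing of an arch diagram. -/
noncomputable def drawing : G.PlaneDrawing where
  pos := A.pos
  arc h := ⟨fun t => A.arcFun h t, (A.continuous_arcFun h).comp continuous_subtype_val⟩
  arc_zero h := by simp [arcFun, halfArc_zero]
  arc_opp h t := by simp [arcFun_opp]
  pos_injective v w hvw := by
    have : (A.foot v : ℝ) = A.foot w := congrArg (fun p : EuclideanSpace ℝ (Fin 2) => p 0) hvw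
    exact A.foot_injective (by exact_mod_cast this)
  arc_ne_pos h v t ht := by
    have ht0 : (0 : ℝ) < t := ht.1
    have ht1 : (t : ℝ) < 1 := ht.2
    simp only [ContinuousMap.coe_mk, arcFun]
    split_ifs with hh
    · exact A.halfArc_ne_pos _ _ ⟨by linarith, by linarith⟩
    · exact A.halfArc_ne_pos _ _ ⟨by linarith, by linarith⟩
  arc_eq_arc h k s hs t ht he := by
    have hs0 : (0 : ℝ) < s := hs.1
    have hs1 : (s : ℝ) < 1 := hs.2
    have ht0 : (0 : ℝ) < t := ht.1
    have ht1 : (t : ℝ) < 1 := ht.2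
    simp only [Subtype.ext_iff, unitInterval.coe_symm_eq]
    simp only [ContinuousMap.coe_mk, arcFun] at he
    split_ifs at he with h1 h2 h2
    · rcases A.halfArc_eq_halfArc _ _ ⟨by linarith, by linarith⟩ ⟨by linarith, by linarith⟩ he with
        ⟨e1, e2⟩ | ⟨e1, e2, e3⟩
      · exact Or.inl ⟨e1, by linarith⟩
      · exact Or.inr ⟨e1, by linarith⟩
    · rcases A.halfArc_eq_halfArc _ _ ⟨by linarith, by linarith⟩ ⟨by linarith, by linarith⟩ he with
        ⟨e1, e2⟩ | ⟨e1, e2, e3⟩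
      · exact Or.inr ⟨by rw [← e1, G.opp_opp], by linarith⟩
      · exact absurd e3 (by linarith)
    · rcases A.halfArc_eq_halfArc _ _ ⟨by linarith, by linarith⟩ ⟨by linarith, by linarith⟩ he with
        ⟨e1, e2⟩ | ⟨e1, e2, e3⟩
      · exact Or.inr ⟨e1, by linarith⟩
      · exact absurd e2 (by linarith)
    · rcases A.halfArc_eq_halfArc _ _ ⟨by linarith, by linarith⟩ ⟨by linarith, by linarith⟩ he with
        ⟨e1, e2⟩ | ⟨e1, e2, e3⟩
      · exact Or.inl ⟨G.opp_injective e1, by linarith⟩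
      · exact absurd e2 (by linarith)

end ArchDiagram

end XGraph

/-! ### Small curves around a point of the line -/

/-- A closed curve around the point `(X, 0)`: an ellipse with the half-axes `2 * ρ` and `K`, squeezed
into the strip of the points at distance at most `ρ` from the vertical line through `(X, 0)`. -/
noncomputable def stripCurve (X ρ K u : ℝ) : EuclideanSpace ℝ (Fin 2) :=
  !₂[X + ρ * max (-1) (min 1 (2 * Real.sin (2 * Real.pi * u))), -(K * Real.cos (2 * Real.pi * u))]

section

variable {X ρ K : ℝ}

theorem stripCurve_apply_zero (u : ℝ) : stripCurve X ρ K u 0 =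
    X + ρ * max (-1) (min 1 (2 * Real.sin (2 * Real.pi * u))) := rfl

theorem stripCurve_apply_one (u : ℝ) : stripCurve X ρ K u 1 = -(K * Real.cos (2 * Real.pi * u)) :=
  rfl

theorem continuous_stripCurve : Continuous (stripCurve X ρ K) := by
  unfold stripCurve
  refine (PiLp.continuous_toLp 2 _).comp (continuous_pi fun i => ?_)
  fin_cases i <;> simp <;> fun_prop

theorem clamp_eq_or (a : ℝ) : (1 ≤ a ∧ max (-1) (min 1 a) = 1) ∨ (a ≤ -1 ∧ max (-1) (min 1 a) = -1) ∨
    (-1 < a ∧ a < 1 ∧ max (-1) (min 1 a) = a) := by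
  rcases le_or_gt 1 a with h | h
  · exact Or.inl ⟨h, by rw [min_eq_left h, max_eq_right (by norm_num)]⟩
  rcases le_or_gt a (-1) with h' | h'
  · exact Or.inr (Or.inl ⟨h', by rw [min_eq_right h.le, max_eq_left h']⟩)
  · exact Or.inr (Or.inr ⟨h', h, by rw [min_eq_right h.le, max_eq_right h'.le]⟩)

theorem isSimpleClosedCurve_stripCurve (hρ : 0 < ρ) (hK : 0 < K) :
    XGraph.IsSimpleClosedCurve (stripCurve X ρ K) where
  continuous := continuous_stripCurve
  periodic u := by
    unfold stripCurve
    rw [mul_add, mul_one, Real.sin_add_two_pi, Real.cos_add_two_pi]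
  injOn u hu w hw huw := by
    have h0 : stripCurve X ρ K u 0 = stripCurve X ρ K w 0 := by rw [huw]
    have h1 : stripCurve X ρ K u 1 = stripCurve X ρ K w 1 := by rw [huw]
    rw [stripCurve_apply_zero, stripCurve_apply_zero] at h0
    rw [stripCurve_apply_one, stripCurve_apply_one] at h1
    have hc := mul_left_cancel₀ hK.ne' (neg_injective h1)
    have hs := mul_left_cancel₀ hρ.ne' (add_left_cancel h0)
    have hsin : Real.sin (2 * Real.pi * u) = Real.sin (2 * Real.pi * w) := by
      have e1 := Real.sin_sq_add_cos_sq (2 * Real.pi * u)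
      have e2 := Real.sin_sq_add_cos_sq (2 * Real.pi * w)
      rw [hc] at e1
      rcases sq_eq_sq_iff_eq_or_eq_neg.1 (by linarith :
        Real.sin (2 * Real.pi * u) ^ 2 = Real.sin (2 * Real.pi * w) ^ 2) with h | h
      · exact h
      · rw [h] at hs ⊢
        rcases clamp_eq_or (2 * -Real.sin (2 * Real.pi * w)) with a | a | a <;>
          rcases clamp_eq_or (2 * Real.sin (2 * Real.pi * w)) with b | b | b <;> linarith
    have := Real.Angle.cos_sin_inj hc hsin
    rw [Real.Angle.angle_eq_iff_two_pi_dvd_sub] at this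
    obtain ⟨k, hk⟩ := this
    have hk' : u - w = k := by
      have : 2 * Real.pi * (u - w) = 2 * Real.pi * k := by linarith
      exact mul_left_cancel₀ Real.two_pi_pos.ne' this
    have a1 : (k : ℝ) < 1 := by rw [← hk']; linarith [hu.2, hw.1]
    have a2 : (-1 : ℝ) < k := by rw [← hk']; linarith [hu.1, hw.2]
    have a1 : k < 1 := by exact_mod_cast a1
    have a2 : -1 < k := by exact_mod_cast a2
    obtain rfl : k = 0 := by omega
    rw [Int.cast_zero] at hk'
    linarith

theorem exists_stripCurve_eq {q : EuclideanSpace ℝ (Fin 2)} {c s : ℝ}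
    (hcs : c ^ 2 + s ^ 2 = 1) (h0 : q 0 = X + ρ * max (-1) (min 1 (2 * c))) (h1 : q 1 = K * s) :
    q ∈ Set.range (stripCurve X ρ K) := by
  have hz : ‖(⟨-s, c⟩ : ℂ)‖ = 1 := by
    rw [Complex.norm_eq_sqrt_sq_add_sq, neg_sq, add_comm, hcs, Real.sqrt_one]
  have hne : (⟨-s, c⟩ : ℂ) ≠ 0 := by
    rw [← norm_pos_iff, hz]; exact one_pos
  refine ⟨Complex.arg ⟨-s, c⟩ / (2 * Real.pi), ?_⟩
  have harg : 2 * Real.pi * (Complex.arg ⟨-s, c⟩ / (2 * Real.pi)) = Complex.arg ⟨-s, c⟩ := by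
    field_simp
  have hcos : Real.cos (Complex.arg ⟨-s, c⟩) = -s := by
    rw [Complex.cos_arg hne, hz, div_one]
  have hsin : Real.sin (Complex.arg ⟨-s, c⟩) = c := by
    rw [Complex.sin_arg, hz, div_one]
  ext i
  fin_cases i
  · change stripCurve X ρ K _ 0 = q 0
    rw [stripCurve_apply_zero, harg, hsin, h0]
  · change stripCurve X ρ K _ 1 = q 1
    rw [stripCurve_apply_one, harg, hcos, h1]
    ring

/-- The distance to the centre, in terms of the coordinates. -/
theorem dist_point_le {a b : ℝ} {q : EuclideanSpace ℝ (Fin 2)} (h0 : |q 0 - X| ≤ a) (h1 : |q 1| ≤ b) :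
    dist q !₂[X, 0] ≤ a + b := by
  have ha : 0 ≤ a := (abs_nonneg _).trans h0
  have hb : 0 ≤ b := (abs_nonneg _).trans h1
  rw [EuclideanSpace.dist_eq, Fin.sum_univ_two]
  refine Real.sqrt_le_iff.2 ⟨by positivity, ?_⟩
  have e0 : dist (q 0) ((!₂[X, 0] : EuclideanSpace ℝ (Fin 2)) 0) = |q 0 - X| := rfl
  have e1 : dist (q 1) ((!₂[X, 0] : EuclideanSpace ℝ (Fin 2)) 1) = |q 1| := by
    rw [Real.dist_eq]; simp
  rw [e0, e1]
  nlinarith [abs_nonneg (q 0 - X), abs_nonneg (q 1)]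

theorem encloses_stripCurve (hρ : 0 < ρ) (hK : 0 < K) :
    XGraph.Encloses (stripCurve X ρ K) !₂[X, 0] := by
  -- The curve contains all points at which `F` takes the value `1`.
  let F : EuclideanSpace ℝ (Fin 2) → ℝ := fun q =>
    max (|q 0 - X| / ρ) ((q 0 - X) ^ 2 / (2 * ρ) ^ 2 + q 1 ^ 2 / K ^ 2)
  have hF : Continuous F := by
    have h0 : Continuous fun q : EuclideanSpace ℝ (Fin 2) => q 0 := by fun_prop
    have h1 : Continuous fun q : EuclideanSpace ℝ (Fin 2) => q 1 := by fun_prop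
    simp only [F]
    fun_prop
  have hrange : ∀ q, F q = 1 → q ∈ Set.range (stripCurve X ρ K) := by
    intro q hq
    have a1 : |q 0 - X| ≤ ρ := by
      have := (le_max_left (|q 0 - X| / ρ) _).trans hq.le
      rwa [div_le_one hρ] at this
    have a2 := (le_max_right (|q 0 - X| / ρ) _).trans hq.le
    have hKs : q 1 = K * (q 1 / K) := by field_simp
    rcases max_choice (|q 0 - X| / ρ) ((q 0 - X) ^ 2 / (2 * ρ) ^ 2 + q 1 ^ 2 / K ^ 2) with h | h
    · have habs : |q 0 - X| = ρ := by
        have := h.symm.trans hq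
        rwa [div_eq_one_iff_eq hρ.ne'] at this
      have hsq : (q 0 - X) ^ 2 = ρ ^ 2 := by rw [← sq_abs, habs]
      have hs : (q 1 / K) ^ 2 ≤ 3 / 4 := by
        rw [hsq] at a2
        have : ρ ^ 2 / (2 * ρ) ^ 2 = 1 / 4 := by field_simp; norm_num
        rw [div_pow]
        linarith
      have hroot : 1 / 2 ≤ √(1 - (q 1 / K) ^ 2) :=
        Real.le_sqrt_of_sq_le (by linarith)
      have hrs := Real.sq_sqrt (show 0 ≤ 1 - (q 1 / K) ^ 2 by linarith)
      rcases (abs_eq hρ.le).1 habs with hc | hc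
      · refine exists_stripCurve_eq (c := √(1 - (q 1 / K) ^ 2)) (by rw [hrs]; ring) ?_ hKs
        rw [min_eq_left (by linarith), max_eq_right (by norm_num)]
        linarith
      · refine exists_stripCurve_eq (c := -√(1 - (q 1 / K) ^ 2)) (by rw [neg_sq, hrs]; ring) ?_
          hKs
        rw [min_eq_right (by linarith), max_eq_left (by linarith)]
        linarith
    · refine exists_stripCurve_eq (c := (q 0 - X) / (2 * ρ)) ?_ ?_ hKs
      · rw [div_pow, div_pow]
        exact h.symm.trans hq
      · have e : 2 * ((q 0 - X) / (2 * ρ)) = (q 0 - X) / ρ := by field_simp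
        have := abs_le.1 a1
        rw [e, min_eq_right ((div_le_one hρ).2 this.2),
          max_eq_right (by rw [le_div_iff₀ hρ]; linarith)]
        field_simp
        ring
  have hF0 : F !₂[X, 0] = 0 := by simp [F]
  have hp : (!₂[X, 0] : EuclideanSpace ℝ (Fin 2)) ∉ Set.range (stripCurve X ρ K) := by
    rintro ⟨u, hu⟩
    have h0 : stripCurve X ρ K u 0 = X := by rw [hu]; rfl
    have h1 : stripCurve X ρ K u 1 = 0 := by rw [hu]; rfl
    rw [stripCurve_apply_zero] at h0
    rw [stripCurve_apply_one, neg_eq_zero, mul_eq_zero, or_iff_right hK.ne'] at h1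
    rw [add_eq_left, mul_eq_zero, or_iff_right hρ.ne'] at h0
    have := Real.sin_sq_add_cos_sq (2 * Real.pi * u)
    rw [h1] at this
    rcases clamp_eq_or (2 * Real.sin (2 * Real.pi * u)) with a | a | a
    · linarith
    · linarith
    · have hsin : Real.sin (2 * Real.pi * u) = 0 := by linarith
      rw [hsin] at this
      norm_num at this
  refine ⟨hp, ?_⟩
  have hlt : ∀ q ∈ connectedComponentIn (Set.range (stripCurve X ρ K))ᶜ !₂[X, 0], F q < 1 := by
    intro q hq
    by_contra! hge
    have hpre : IsPreconnected (F '' connectedComponentIn (Set.range (stripCurve X ρ K))ᶜ !₂[X, 0]) :=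
      isPreconnected_connectedComponentIn.image F hF.continuousOn
    have := hpre.ordConnected.out ⟨_, mem_connectedComponentIn hp, hF0⟩ ⟨q, hq, rfl⟩
      ⟨zero_le_one, hge⟩
    obtain ⟨z, hz, hz1⟩ := this
    exact connectedComponentIn_subset _ _ hz (hrange z hz1)
  refine (Metric.isBounded_closedBall (x := (!₂[X, 0] : EuclideanSpace ℝ (Fin 2)))
    (r := ρ + K)).subset fun q hq => ?_
  have h1 := hlt q hq
  have a1 : |q 0 - X| ≤ ρ := by
    have := (le_max_left (|q 0 - X| / ρ) _).trans h1.le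
    rwa [div_le_one hρ] at this
  have a2 : |q 1| ≤ K := by
    have h2 := (le_max_right (|q 0 - X| / ρ) _).trans h1.le
    have h3 : q 1 ^ 2 / K ^ 2 ≤ 1 := by
      have : 0 ≤ (q 0 - X) ^ 2 / (2 * ρ) ^ 2 := by positivity
      linarith
    rw [div_le_one (by positivity)] at h3
    exact abs_le_of_sq_le_sq h3 hK.le
  exact Metric.mem_closedBall.2 (dist_point_le a1 a2)

theorem abs_stripCurve_le (hρ : 0 < ρ) (hK : 0 < K) (u : ℝ) :
    |stripCurve X ρ K u 0 - X| ≤ ρ ∧ |stripCurve X ρ K u 1| ≤ K := by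
  rw [stripCurve_apply_zero, stripCurve_apply_one, add_sub_cancel_left, abs_mul, abs_neg, abs_mul,
    abs_of_pos hρ, abs_of_pos hK]
  refine ⟨mul_le_of_le_one_right hρ.le (abs_le.2 ⟨le_max_left _ _, ?_⟩),
    mul_le_of_le_one_right hK.le (Real.abs_cos_le_one _)⟩
  exact max_le (by norm_num) (min_le_left _ _)

/-- Near the line, the curve consists of the two vertical sides of the strip. -/
theorem abs_stripCurve_eq (hρ : 0 < ρ) (hK : 0 < K) {u : ℝ} (hu : |stripCurve X ρ K u 1| ≤ K / 2) :
    |stripCurve X ρ K u 0 - X| = ρ := by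
  rw [stripCurve_apply_one, abs_neg, abs_mul, abs_of_pos hK] at hu
  have h1 : |Real.cos (2 * Real.pi * u)| ≤ 1 / 2 := by
    by_contra! h
    nlinarith
  have h2 : Real.cos (2 * Real.pi * u) ^ 2 ≤ (1 / 2) ^ 2 := sq_le_sq' (by linarith [(abs_le.1 h1).1])
    (abs_le.1 h1).2
  have h3 := Real.sin_sq_add_cos_sq (2 * Real.pi * u)
  rw [stripCurve_apply_zero, add_sub_cancel_left, abs_mul, abs_of_pos hρ]
  rcases clamp_eq_or (2 * Real.sin (2 * Real.pi * u)) with a | a | a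
  · rw [a.2]; simp
  · rw [a.2]; simp
  · nlinarith

theorem stripCurve_three_quarters : stripCurve X ρ K (3 / 4) = !₂[X - ρ, 0] := by
  have e : 2 * Real.pi * (3 / 4) = Real.pi / 2 + Real.pi := by ring
  unfold stripCurve
  rw [e, Real.sin_add_pi, Real.cos_add_pi, Real.sin_pi_div_two, Real.cos_pi_div_two,
    min_eq_right (by norm_num), max_eq_left (by norm_num)]
  ext i
  fin_cases i
  · simp; ring
  · simp

/-- The points of the right side of the strip, in the order of their heights. -/
theorem stripCurve_arccos (hK : 0 < K) {y : ℝ} (hy : |y| ≤ K / 2) :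
    stripCurve X ρ K (Real.arccos (-y / K) / (2 * Real.pi)) = !₂[X + ρ, y] := by
  have e : 2 * Real.pi * (Real.arccos (-y / K) / (2 * Real.pi)) = Real.arccos (-y / K) := by
    field_simp
  have h1 : |-y / K| ≤ 1 / 2 := by
    rw [abs_div, abs_neg, abs_of_pos hK, div_le_iff₀ hK]
    linarith
  have h2 := abs_le.1 h1
  have h3 : (-y / K) ^ 2 ≤ (1 / 2) ^ 2 := sq_le_sq' h2.1 h2.2
  unfold stripCurve
  rw [e, Real.cos_arccos (by linarith) (by linarith), Real.sin_arccos]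
  have : 1 / 2 ≤ √(1 - (-y / K) ^ 2) := Real.le_sqrt_of_sq_le (by linarith)
  rw [min_eq_left (by linarith), max_eq_right (by norm_num)]
  ext i
  fin_cases i
  · simp
  · simp; field_simp

end

/-! ### Alternation of the pairs in the drawing by arches -/

namespace XGraph

variable {V H : Type*} {G : XGraph V H}

namespace ArchDiagram

variable (A : G.ArchDiagram)

theorem mem_image_drawing {q : EuclideanSpace ℝ (Fin 2)} (hq : q ∈ A.drawing.image) :
    (∃ w, q = A.pos w) ∨ ∃ k, ∃ s ∈ Set.Ioc (0 : ℝ) 1, q = A.halfArc k s := by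
  have key : ∀ k, ∀ s ∈ Set.Icc (0 : ℝ) 1,
      (∃ w, A.halfArc k s = A.pos w) ∨ ∃ k', ∃ s' ∈ Set.Ioc (0 : ℝ) 1,
        A.halfArc k s = A.halfArc k' s' := by
    intro k s hs
    rcases hs.1.eq_or_lt with rfl | h
    · exact Or.inl ⟨_, A.halfArc_zero k⟩
    · exact Or.inr ⟨k, s, ⟨h, hs.2⟩, rfl⟩
  rcases hq with ⟨w, rfl⟩ | hq
  · exact Or.inl ⟨w, rfl⟩
  · obtain ⟨k, s, rfl⟩ := Set.mem_iUnion.1 hq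
    change (∃ w, A.arcFun k s = A.pos w) ∨ ∃ k', ∃ s' ∈ Set.Ioc (0 : ℝ) 1,
      A.arcFun k s = A.halfArc k' s'
    have h0 := s.2.1
    have h1 := s.2.2
    unfold arcFun
    split_ifs
    · exact key _ _ ⟨by linarith, by linarith⟩
    · exact key _ _ ⟨by linarith, by linarith⟩

/-- Only the arches starting at `v` come close to the position of `v`. -/
theorem vert_eq_of_halfArc_near {v : V} {k : H} {s : ℝ} (hs : s ∈ Set.Ioc (0 : ℝ) 1)
    (h0 : |A.halfArc k s 0 - (A.foot v : ℝ)| ≤ 1 / 4) (h1 : |A.halfArc k s 1| ≤ 1 / 2) :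
    G.vert k = v := by
  have h0 := abs_le.1 h0
  rcases hs.2.eq_or_lt with rfl | hs1
  · have hx : A.halfArc k 1 0 = (A.far k : ℝ) := by simp [halfArc]
    rw [hx] at h0
    have e1 : (A.far k : ℝ) < A.foot v + 1 := by linarith
    have e2 : (A.foot v : ℝ) < A.far k + 1 := by linarith
    have e1 : A.far k < A.foot v + 1 := by exact_mod_cast e1
    have e2 : A.foot v < A.far k + 1 := by exact_mod_cast e2
    exact absurd (by omega) (A.far_ne_foot k v)
  by_contra hkv
  have hfoot : A.foot (G.vert k) ≠ A.foot v := A.foot_injective.ne hkv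
  have hfar := A.far_ne_foot k v
  obtain ⟨l, r, hl, hr, a1, a2, a3⟩ := A.exists_interval k ⟨hs.1, hs1⟩
  generalize A.halfArc k s 0 = x at *
  generalize A.halfArc k s 1 = y at *
  have e1 : (l : ℝ) < A.foot v + 1 := by linarith
  have e2 : (A.foot v : ℝ) < r + 1 := by linarith
  have e1 : l < A.foot v + 1 := by exact_mod_cast e1
  have e2 : A.foot v < r + 1 := by exact_mod_cast e2
  have f1 : l + 1 ≤ A.foot v := by omega
  have f2 : A.foot v + 1 ≤ r := by omega
  have hb : A.bend k ≠ 0 := fun hb => by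
    have := A.far_of_bend_eq_zero k hb
    omega
  have f1 : (l + 1 : ℝ) ≤ A.foot v := by exact_mod_cast f1
  have f2 : (A.foot v + 1 : ℝ) ≤ r := by exact_mod_cast f2
  have hprod : 9 / 16 ≤ (x - l) * (r - x) := by nlinarith
  have habs : |y| = (x - l) * (r - x) := by
    rw [a3, abs_mul, abs_of_pos (a := (x - l) * (r - x)) (by linarith)]
    rcases A.bend_eq k with h | h | h
    · simp [h]
    · simp [h]
    · exact absurd h hb
  linarith

/-- The point of an arch at the horizontal distance `ρ` from its vertex. -/
theorem halfArc_div_of_lt {h : H} {v : V} (hv : G.vert h = v) (hlt : A.foot v < A.far h) (ρ : ℝ) :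
    A.halfArc h (ρ / |(A.far h : ℝ) - A.foot v|) =
      !₂[A.foot v + ρ, A.bend h * (ρ * ((A.far h : ℝ) - A.foot v - ρ))] := by
  subst hv
  have hD : (0 : ℝ) < A.far h - A.foot (G.vert h) := sub_pos.2 (by exact_mod_cast hlt)
  rw [abs_of_pos hD, halfArc]
  congr 2
  · field_simp
  · congr 1
    field_simp

theorem halfArc_div_of_gt {h : H} {v : V} (hv : G.vert h = v) (hlt : A.far h < A.foot v) (ρ : ℝ) :
    A.halfArc h (ρ / |(A.far h : ℝ) - A.foot v|) = !₂[A.foot v - ρ, 0] := by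
  subst hv
  have hD : (A.far h : ℝ) - A.foot (G.vert h) < 0 := sub_neg.2 (by exact_mod_cast hlt)
  rw [abs_of_neg hD, halfArc, A.bend_eq_zero_of_far_lt h hlt]
  have : ((A.far h : ℝ) - A.foot (G.vert h)) * (ρ / -((A.far h : ℝ) - A.foot (G.vert h))) = -ρ := by
    have := hD.ne
    field_simp
  rw [this]
  simp [sub_eq_add_neg]

/-- The small curve around `v` is a `stripCurve` so flat that inside it all arches at `v` stay at
heights at most `K / 2`; hence they leave it through the vertical sides of the strip, in the order of
their heights at the distance `ρ`, which is the order given by `exists_order`. -/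
theorem alternatesAt [Finite H] (v : V) : A.drawing.AlternatesAt v := by
  intro ε hε
  obtain ⟨M, hM1, hM⟩ : ∃ M : ℝ, 1 ≤ M ∧ ∀ h, |(A.far h : ℝ) - A.foot (G.vert h)| ≤ M := by
    obtain ⟨M, hM⟩ :=
      (Set.finite_range fun h => |(A.far h : ℝ) - A.foot (G.vert h)|).bddAbove
    exact ⟨max 1 M, le_max_left _ _, fun h => (hM ⟨h, rfl⟩).trans (le_max_right _ _)⟩
  obtain ⟨ρ, hρ, hρ1, hρε⟩ : ∃ ρ : ℝ, 0 < ρ ∧ ρ * M ≤ 1 / 4 ∧ ρ * M < ε / 3 := by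
    have h := lt_min (show (0 : ℝ) < 1 / 4 by norm_num) (show 0 < ε / 4 by linarith)
    refine ⟨min (1 / 4) (ε / 4) / M, by positivity, ?_, ?_⟩
    · rw [div_mul_cancel₀ _ (by positivity)]
      exact min_le_left _ _
    · rw [div_mul_cancel₀ _ (by positivity)]
      exact (min_le_right _ _).trans_lt (by linarith)
  have hρM : ρ ≤ ρ * M := le_mul_of_one_le_right hρ.le hM1
  obtain ⟨K, hKdef⟩ : ∃ K, K = 2 * (ρ * M) := ⟨_, rfl⟩
  have hK : 0 < K := by rw [hKdef]; positivity
  let γ := stripCurve (A.foot v) ρ K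
  have hγ : IsSimpleClosedCurve γ := isSimpleClosedCurve_stripCurve hρ hK
  have henc : Encloses γ (A.pos v) := encloses_stripCurve hρ hK
  have hD1 : ∀ h, 1 ≤ |(A.far h : ℝ) - A.foot v| := by
    intro h
    have := Int.one_le_abs (sub_ne_zero.2 (A.far_ne_foot h v))
    exact_mod_cast this
  obtain ⟨h, hvert, hp0, hp1, hord⟩ := A.exists_order v
  -- the height at which an arch leaves the strip to the right, and the parameter of this point
  let Y : H → ℝ := fun h => A.bend h * (ρ * ((A.far h : ℝ) - A.foot v - ρ))
  let T : H → ℝ := fun h =>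
    if A.foot v < A.far h then Real.arccos (-Y h / K) / (2 * Real.pi) else 3 / 4
  have hY : ∀ h, G.vert h = v → A.foot v < A.far h → |Y h| ≤ K / 2 := by
    intro h hv hlt
    have h1 := (le_abs_self _).trans (hM h)
    have h2 := hD1 h
    rw [hv] at h1
    rw [abs_of_pos (sub_pos.2 (by exact_mod_cast hlt))] at h2
    have h3 : 0 ≤ ρ * ((A.far h : ℝ) - A.foot v - ρ) := mul_nonneg hρ.le (by linarith)
    have h4 : ρ * ((A.far h : ℝ) - A.foot v - ρ) ≤ ρ * M :=
      mul_le_mul_of_nonneg_left (by linarith) hρ.le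
    have h5 : |(A.bend h : ℝ)| ≤ 1 := by
      rcases A.bend_eq h with e | e | e <;> simp [e]
    change |(A.bend h : ℝ) * _| ≤ _
    rw [abs_mul, abs_of_nonneg h3]
    nlinarith [abs_nonneg (A.bend h : ℝ)]
  have hYK : ∀ h, G.vert h = v → A.foot v < A.far h → -1 ≤ -Y h / K ∧ -Y h / K ≤ 1 := by
    intro h hv hlt
    have := abs_le.1 (hY h hv hlt)
    rw [le_div_iff₀ hK, div_le_iff₀ hK]
    constructor <;> linarith
  have hT : ∀ h, G.vert h = v → γ (T h) = A.halfArc h (ρ / |(A.far h : ℝ) - A.foot v|) := by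
    intro h hv
    by_cases hlt : A.foot v < A.far h
    · rw [A.halfArc_div_of_lt hv hlt]
      simp only [T, if_pos hlt]
      exact stripCurve_arccos hK (hY h hv hlt)
    · rw [A.halfArc_div_of_gt hv (lt_of_le_of_ne (not_lt.1 hlt) (A.far_ne_foot h v))]
      simp only [T, if_neg hlt]
      exact stripCurve_three_quarters
  have hThalf : ∀ h, A.foot v < A.far h → 0 ≤ T h ∧ T h ≤ 1 / 2 := by
    intro h hlt
    simp only [T, if_pos hlt]
    have h1 := Real.arccos_nonneg (-Y h / K)
    have h2 := Real.arccos_le_pi (-Y h / K)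
    refine ⟨by positivity, ?_⟩
    rw [div_le_iff₀ Real.two_pi_pos]
    linarith
  have hTmem : ∀ h, T h ∈ Set.Ico (0 : ℝ) 1 := by
    intro h
    by_cases hlt : A.foot v < A.far h
    · have := hThalf h hlt
      exact ⟨this.1, by linarith⟩
    · simp only [T, if_neg hlt]
      norm_num
  have hmono : StrictMono fun i => T (h i) := by
    intro i j hij
    obtain ⟨hi, hj | hj⟩ := hord i j hij
    · refine (hThalf _ hi).2.trans_lt ?_
      simp only [T, if_neg (not_lt.2 hj.le)]
      norm_num
    · by_cases hjf : A.foot v < A.far (h j)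
      · simp only [T, if_pos hi, if_pos hjf]
        refine div_lt_div_of_pos_right ?_ Real.two_pi_pos
        refine Real.strictAntiOn_arccos (hYK _ (hvert j) hjf) (hYK _ (hvert i) hi) ?_
        refine div_lt_div_of_pos_right (neg_lt_neg ?_) hK
        -- the integers on both sides differ by at least one, which outweighs the terms with `ρ`
        have e1 : A.bend (h i) * (A.far (h i) - A.foot v) + 1 ≤
          A.bend (h j) * (A.far (h j) - A.foot v) := hj
        have e1 : (A.bend (h i) * (A.far (h i) - A.foot v) + 1 : ℝ) ≤
          A.bend (h j) * (A.far (h j) - A.foot v) := by exact_mod_cast e1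
        have e2 : (A.bend (h j) : ℝ) ≤ 1 ∧ (-1 : ℝ) ≤ A.bend (h i) := by
          constructor
          · rcases A.bend_eq (h j) with e | e | e <;> rw [e] <;> norm_num
          · rcases A.bend_eq (h i) with e | e | e <;> rw [e] <;> norm_num
        have e3 : (A.bend (h j) * ρ - A.bend (h i) * ρ : ℝ) ≤ 2 * ρ := by nlinarith
        have e4 : (A.bend (h i) * ((A.far (h i) : ℝ) - A.foot v - ρ)) <
          A.bend (h j) * ((A.far (h j) : ℝ) - A.foot v - ρ) := by linarith
        have := mul_lt_mul_of_pos_left e4 hρ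
        simp only [Y]
        linarith
      · refine (hThalf _ hi).2.trans_lt ?_
        simp only [T, if_neg hjf]
        norm_num
  have hinj : Function.Injective h := fun i j hij => hmono.injective (congrArg T hij)
  have hall : ∀ k, G.vert k = v → ∃ i, h i = k := by
    intro k hk
    obtain ⟨i, hi⟩ := G.exists_eq_of_vert_eq hinj hvert hk
    exact ⟨i, hi.symm⟩
  have hnpos : ∀ u w, γ u ≠ A.pos w := by
    intro u w hw
    have h0 := (abs_stripCurve_le (X := A.foot v) hρ hK u).1
    have e : stripCurve (A.foot v) ρ K u 0 = (A.foot w : ℝ) := by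
      change γ u 0 = _
      rw [hw]; rfl
    rw [e] at h0
    have h0 := abs_le.1 h0
    have e1 : (A.foot w : ℝ) < A.foot v + 1 := by linarith
    have e2 : (A.foot v : ℝ) < A.foot w + 1 := by linarith
    have e1 : A.foot w < A.foot v + 1 := by exact_mod_cast e1
    have e2 : A.foot v < A.foot w + 1 := by exact_mod_cast e2
    obtain rfl : w = v := A.foot_injective (by omega)
    exact henc.1 ⟨u, hw⟩
  refine ⟨γ, hγ, henc, ?_, h, fun i => T (h i), hinj, hvert, hp0, hp1, hmono, fun i => hTmem _,
    fun i => ?_, fun u hu hmem => ?_⟩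
  · rintro _ ⟨u, rfl⟩
    obtain ⟨h0, h1⟩ := abs_stripCurve_le (X := A.foot v) hρ hK u
    exact Metric.mem_ball.2 ((dist_point_le h0 h1).trans_lt (by linarith))
  · have h1 := hD1 (h i)
    have h2 : ρ / |(A.far (h i) : ℝ) - A.foot v| ≤ ρ := div_le_self hρ.le h1
    have h3 : 0 < ρ / |(A.far (h i) : ℝ) - A.foot v| := by positivity
    refine ⟨⟨ρ / |(A.far (h i) : ℝ) - A.foot v| / 2, by linarith, by linarith⟩, by
      change ρ / |(A.far (h i) : ℝ) - A.foot v| / 2 < 1 / 2; linarith, ?_⟩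
    change γ (T (h i)) = A.arcFun (h i) (ρ / |(A.far (h i) : ℝ) - A.foot v| / 2)
    rw [hT _ (hvert i), arcFun, if_pos (by linarith), mul_div_cancel₀ _ two_ne_zero]
  · rcases A.mem_image_drawing hmem with ⟨w, hw⟩ | ⟨k, s, hs, hk⟩
    · exact absurd hw (hnpos u w)
    obtain ⟨h0, h1⟩ := abs_stripCurve_le (X := A.foot v) hρ hK u
    have hkv : G.vert k = v := by
      change |γ u 0 - _| ≤ _ at h0
      change |γ u 1| ≤ _ at h1
      rw [hk] at h0 h1
      exact A.vert_eq_of_halfArc_near hs (h0.trans (by linarith)) (h1.trans (by linarith))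
    obtain ⟨i, rfl⟩ := hall k hkv
    refine ⟨i, hγ.injOn hu (hTmem _) ?_⟩
    rw [hT _ (hvert i), hk]
    have hx : |A.halfArc (h i) s 0 - (A.foot v : ℝ)| = |(A.far (h i) : ℝ) - A.foot v| * s := by
      have : A.halfArc (h i) s 0 - (A.foot v : ℝ) = ((A.far (h i) : ℝ) - A.foot v) * s := by
        simp only [halfArc, hkv, PiLp.toLp_apply, Matrix.cons_val_zero]
        ring
      rw [this, abs_mul, abs_of_pos hs.1]
    have hside : |stripCurve (A.foot v) ρ K u 0 - A.foot v| = ρ := by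
      refine abs_stripCurve_eq hρ hK ?_
      change |γ u 0 - _| ≤ _ at h0
      change |γ u 1| ≤ _
      rw [hk] at h0 ⊢
      rw [hx] at h0
      have hy : A.halfArc (h i) s 1 =
          A.bend (h i) * ((A.far (h i) : ℝ) - A.foot v) ^ 2 * (s * (1 - s)) := by
        simp [halfArc, hkv]
      have hDM := hM (h i)
      rw [hkv] at hDM
      have hb : |(A.bend (h i) : ℝ)| ≤ 1 := by
        rcases A.bend_eq (h i) with e | e | e <;> simp [e]
      have hs0 := hs.1
      have hs1 := hs.2
      rw [hy, abs_mul, abs_mul, abs_of_nonneg (a := s * (1 - s)) (by nlinarith), abs_pow]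
      have hD0 := abs_nonneg ((A.far (h i) : ℝ) - A.foot v)
      generalize |(A.far (h i) : ℝ) - A.foot v| = D at h0 hDM hD0 ⊢
      have hDs : D * (1 - s) ≤ M := (mul_le_of_le_one_right hD0 (by linarith)).trans hDM
      have hprod : D * s * (D * (1 - s)) ≤ ρ * M :=
        mul_le_mul h0 hDs (mul_nonneg hD0 (by linarith)) hρ.le
      have hprod0 : 0 ≤ D * s * (D * (1 - s)) :=
        mul_nonneg (mul_nonneg hD0 hs0.le) (mul_nonneg hD0 (by linarith))
      calc |(A.bend (h i) : ℝ)| * D ^ 2 * (s * (1 - s))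
          = |(A.bend (h i) : ℝ)| * (D * s * (D * (1 - s))) := by ring
        _ ≤ D * s * (D * (1 - s)) := mul_le_of_le_one_left hprod0 hb
        _ ≤ K / 2 := by linarith
    change |γ u 0 - _| = _ at hside
    rw [hk, hx] at hside
    congr 1
    rw [eq_div_iff (by linarith [hD1 (h i)]), mul_comm]
    exact hside

/-- A graph with an arch diagram is `X`-planar. -/
theorem isXPlanar [Finite H] (A : G.ArchDiagram) : G.IsXPlanar := ⟨A.drawing, A.alternatesAt⟩

end ArchDiagram

end XGraph

/-! ### The planarity criterion -/

namespace XGraph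

variable {V H : Type*}

theorem isXPlanar_of_even_crossings [Fintype H] (G : XGraph V H)
    (hP : ∀ f g : H → ZMod 2, G.IsEven f → G.IsEven g → (∀ h, f h * g h = 0) →
      Even (G.crossings f g).ncard) : G.IsXPlanar := by
  obtain ⟨L⟩ := G.exists_layout hP
  obtain ⟨C⟩ := L.colorable_interlaceGraph hP
  have hC : ∀ v, C v = 0 ∨ C v = 1 := fun v => by
    generalize C v = i
    fin_cases i <;> simp
  let c : V → ℤ := fun v => if C v = 0 then 1 else -1
  refine (L.archDiagram c (fun v => ?_) (fun v w hvw he => C.valid hvw ?_)).isXPlanar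
  · simp only [c]
    split_ifs <;> simp
  · simp only [c] at he
    rcases hC v with hv | hv <;> rcases hC w with hw | hw <;> simp [hv, hw] at he ⊢

end XGraph

theorem mainTheorem1 {V H : Type*} [Finite V] (G : XGraph V H) :
    G.IsXPlanar ↔
      ¬ ∃ C D : G.SimpleCycle, C.EdgeDisjoint D ∧ ∃! v, C.IsCrossingVertex D v := by
  refine ⟨fun hG => hG.not_exists_unique_crossing, fun hG => ?_⟩
  have := G.finite_halfEdges
  have := Fintype.ofFinite H
  refine G.isXPlanar_of_even_crossings fun f g hf hg hfg => ?_
  by_contra hodd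
  exact hG (XGraph.exists_unique_crossing_of_odd f g hf hg hfg (Nat.not_even_iff_odd.1 hodd))
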